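/- **Theorem (Score Learning with Decision Trees).** All logarithms are to base $2$. *Model.* Let $\boldsymbol m:\{0,1\}^d\to[0,1]^k$, let $\mathcal D_x$ be a probability distribution on $\{0,1\}^d$, and let $\mathcal E$ be a probability distribution on $[-1/4,1/4]^k$ all of whose coordinates have mean zero. A sample $(\boldsymbol x,\boldsymbol y)\sim\mathcal D$ is $\boldsymbol x\sim\mathcal D_x$, $\boldsymbol y=\boldsymbol m(\boldsymbol x)+\boldsymbol\xi$ with $\boldsymbol\xi\sim\mathcal E$ independent of $\boldsymbol x$. Let $r\ge 1$ be an integer, and suppose that every coordinate $m_i$ is $r$-sparse, i.e. depends only on the coordinates in some set $R_i\subseteq[d]$ with $|R_i|=r$. *Conditions, for $C\ge1$ and $f:\{0,1\}^d\to\mathbb R$.* For $S\subseteq[d]$ put $\widetilde V(S)=\mathbf E_{\boldsymbol x\sim\mathcal D_x}\big[\mathbf E_{\boldsymbol w\sim\mathcal D_x}[f(\boldsymbol w)\mid \boldsymbol w_S=\boldsymbol x_S]^2\big]$; $f$ is *$C$-approximately submodular* if $\widetilde V(T\cup\{i\})-\widetilde V(T)\le C(\widetilde V(S\cup\{i\})-\widetilde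 V(S))$ for all $S\subseteq T\subseteq[d]$ and $i\in[d]$. For a cell (subcube) $A$ and $T\subseteq[d]$ put $\widetilde V_\ell(A,T)=\mathbf E_{\boldsymbol x\sim\mathcal D_x}\big[\mathbf E_{\boldsymbol z\sim\mathcal D_x}[f(\boldsymbol z)\mid \boldsymbol z\in A,\boldsymbol z_T=\boldsymbol x_T]^2\mid \boldsymbol x\in A\big]$ (and $0$ if $A$ is null); $f$ has *$C$-approximate diminishing returns* if $\widetilde V_\ell(A',T\cup\{i\})-\widetilde V_\ell(A',T)\le C(\widetilde V_\ell(A,\{i\})-\widetilde V_\ell(A,\emptyset))$ for all cells $A'\subseteq A$, all $T\subseteq[d]$ and $i\in[d]$. *Algorithms.* From $n$ i.i.d. samples, a regression tree is fitted separately to each of the $k$ data sets $(\boldsymbol x^{(j)},y^{(j)}_i)_{j\le n}$; ties between directions are broken in favour of the smallest index, and a leaf predicts the average label of the training samples in it (and $0$ if there is none). - *Level-Splits with $H$ levels.* Starting from $S=\emptyset$, $H$ times add to $S$ a direction $i\in[d]$ that maximizes $V_n(S\cup\{i\})$, where $V_n(S)=\frac1n\sum_j f^{(n)}(\boldsymbol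 x^{(j)};S)^2$ and $f^{(n)}(\boldsymbol x;S)$ is the average label of the samples that agree with $\boldsymbol x$ on $S$. At each level all cells are split in the chosen direction, except those with a half that would contain no training sample. - *Breiman with $t$ leaves.* Starting from the root, cells are processed level by level; a cell $A$ with at least two training samples is cut in a direction $i$ that maximizes $\sum_{z\in\{0,1\}}\frac{N_n(A^i_z)}{N_n(A)}\,g^{(n)}(A^i_z)^2$, where $A^i_z=\{\boldsymbol x\in A:x_i=z\}$, $N_n$ counts training samples and $g^{(n)}$ is the average label, until there are $t$ cells or no cell contains two training samples. Let $\boldsymbol m^{(n)}$ denote the vector of the $k$ fitted trees. *Claim.* There are absolute constants $K\ge1$ and $p\in\mathbb N$ such that, writing $\widetilde O(X)$ for $K\,X\,(\log(2+X))^p$, the following hold for all $\varepsilon>0$ and $\delta>0$ with $2\delta\le d$ (so that $\log(d/\delta)\ge1$). In each of the cases below, $$\Pr_{\mathcal D^n}\Big[\mathbf E_{\boldsymbol x\sim\mathcal D_x}\big\|\boldsymbol m(\boldsymbol x)-\boldsymbol m^{(n)}(\boldsymbol x)\big\|_2^2>\varepsilon\Big]\le\delta .$$ 1. **Level-Splits**,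 if every $m_i$ is $C$-approximately submodular: (a) for every $n\ge\widetilde O\big(\log(dk/\delta)\,k^{Cr+2}(Cr/\varepsilon)^{Cr+2}\big)$, with $q=\frac{Cr}{Cr+2}(\log n-\log\log(d/\delta))$ splits; (b) if in addition $\mathcal D_x$ is a product distribution: for every $n\ge\widetilde O\big(\log(dk/\delta)\,2^r k^2(C/\varepsilon)^2\big)$, with $q=r$ splits. Here "$q$ splits" means $H\in\{h,h+1\}$ levels, where $h=\max(\lceil q\rceil,0)$. 2. **Breiman**, if every $m_i$ has $C$-approximate diminishing returns: (a) for every $n\ge\widetilde O\big(\log(dk/\delta)\,k^{Cr+3}(Cr/\varepsilon)^{Cr+3}\big)$, with $q=\frac{Cr}{Cr+3}(\log n-\log\log(d/\delta))$; (b) if in addition $\mathcal D_x$ is a product distribution: for every $n\ge\widetilde O\big(\log(dk/\delta)\,k^3C^2 2^r/\varepsilon^3\big)$, with $q=r$; in both cases for every integer $t\ge1$ with $\log t\ge q$ and $$t\le\max\Big\{2\cdot2^{q},\ \min\Big(n,\frac{n\varepsilon^2}{K\,C^2r^2k^2\log(dk/\delta)}\Big)\Big\}.$$ *Running time.* For all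 $C\ge 1$ and $r\ge1$ there is $a\in\mathbb N$ such that, in each of the four cases, with $n$ equal to the stated sample size $\widetilde O(X)$ rounded up, the number of elementary steps (unit-cost arithmetic and comparisons on real numbers, feature look-ups, elementary list and tree operations) of the algorithm is, on every data set of size $n$, at most $a\,\big(d+k+1/\varepsilon+\log(2+1/\delta)\big)^a$. -/

import Mathlib

open MeasureTheory

namespace ScoreTrees

/-! ## Programs with a step count

Unit-cost real RAM: one step for every arithmetic operation or comparison on reals or integers, every
access to a feature of a point, and every elementary list or tree operation. -/

/-- The result of a program, together with the number of elementary steps it performs. -/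
structure Timed (α : Type) where
  val : α
  steps : ℕ

namespace Timed

/-- Sequential composition adds up the steps. -/
instance : Monad Timed where
  pure a := ⟨a, 0⟩
  bind u f := ⟨(f u.val).val, u.steps + (f u.val).steps⟩

/-- Return `a`, at the price of `c` elementary steps. -/
def charge {α : Type} (c : ℕ) (a : α) : Timed α := ⟨a, c⟩

/-- Return `a`, at the price of one elementary step. -/
def op {α : Type} (a : α) : Timed α := charge 1 a

/-- Run the programs `f 0, …, f (k - 1)` one after the other and collect their results. -/
def forAll {α : Type} {k : ℕ} (f : Fin k → Timed α) : Timed (Fin k → α) :=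
  ⟨fun i => (f i).val, ∑ i, ((f i).steps + 1)⟩

end Timed

open Timed

/-! ## Points, labelled samples, decision trees -/

/-- A point of the hypercube `{0,1}^d`. -/
abbrev Point (d : ℕ) : Type := Fin d → Bool

/-- A point with a real label. -/
abbrev Sample (d : ℕ) : Type := Point d × ℝ

/-- A binary decision tree on `{0,1}^d`: `node i l r` sends `x` to `l` if `x i` is false (`x_i = 0`)
and to `r` if `x i` is true (`x_i = 1`). The leaves are the cells of a partition of the cube. -/
inductive DTree (d : ℕ) (α : Type) : Type
  | leaf (a : α) : DTree d α
  | node (i : Fin d) (l r : DTree d α) : DTree d α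

/-- The content of the leaf that `x` reaches. -/
def DTree.eval {d : ℕ} {α : Type} : DTree d α → Point d → α
  | .leaf a, _ => a
  | .node i l r, x => if x i then r.eval x else l.eval x

noncomputable section

/-! ## Common subroutines -/

/-- Sum and number of the labels in a list of samples. -/
def sumCount {d : ℕ} : List (Sample d) → Timed (ℝ × ℕ)
  | [] => op (0, 0)
  | s :: D => do
      let sc ← sumCount D
      charge 2 (sc.1 + s.2, sc.2 + 1)

/-- Average label of a list of samples (`0` for the empty list). -/
def meanLabel {d : ℕ} (D : List (Sample d)) : Timed ℝ := do
  let sc ← sumCount D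
  op (sc.1 / (sc.2 : ℝ))

/-- Distribute samples according to the value of feature `i`: first `x_i = 0`, then `x_i = 1`. -/
def splitOn {d : ℕ} (i : Fin d) : List (Sample d) → Timed (List (Sample d) × List (Sample d))
  | [] => op ([], [])
  | s :: D => do
      let q ← splitOn i D
      if s.1 i then charge 2 (q.1, s :: q.2) else charge 2 (s :: q.1, q.2)

/-- Scan a list of directions and return the first one with the largest score, with that score. -/
def scanMax {d : ℕ} (score : Fin d → Timed ℝ) : List (Fin d) → Timed (Option (Fin d × ℝ))
  | [] => op none
  | i :: I => do
      let v ← score i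
      let b ← scanMax score I
      match b with
      | none => op (some (i, v))
      | some (j, w) => if w ≤ v then op (some (i, v)) else op (some (j, w))

/-! ## Level-Splits -/

/-- Do `x` and `z` agree on the coordinates in `S`? -/
def agrees {d : ℕ} : List (Fin d) → Point d → Point d → Timed Bool
  | [], _, _ => op true
  | i :: S, x, z => do
      let b ← op (x i == z i)
      if b then agrees S x z else op false

/-- The samples whose points agree with `x` on `S`. -/
def samplesAgreeing {d : ℕ} (S : List (Fin d)) (x : Point d) :
    List (Sample d) → Timed (List (Sample d))
  | [] => op []
  | s :: D => do
      let b ← agrees S x s.1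
      let D' ← samplesAgreeing S x D
      if b then op (s :: D') else op D'

/-- The sum over the samples `(x, y)` in the last argument of `f⁽ⁿ⁾(x; S)²`, where `f⁽ⁿ⁾(x; S)` is the
average label of the training samples in `D` that agree with `x` on `S`. -/
def sumSqFit {d : ℕ} (S : List (Fin d)) (D : List (Sample d)) : List (Sample d) → Timed ℝ
  | [] => op 0
  | s :: E => do
      let cell ← samplesAgreeing S s.1 D
      let g ← meanLabel cell
      let v ← sumSqFit S D E
      charge 2 (g ^ 2 + v)

/-- The empirical criterion `V_n(S) = (1/n) ∑_j f⁽ⁿ⁾(x⁽ʲ⁾; S)²`. -/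
def empV {d : ℕ} (S : List (Fin d)) (D : List (Sample d)) : Timed ℝ := do
  let v ← sumSqFit S D D
  charge (D.length + 1) (v / (D.length : ℝ))

/-- Extend the list `S` of split directions greedily for a given number of levels: at each level, add a
direction `i` that maximizes `V_n(S ∪ {i})`. -/
def greedySplits {d : ℕ} (D : List (Sample d)) : ℕ → List (Fin d) → Timed (List (Fin d))
  | 0, S => op S
  | H + 1, S => do
      let b ← scanMax (fun i => empV (i :: S) D) (List.finRange d)
      match b with
      | none => op S
      | some (i, _) => do
          let S' ← charge (S.length + 1) (S ++ [i])
          greedySplits D H S'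

/-- The tree whose levels split in the directions `S` (the first one at the root). A cell is left
unsplit at a level if one of its halves would contain no training sample. The value of a leaf is the
average label of the training samples in it. -/
def levelTree {d : ℕ} : List (Fin d) → List (Sample d) → Timed (DTree d ℝ)
  | [], D => do
      let v ← meanLabel D
      op (DTree.leaf v)
  | i :: S, D => do
      let q ← splitOn i D
      let b ← charge 2 (q.1.isEmpty || q.2.isEmpty)
      if b then levelTree S D
      else do
        let l ← levelTree S q.1
        let r ← levelTree S q.2
        op (DTree.node i l r)

/-- The Level-Splits algorithm with `H` levels: the list of chosen directions and the fitted tree. -/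
def levelSplits {d : ℕ} (D : List (Sample d)) (H : ℕ) : Timed (List (Fin d) × DTree d ℝ) := do
  let S ← greedySplits D H []
  let T ← levelTree S D
  op (S, T)

/-! ## Breiman -/

/-- The empirical criterion `∑_{z = 0, 1} (N_n(A_z) / N_n(A)) g⁽ⁿ⁾(A_z)²` of splitting the cell `A`
in direction `i`; here `A` is the list of the training samples in the cell. -/
def localV {d : ℕ} (A : List (Sample d)) (i : Fin d) : Timed ℝ := do
  let q ← splitOn i A
  let s₀ ← sumCount q.1
  let s₁ ← sumCount q.2
  charge 10
    (((s₀.2 : ℝ) / ((s₀.2 : ℝ) + s₁.2)) * (s₀.1 / s₀.2) ^ 2 +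
      ((s₁.2 : ℝ) / ((s₀.2 : ℝ) + s₁.2)) * (s₁.1 / s₁.2) ^ 2)

/-- Process all the leaves of a tree once, in order, while at most `b` cuts remain allowed: a leaf with
at least two training samples is cut in a direction that maximizes its own criterion. Returns the new
tree and the number of cuts still allowed. Leaves carry the training samples in them. -/
def breimanLevel {d : ℕ} : DTree d (List (Sample d)) → ℕ →
    Timed (DTree d (List (Sample d)) × ℕ)
  | .leaf A, b => do
      let c ← charge 3 (decide (2 ≤ A.length) && decide (0 < b))
      if c then do
        let o ← scanMax (localV A) (List.finRange d)
        match o with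
        | none => op (DTree.leaf A, b)
        | some (i, _) => do
            let q ← splitOn i A
            charge 2 (DTree.node i (DTree.leaf q.1) (DTree.leaf q.2), b - 1)
      else op (DTree.leaf A, b)
  | .node i l r, b => do
      let u ← breimanLevel l b
      let v ← breimanLevel r u.2
      op (DTree.node i u.1 v.1, v.2)

/-- A given number of rounds of `breimanLevel`. -/
def breimanGrow {d : ℕ} : ℕ → DTree d (List (Sample d)) → ℕ → Timed (DTree d (List (Sample d)))
  | 0, T, _ => op T
  | L + 1, T, b => do
      let u ← breimanLevel T b
      breimanGrow L u.1 u.2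

/-- Replace the sample list in each leaf by its average label. -/
def fitLeaves {d : ℕ} : DTree d (List (Sample d)) → Timed (DTree d ℝ)
  | .leaf A => do
      let v ← meanLabel A
      op (DTree.leaf v)
  | .node i l r => do
      let l' ← fitLeaves l
      let r' ← fitLeaves r
      op (DTree.node i l' r')

/-- Breiman's algorithm with at most `t` leaves: starting from the root, the cells are processed level
by level and cut until there are `t` of them or no cell contains two training samples. Each round before
that point makes a cut, so `t` rounds always complete the process. -/
def breiman {d : ℕ} (D : List (Sample d)) (t : ℕ) : Timed (DTree d ℝ) := do
  let T ← breimanGrow t (DTree.leaf D) (t - 1)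
  fitLeaves T

/-! ## Score learning: one tree per coordinate of the label -/

/-- A data set of `n` points with labels in `ℝ^k`. -/
abbrev ScoreData (d k n : ℕ) : Type := Fin n → Point d × (Fin k → ℝ)

/-- The data set for the `i`-th coordinate of the label. -/
def coordData {d k n : ℕ} (ω : ScoreData d k n) (i : Fin k) : Timed (List (Sample d)) :=
  charge (n * (d + 2)) (List.ofFn fun j => ((ω j).1, (ω j).2 i))

/-- Score learning with `k` Level-Splits trees of `H` levels. -/
def learnLevelSplits {d k n : ℕ} (H : ℕ) (ω : ScoreData d k n) :
    Timed (Fin k → List (Fin d) × DTree d ℝ) :=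
  forAll fun i => do
    let D ← coordData ω i
    levelSplits D H

/-- Score learning with `k` Breiman trees of at most `t` leaves. -/
def learnBreiman {d k n : ℕ} (t : ℕ) (ω : ScoreData d k n) : Timed (Fin k → DTree d ℝ) :=
  forAll fun i => do
    let D ← coordData ω i
    breiman D t

/-- The score estimate of Level-Splits. -/
def levelSplitsEstimate {d k n : ℕ} (H : ℕ) (ω : ScoreData d k n) (x : Point d) (i : Fin k) : ℝ :=
  ((learnLevelSplits H ω).val i).2.eval x

/-- The score estimate of Breiman's algorithm. -/
def breimanEstimate {d k n : ℕ} (t : ℕ) (ω : ScoreData d k n) (x : Point d) (i : Fin k) : ℝ :=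
  ((learnBreiman t ω).val i).eval x

/-! ## The statistical model -/

/-- Zero-mean noise with values in `[-1/4, 1/4]^k`. -/
def IsBoundedCenteredNoise {k : ℕ} (E : Measure (Fin k → ℝ)) : Prop :=
  (∀ᵐ ξ ∂E, ∀ i, ξ i ∈ Set.Icc (-(1 / 4) : ℝ) (1 / 4)) ∧ ∀ i, ∫ ξ, ξ i ∂E = 0

/-- The law of `(x, m(x) + ξ)` for independent `x ∼ Dx` and `ξ ∼ E`. -/
def scoreLaw {d k : ℕ} (m : Point d → Fin k → ℝ) (Dx : Measure (Point d))
    (E : Measure (Fin k → ℝ)) : Measure (Point d × (Fin k → ℝ)) :=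
  (Dx.prod E).map fun p => (p.1, m p.1 + p.2)

/-- The law of `n` independent samples. -/
def sampleLaw {d k : ℕ} (m : Point d → Fin k → ℝ) (Dx : Measure (Point d))
    (E : Measure (Fin k → ℝ)) (n : ℕ) : Measure (ScoreData d k n) :=
  Measure.pi fun _ => scoreLaw m Dx E

/-- The risk `E_{x ∼ Dx} ‖m(x) - g(x)‖₂²`. -/
def risk {d k : ℕ} (m : Point d → Fin k → ℝ) (Dx : Measure (Point d))
    (g : Point d → Fin k → ℝ) : ℝ :=
  ∫ x, ∑ i, (m x i - g x i) ^ 2 ∂Dx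

/-- `f` depends only on the coordinates in some set of size `r`. -/
def IsSparse {d : ℕ} (r : ℕ) (f : Point d → ℝ) : Prop :=
  ∃ R : Finset (Fin d), R.card = r ∧ ∃ h : (R → Bool) → ℝ, ∀ z, f z = h fun i => z i

/-- The features are independent. -/
def IsProductLaw {d : ℕ} (Dx : Measure (Point d)) : Prop :=
  ∃ μ : Fin d → Measure Bool, (∀ i, IsProbabilityMeasure (μ i)) ∧ Dx = Measure.pi μ

/-- The cell (subcube) of the points that agree with `x` on `S`. -/
def cell {d : ℕ} (S : Finset (Fin d)) (x : Point d) : Set (Point d) :=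
  {w | ∀ i ∈ S, w i = x i}

/-- `V(S) = E_x [ E_w[f(w) | w_S = x_S]² ]`. -/
def popV {d : ℕ} (f : Point d → ℝ) (Dx : Measure (Point d)) (S : Finset (Fin d)) : ℝ :=
  ∫ x, (∫ w, f w ∂(ProbabilityTheory.cond Dx (cell S x))) ^ 2 ∂Dx

/-- `V` is `C`-approximate submodular. -/
def ApproxSubmodular {d : ℕ} (C : ℝ) (f : Point d → ℝ) (Dx : Measure (Point d)) : Prop :=
  ∀ S T : Finset (Fin d), S ⊆ T → ∀ i : Fin d,
    popV f Dx (insert i T) - popV f Dx T ≤ C * (popV f Dx (insert i S) - popV f Dx S)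

/-- `V_ℓ(A, T) = E_x [ E_z[f(z) | z ∈ A, z_T = x_T]² | x ∈ A ]`, the local criterion of the partition of
`A` according to the coordinates in `T`; `V_ℓ(A) = V_ℓ(A, ∅)`. If `A` is null, then it is `0`. -/
def popLocalV {d : ℕ} (f : Point d → ℝ) (Dx : Measure (Point d)) (A : Set (Point d))
    (T : Finset (Fin d)) : ℝ :=
  ∫ x, (∫ z, f z ∂(ProbabilityTheory.cond Dx (A ∩ cell T x))) ^ 2 ∂(ProbabilityTheory.cond Dx A)

/-- `V_ℓ` has `C`-approximate diminishing returns. -/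
def ApproxDiminishingReturns {d : ℕ} (C : ℝ) (f : Point d → ℝ) (Dx : Measure (Point d)) : Prop :=
  ∀ (I I' : Finset (Fin d)) (a a' : Point d), cell I' a' ⊆ cell I a →
    ∀ (T : Finset (Fin d)) (i : Fin d),
      popLocalV f Dx (cell I' a') (insert i T) - popLocalV f Dx (cell I' a') T ≤
        C * (popLocalV f Dx (cell I a) {i} - popLocalV f Dx (cell I a) ∅)

/-! ## Sample sizes, depths and leaf budgets (all logarithms are to base `2`) -/

/-- A bound of the form `Õ(X)`: a constant, times `X`, times a power of `log X`. -/
def softO (K : ℝ) (p : ℕ) (X : ℝ) : ℝ := K * X * Real.logb 2 (2 + X) ^ p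

/-- `log(dk/δ) · k^(Cr+e) · (Cr/ε)^(Cr+e)`. -/
def rateGeneral (e : ℝ) (d k r : ℕ) (C ε δ : ℝ) : ℝ :=
  Real.logb 2 (d * k / δ) * (k : ℝ) ^ (C * r + e) * (C * r / ε) ^ (C * r + e)

/-- `log(dk/δ) · 2^r · k² · (C/ε)²`. -/
def rateLevelProduct (d k r : ℕ) (C ε δ : ℝ) : ℝ :=
  Real.logb 2 (d * k / δ) * 2 ^ r * (k : ℝ) ^ 2 * (C / ε) ^ 2

/-- `log(dk/δ) · k³ · C² · 2^r / ε³`. -/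
def rateBreimanProduct (d k r : ℕ) (C ε δ : ℝ) : ℝ :=
  Real.logb 2 (d * k / δ) * (k : ℝ) ^ 3 * C ^ 2 * 2 ^ r / ε ^ 3

/-- `(Cr/(Cr+e)) · (log n - log log(d/δ))`. -/
def logLeaves (e : ℝ) (d n r : ℕ) (C δ : ℝ) : ℝ :=
  C * r / (C * r + e) * (Real.logb 2 n - Real.logb 2 (Real.logb 2 (d / δ)))

/-- `H` is the number `q` of splits, rounded up to an integer (or that integer plus one). -/
def IsDepth (q : ℝ) (H : ℕ) : Prop := ⌈q⌉₊ ≤ H ∧ H ≤ ⌈q⌉₊ + 1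

/-- The number `t` of leaves satisfies `log t ≥ q`, and it is either at most `2 · 2^q` or at most
`n` and `n ε² / (K C² r² k² log(dk/δ))`. -/
def IsLeafBudget (K q : ℝ) (d k n r : ℕ) (C ε δ : ℝ) (t : ℕ) : Prop :=
  1 ≤ t ∧ q ≤ Real.logb 2 t ∧
    (t : ℝ) ≤ max (2 * 2 ^ q)
      (min (n : ℝ) (n * ε ^ 2 / (K * (C * r * k) ^ 2 * Real.logb 2 (d * k / δ))))

end

end ScoreTrees

open ScoreTrees

/-!
The argument treats one coordinate of the label at a time, with failure probability `δ / k`.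

*Cells and criteria.* The cube is finite, so both the population and the sample are given by weights on
points: a pair `a`, `b` with `a x` the mass of the labels at `x` and `b x` the mass of `x`. A cell of a tree
is the list of answers on the path to it, and for a cell `p` both criteria `V_n` and `V` are built from
`crit a b p = (∑ a)² / ∑ b`. Summing over the leaves of a tree `T`, the empirical and the population
criterion differ by at most three times the `discrepancy` of `T`, the sum over its leaves of the deviations
of `∑ a` and `∑ b` (`treeCrit_sub_le`). The risk of the fitted tree exceeds the population loss of its
partition, `treeLoss`, by at most six times the discrepancy (`tree_risk_le`); this includes the leaves
that no training sample reaches.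

*Concentration.* The discrepancy of `T` is a maximum over signs on the leaves of `T` of the deviation of a
sum of independent bounded variables. Hoeffding's inequality and a weighted union bound over signed trees
bound all discrepancies at once: by `levelDev` for the trees of Level-Splits, which are lists of
directions, and by `leafDev` for all trees of a given number of leaves (`measure_levelDev_lt_le`,
`measure_leafDev_lt_le`). What remains is a deterministic statement about greedy algorithms whose criterion
is known up to an error.

*Greedy steps.* Since the regression function `f` of the coordinate depends on `r` directions, telescoping over them shows that some direction
gains a fraction `1 / (C r)` of the current loss (`ApproxSubmodular.exists_gain`, for each partition by
levels; `ApproxDiminishingReturns.exists_gain`, for each cell). So every level multiplies the loss by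
`1 - 1 / (C r)`, up to the discrepancy (`levelSplits_risk_le_of_gain`, `breiman_risk_le_of_gain`). For
Breiman's algorithm, the cells that are left uncut because they hold at most one sample have little mass, and
the cuts after the last complete round can only lower the loss.

*Product laws.* Here an irrelevant direction gains exactly nothing (`IsProductLaw.cellGain_eq_zero`). As soon
as the greedy choice is irrelevant or repeated, the best gain is at most a multiple of the discrepancy, and
the loss is at most `C r` times that. Otherwise every level uses up one relevant direction, and after `r` levels the loss is
`0` (`levelSplits_risk_le_of_relevant`, `breiman_risk_le_of_relevant`).

*Sample sizes.* With `K = M ^ (M + 3)` for a large constant `M`, the general sample size is at least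
`log (d k / δ) (M k / ε) ^ (C r + e)` (`rpow_le_of_rateGeneral`): the factor `M` in the base costs at most `K`
if `C r ≤ M`, and replaces `C r` otherwise. The polynomial factors in `C r` and in the depth that the error
bounds contain are at most powers of `log n` and are absorbed by the power of `n`. Under a product law the
power of the logarithm in the sample size is at least a constant times `r ^ 4`, which absorbs the factors `r`.

*Running time.* The step counts are polynomial in `d`, `k`, `n` and the depth or the number of leaves
(`learnLevelSplits_steps_le`, `learnBreiman_steps_le`), and for fixed `C` and `r` all of these are polynomial in
the size of the problem (`exists_steps_le`).
-/

namespace ScoreTrees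

open MeasureTheory Timed

noncomputable section

/-! ### Sums over the leaves of a tree -/

/-- The points that satisfy all the constraints `x i = z`, for `(i, z)` on a path in a decision tree. It is
a subcube, or empty if the path contradicts itself. -/
def pathPts {d : ℕ} (p : List (Fin d × Bool)) : Finset (Point d) :=
  Finset.univ.filter fun x => ∀ c ∈ p, x c.1 = c.2

/-- The sum of `φ` over the leaves of a tree whose root is reached by the path `p`; a leaf is represented by
the path that leads to it, last constraint first. -/
def DTree.leafSum {d : ℕ} {α : Type} (φ : List (Fin d × Bool) → ℝ) :
    DTree d α → List (Fin d × Bool) → ℝ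
  | .leaf _, p => φ p
  | .node i l r, p => l.leafSum φ ((i, false) :: p) + r.leafSum φ ((i, true) :: p)

/-- The number of leaves. -/
def DTree.leaves {d : ℕ} {α : Type} : DTree d α → ℕ
  | .leaf _ => 1
  | .node _ l r => l.leaves + r.leaves

/-- Forget the contents of the leaves. -/
def DTree.shape {d : ℕ} {α : Type} : DTree d α → DTree d Unit
  | .leaf _ => .leaf ()
  | .node i l r => .node i l.shape r.shape

/-- The path to the leaf that `x` reaches, if the root is reached by the path `p`. -/
def DTree.leafPath {d : ℕ} {α : Type} : DTree d α → Point d → List (Fin d × Bool) →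
    List (Fin d × Bool)
  | .leaf _, _, p => p
  | .node i l r, x, p => if x i then r.leafPath x ((i, true) :: p) else l.leafPath x ((i, false) :: p)

/-- Cut every leaf in the direction that `c` gives for it, if there is one. -/
def DTree.refine {d : ℕ} (c : List (Fin d × Bool) → Option (Fin d)) :
    DTree d Unit → List (Fin d × Bool) → DTree d Unit
  | .leaf _, p => (c p).elim (.leaf ()) fun i => .node i (.leaf ()) (.leaf ())
  | .node i l r, p => .node i (l.refine c ((i, false) :: p)) (r.refine c ((i, true) :: p))

/-- The tree all of whose leaves at a level are split in the same direction, the one given by the list. -/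
def fullTree {d : ℕ} : List (Fin d) → DTree d Unit
  | [] => .leaf ()
  | i :: S => .node i (fullTree S) (fullTree S)

section basic

variable {d : ℕ} {α : Type}

@[simp] lemma mem_pathPts {p : List (Fin d × Bool)} {x : Point d} :
    x ∈ pathPts p ↔ ∀ c ∈ p, x c.1 = c.2 := by
  simp [pathPts]

lemma pathPts_nil : pathPts ([] : List (Fin d × Bool)) = Finset.univ := by
  simp [pathPts]

lemma pathPts_cons (i : Fin d) (z : Bool) (p : List (Fin d × Bool)) :
    pathPts ((i, z) :: p) = (pathPts p).filter fun x => x i = z := by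
  ext x; simp [and_comm]

lemma sum_pathPts_cons (g : Point d → ℝ) (i : Fin d) (p : List (Fin d × Bool)) :
    ∑ x ∈ pathPts ((i, false) :: p), g x + ∑ x ∈ pathPts ((i, true) :: p), g x =
      ∑ x ∈ pathPts p, g x := by
  rw [pathPts_cons, pathPts_cons, add_comm,
    ← Finset.sum_filter_add_sum_filter_not (pathPts p) (fun x => x i = true)]
  simp

lemma DTree.one_le_leaves (T : DTree d α) : 1 ≤ T.leaves := by
  induction T with
  | leaf a => simp [DTree.leaves]
  | node i l r hl hr => simp only [DTree.leaves]; omega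

@[simp] lemma DTree.leaves_shape (T : DTree d α) : T.shape.leaves = T.leaves := by
  induction T with
  | leaf a => rfl
  | node i l r hl hr => simp [DTree.leaves, DTree.shape, hl, hr]

@[simp] lemma DTree.leafSum_shape (φ : List (Fin d × Bool) → ℝ) (T : DTree d α) :
    ∀ p, T.shape.leafSum φ p = T.leafSum φ p := by
  induction T with
  | leaf a => intro p; rfl
  | node i l r hl hr => intro p; simp [DTree.leafSum, DTree.shape, hl, hr]

lemma DTree.leafSum_add (φ ψ : List (Fin d × Bool) → ℝ) (T : DTree d α) :
    ∀ p, T.leafSum (fun q => φ q + ψ q) p = T.leafSum φ p + T.leafSum ψ p := by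
  induction T with
  | leaf a => intro p; rfl
  | node i l r hl hr => intro p; simp only [DTree.leafSum, hl, hr]; ring

lemma DTree.leafSum_mul (c : ℝ) (φ : List (Fin d × Bool) → ℝ) (T : DTree d α) :
    ∀ p, T.leafSum (fun q => c * φ q) p = c * T.leafSum φ p := by
  induction T with
  | leaf a => intro p; rfl
  | node i l r hl hr => intro p; simp only [DTree.leafSum, hl, hr]; ring

lemma DTree.leafSum_sub (φ ψ : List (Fin d × Bool) → ℝ) (T : DTree d α) (p) :
    T.leafSum (fun q => φ q - ψ q) p = T.leafSum φ p - T.leafSum ψ p := by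
  have := T.leafSum_add φ (fun q => (-1) * ψ q) p
  rw [T.leafSum_mul] at this
  simp only [sub_eq_add_neg, neg_one_mul] at this ⊢
  exact this

lemma DTree.leafSum_mono {φ ψ : List (Fin d × Bool) → ℝ} (h : ∀ q, φ q ≤ ψ q) (T : DTree d α) :
    ∀ p, T.leafSum φ p ≤ T.leafSum ψ p := by
  induction T with
  | leaf a => intro p; exact h p
  | node i l r hl hr => intro p; simp only [DTree.leafSum]; linarith [hl ((i, false) :: p), hr ((i, true) :: p)]

lemma DTree.leafSum_const (c : ℝ) (T : DTree d α) :
    ∀ p, T.leafSum (fun _ => c) p = T.leaves * c := by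
  induction T with
  | leaf a => intro p; simp [DTree.leafSum, DTree.leaves]
  | node i l r hl hr => intro p; simp only [DTree.leafSum, DTree.leaves, hl, hr]; push_cast; ring

lemma DTree.leafSum_sum (g : Point d → ℝ) (T : DTree d α) :
    ∀ p, T.leafSum (fun q => ∑ x ∈ pathPts q, g x) p = ∑ x ∈ pathPts p, g x := by
  induction T with
  | leaf a => intro p; rfl
  | node i l r hl hr => intro p; simp only [DTree.leafSum, hl, hr, sum_pathPts_cons]

/-- A quantity that can only grow when a cell is cut can only grow under refinement. -/
lemma DTree.le_leafSum {φ : List (Fin d × Bool) → ℝ}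
    (h : ∀ i q, φ q ≤ φ ((i, false) :: q) + φ ((i, true) :: q)) (T : DTree d α) :
    ∀ p, φ p ≤ T.leafSum φ p := by
  induction T with
  | leaf a => intro p; exact le_rfl
  | node i l r hl hr =>
    intro p; simp only [DTree.leafSum]
    linarith [hl ((i, false) :: p), hr ((i, true) :: p), h i p]

/-- The leaves of a tree partition the cube. -/
lemma DTree.leafSum_sum_leafPath (g : Point d → List (Fin d × Bool) → ℝ) (T : DTree d α) :
    ∀ p, T.leafSum (fun q => ∑ x ∈ pathPts q, g x q) p = ∑ x ∈ pathPts p, g x (T.leafPath x p) := by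
  induction T with
  | leaf a => intro p; rfl
  | node i l r hl hr =>
    intro p
    simp only [DTree.leafSum, hl, hr]
    rw [← sum_pathPts_cons _ i p]
    congr 1
    · refine Finset.sum_congr rfl fun x hx => ?_
      have hx' : x i = false := by simpa using (mem_pathPts.1 hx) (i, false) (by simp)
      simp [DTree.leafPath, hx']
    · refine Finset.sum_congr rfl fun x hx => ?_
      have hx' : x i = true := by simpa using (mem_pathPts.1 hx) (i, true) (by simp)
      simp [DTree.leafPath, hx']

lemma DTree.leafSum_refine (φ : List (Fin d × Bool) → ℝ) (c : List (Fin d × Bool) → Option (Fin d))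
    (T : DTree d Unit) :
    ∀ p, (T.refine c p).leafSum φ p =
      T.leafSum (fun q => (c q).elim (φ q) fun i => φ ((i, false) :: q) + φ ((i, true) :: q)) p := by
  induction T with
  | leaf a =>
    intro p
    simp only [DTree.refine, DTree.leafSum]
    cases c p <;> simp [DTree.leafSum]
  | node i l r hl hr => intro p; simp only [DTree.refine, DTree.leafSum, hl, hr]

lemma DTree.leaves_refine_le (c : List (Fin d × Bool) → Option (Fin d)) (T : DTree d Unit) :
    ∀ p, (T.refine c p).leaves ≤ 2 * T.leaves := by
  induction T with
  | leaf a =>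
    intro p
    simp only [DTree.refine, DTree.leaves]
    cases c p <;> simp [DTree.leaves]
  | node i l r hl hr =>
    intro p; simp only [DTree.refine, DTree.leaves]
    linarith [hl ((i, false) :: p), hr ((i, true) :: p)]

@[simp] lemma leaves_fullTree (S : List (Fin d)) : (fullTree S).leaves = 2 ^ S.length := by
  induction S with
  | nil => rfl
  | cons i S ih => simp only [fullTree, DTree.leaves, ih, List.length_cons]; ring

lemma fullTree_append (S : List (Fin d)) (i : Fin d) :
    ∀ p, fullTree (S ++ [i]) = (fullTree S).refine (fun _ => some i) p := by
  induction S with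
  | nil => intro p; simp [fullTree, DTree.refine]
  | cons j S ih =>
    intro p
    simp only [List.cons_append, fullTree, DTree.refine]
    rw [← ih, ← ih]

lemma pathPts_leafPath_fullTree (S : List (Fin d)) (x : Point d) :
    ∀ p, pathPts ((fullTree S).leafPath x p) = (pathPts p).filter fun y => ∀ i ∈ S, y i = x i := by
  induction S with
  | nil => intro p; simp [fullTree, DTree.leafPath]
  | cons i S ih =>
    intro p
    rcases h : x i with _ | _ <;>
      simp only [fullTree, DTree.leafPath, h, Bool.false_eq_true, if_true, if_false, ih, pathPts_cons,
        Finset.filter_filter, List.forall_mem_cons]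

end basic

/-! ### The splitting criterion as a function of moments -/

/-- The criterion `(∑ a)² / ∑ b` of a cell: for a distribution of labelled points, where `b` is the mass of a
point and `a` the integral of the label over it, it is the mass of the cell times the square of its
average label. -/
def crit {d : ℕ} (a b : Point d → ℝ) (A : Finset (Point d)) : ℝ :=
  (∑ x ∈ A, a x) ^ 2 / ∑ x ∈ A, b x

/-- `a` and `b` are the first moment of the label and the mass, for labels in `[-5/4, 5/4]`. -/
def IsMoment {d : ℕ} (a b : Point d → ℝ) : Prop := ∀ x, |a x| ≤ 5 / 4 * b x

/-- The deviation of the moments of two distributions, summed over the leaves of a tree; `u` and `v` are the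
differences of first moments and of masses. -/
def discrepancy {d : ℕ} {α : Type} (u v : Point d → ℝ) (T : DTree d α) : ℝ :=
  T.leafSum (fun p => |∑ x ∈ pathPts p, u x| + |∑ x ∈ pathPts p, v x|) []

section crit

variable {d : ℕ} {α : Type} {a b a' b' : Point d → ℝ}

lemma IsMoment.nonneg (h : IsMoment a b) (x : Point d) : 0 ≤ b x := by
  have := h x; have := abs_nonneg (a x); linarith

lemma IsMoment.sum_nonneg (h : IsMoment a b) (A : Finset (Point d)) : 0 ≤ ∑ x ∈ A, b x :=
  Finset.sum_nonneg fun x _ => h.nonneg x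

lemma IsMoment.abs_sum_le (h : IsMoment a b) (A : Finset (Point d)) :
    |∑ x ∈ A, a x| ≤ 5 / 4 * ∑ x ∈ A, b x := by
  rw [Finset.mul_sum]
  exact (Finset.abs_sum_le_sum_abs _ _).trans (Finset.sum_le_sum fun x _ => h x)

lemma crit_nonneg (h : IsMoment a b) (A : Finset (Point d)) : 0 ≤ crit a b A :=
  div_nonneg (sq_nonneg _) (h.sum_nonneg A)

/-- The criterion is the maximum over `g` of `2 g ∑ a - g² ∑ b`. -/
lemma le_crit (h : IsMoment a b) (A : Finset (Point d)) (g : ℝ) :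
    2 * g * ∑ x ∈ A, a x - g ^ 2 * ∑ x ∈ A, b x ≤ crit a b A := by
  have h1 := h.abs_sum_le A
  rcases (h.sum_nonneg A).eq_or_lt with h0 | h0
  · rw [← h0, mul_zero] at h1
    have h2 : ∑ x ∈ A, a x = 0 := abs_eq_zero.1 (le_antisymm h1 (abs_nonneg _))
    simp [crit, h2, ← h0]
  · rw [crit, le_div_iff₀ h0]
    nlinarith [sq_nonneg (∑ x ∈ A, a x - g * ∑ x ∈ A, b x)]

/-- The maximum of `le_crit` is attained at the average label; in a cell without mass, this is the junk value
`0`, which is as good as any other. -/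
lemma crit_eq (h : IsMoment a b) (A : Finset (Point d)) :
    2 * ((∑ x ∈ A, a x) / ∑ x ∈ A, b x) * ∑ x ∈ A, a x -
      ((∑ x ∈ A, a x) / ∑ x ∈ A, b x) ^ 2 * ∑ x ∈ A, b x = crit a b A := by
  rcases (h.sum_nonneg A).eq_or_lt with h0 | h0
  · simp [crit, ← h0]
  · rw [crit]; field_simp; ring

lemma IsMoment.abs_div_le (h : IsMoment a b) (A : Finset (Point d)) :
    |(∑ x ∈ A, a x) / ∑ x ∈ A, b x| ≤ 5 / 4 := by
  rcases (h.sum_nonneg A).eq_or_lt with h0 | h0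
  · simp [← h0]; norm_num
  · rw [abs_div, abs_of_pos h0, div_le_iff₀ h0]; exact h.abs_sum_le A

/-- The error of `2 g ∑ a - g² ∑ b` when the sums are off by `u` and `v`, for `g` in the range of labels. -/
lemma mul_sub_sq_mul_le {g u v : ℝ} (hg : |g| ≤ 5 / 4) :
    2 * g * u - g ^ 2 * v ≤ 3 * (|u| + |v|) := by
  have h1 : g * u ≤ 5 / 4 * |u| :=
    (le_abs_self _).trans (by rw [abs_mul]; exact mul_le_mul_of_nonneg_right hg (abs_nonneg _))
  have h2 : g ^ 2 ≤ 25 / 16 := by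
    have := sq_le_sq' (by linarith [abs_nonneg g] : -(5/4 : ℝ) ≤ |g|) hg
    rw [sq_abs] at this; linarith
  have h3 : -(g ^ 2 * v) ≤ 25 / 16 * |v| := by
    have := mul_le_mul h2 (neg_abs_le v |> fun h => (by linarith : -v ≤ |v|))
    nlinarith [sq_nonneg g, neg_abs_le v, abs_nonneg v]
  linarith [abs_nonneg u, abs_nonneg v]

lemma crit_sub_crit_le (h : IsMoment a b) (h' : IsMoment a' b') (A : Finset (Point d)) :
    crit a' b' A - crit a b A ≤
      3 * (|∑ x ∈ A, (a x - a' x)| + |∑ x ∈ A, (b x - b' x)|) := by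
  have h1 := le_crit h A ((∑ x ∈ A, a' x) / ∑ x ∈ A, b' x)
  have h2 := crit_eq h' A
  have h3 := mul_sub_sq_mul_le (u := -∑ x ∈ A, (a x - a' x)) (v := -∑ x ∈ A, (b x - b' x))
    (h'.abs_div_le A)
  rw [abs_neg, abs_neg] at h3
  simp only [Finset.sum_sub_distrib] at h3 ⊢
  linarith

lemma crit_le_crit_add_crit (h : IsMoment a b) (i : Fin d) (p : List (Fin d × Bool)) :
    crit a b (pathPts p) ≤
      crit a b (pathPts ((i, false) :: p)) + crit a b (pathPts ((i, true) :: p)) := by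
  set g := (∑ x ∈ pathPts p, a x) / ∑ x ∈ pathPts p, b x
  have h1 := le_crit h (pathPts ((i, false) :: p)) g
  have h2 := le_crit h (pathPts ((i, true) :: p)) g
  have h3 := crit_eq h (pathPts p)
  rw [← sum_pathPts_cons a i p, ← sum_pathPts_cons b i p] at h3
  have h4 : g = (∑ x ∈ pathPts ((i, false) :: p), a x + ∑ x ∈ pathPts ((i, true) :: p), a x) /
      (∑ x ∈ pathPts ((i, false) :: p), b x + ∑ x ∈ pathPts ((i, true) :: p), b x) := by
    rw [sum_pathPts_cons, sum_pathPts_cons]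
  rw [← h4] at h3
  linarith

/-- The criterion of a whole tree, with respect to the moments `a` and `b`. -/
def treeCrit (a b : Point d → ℝ) (T : DTree d α) (p : List (Fin d × Bool)) : ℝ :=
  T.leafSum (fun q => crit a b (pathPts q)) p

lemma treeCrit_sub_le (h : IsMoment a b) (h' : IsMoment a' b') (T : DTree d α) :
    treeCrit a' b' T [] - treeCrit a b T [] ≤
      3 * discrepancy (fun x => a x - a' x) (fun x => b x - b' x) T := by
  rw [treeCrit, treeCrit, ← DTree.leafSum_sub, discrepancy, ← DTree.leafSum_mul]
  exact T.leafSum_mono (fun q => crit_sub_crit_le h h' _) _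

lemma discrepancy_comm (T : DTree d α) :
    discrepancy (fun x => a x - a' x) (fun x => b x - b' x) T =
      discrepancy (fun x => a' x - a x) (fun x => b' x - b x) T := by
  simp only [discrepancy]
  congr 1; ext p
  simp only [Finset.sum_sub_distrib]
  rw [abs_sub_comm, abs_sub_comm (∑ x ∈ pathPts p, b x)]

lemma discrepancy_nonneg (u v : Point d → ℝ) (T : DTree d α) : 0 ≤ discrepancy u v T := by
  have := T.leafSum_mono (φ := fun _ => (0:ℝ))
    (ψ := fun p => |∑ x ∈ pathPts p, u x| + |∑ x ∈ pathPts p, v x|) (fun q => by positivity) []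
  rwa [T.leafSum_const, mul_zero] at this

lemma treeCrit_refine_sub (T : DTree d Unit) (c : List (Fin d × Bool) → Option (Fin d)) (p) :
    treeCrit a b (T.refine c p) p - treeCrit a b T p =
      T.leafSum (fun q => (c q).elim 0 fun i => crit a b (pathPts ((i, false) :: q)) +
        crit a b (pathPts ((i, true) :: q)) - crit a b (pathPts q)) p := by
  rw [treeCrit, treeCrit, DTree.leafSum_refine, ← DTree.leafSum_sub]
  congr 1; ext q
  cases c q <;> simp

/-- The criterion of the partition according to the coordinates in `S`, as a sum over points. -/
lemma treeCrit_fullTree (h : IsMoment a b) (S : List (Fin d)) (p) :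
    treeCrit a b (fullTree S) p =
      ∑ x ∈ pathPts p, b x * ((∑ y ∈ (pathPts p).filter fun y => ∀ i ∈ S, y i = x i, a y) /
        ∑ y ∈ (pathPts p).filter fun y => ∀ i ∈ S, y i = x i, b y) ^ 2 := by
  have h1 : ∀ q : List (Fin d × Bool), crit a b (pathPts q) = ∑ x ∈ pathPts q,
      b x * ((∑ y ∈ pathPts q, a y) / ∑ y ∈ pathPts q, b y) ^ 2 := by
    intro q
    rw [← Finset.sum_mul, crit]
    rcases (h.sum_nonneg (pathPts q)).eq_or_lt with h0 | h0
    · simp [← h0]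
    · field_simp
  simp only [treeCrit, h1]
  rw [DTree.leafSum_sum_leafPath (fun x q => b x * ((∑ y ∈ pathPts q, a y) / ∑ y ∈ pathPts q, b y) ^ 2)]
  simp only [pathPts_leafPath_fullTree]

/-- The risk of a fit `g` on a cell is at most the loss of the cell, up to the deviation of the empirical
moments `a` and `b` from those of the population, provided that `g` is the empirical average if there are
samples in the cell. -/
lemma cell_risk_le (h : IsMoment a b) {w f g : Point d → ℝ} (hw : ∀ x, 0 ≤ w x)
    (hf : ∀ x, f x ∈ Set.Icc (0 : ℝ) 1) (hg : ∀ x, g x ∈ Set.Icc (-(1 / 4) : ℝ) (5 / 4))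
    (A : Finset (Point d))
    (hA : 0 < ∑ x ∈ A, b x → ∀ x ∈ A, g x = (∑ x ∈ A, a x) / ∑ x ∈ A, b x) :
    ∑ x ∈ A, w x * (f x - g x) ^ 2 ≤
      (∑ x ∈ A, w x * f x ^ 2 - crit (fun x => w x * f x) w A) +
        6 * (|∑ x ∈ A, (a x - w x * f x)| + |∑ x ∈ A, (b x - w x)|) := by
  have hm : IsMoment (fun x => w x * f x) w := fun x => by
    rw [abs_mul, abs_of_nonneg (hw x), abs_of_nonneg (hf x).1]
    nlinarith [hw x, (hf x).2]
  rcases (h.sum_nonneg A).eq_or_lt with h0 | h0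
  -- Without samples in the cell, its whole mass is deviation, and the risk is at most `25/16` times the mass.
  · have h1 : ∑ x ∈ A, w x * (f x - g x) ^ 2 ≤ ∑ x ∈ A, 25 / 16 * w x := by
      refine Finset.sum_le_sum fun x _ => ?_
      have : (f x - g x) ^ 2 ≤ 25 / 16 := by
        have := (hf x).1; have := (hf x).2; have := (hg x).1; have := (hg x).2
        nlinarith
      nlinarith [hw x]
    rw [← Finset.mul_sum] at h1
    have h2 : crit (fun x => w x * f x) w A ≤ ∑ x ∈ A, w x * f x ^ 2 := by
      have := crit_eq hm A
      rw [← this]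
      set G := (∑ x ∈ A, w x * f x) / ∑ x ∈ A, w x
      rw [Finset.mul_sum, Finset.mul_sum, ← Finset.sum_sub_distrib]
      refine Finset.sum_le_sum fun x _ => ?_
      nlinarith [hw x, mul_nonneg (hw x) (sq_nonneg (f x - G))]
    have h3 : |∑ x ∈ A, (b x - w x)| = ∑ x ∈ A, w x := by
      rw [Finset.sum_sub_distrib, ← h0, zero_sub, abs_neg, abs_of_nonneg (hm.sum_nonneg A)]
    have h4 := hm.sum_nonneg A
    have h5 := abs_nonneg (∑ x ∈ A, (a x - w x * f x))
    rw [h3]; linarith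
  · have hA' := hA h0
    set G := (∑ x ∈ A, a x) / ∑ x ∈ A, b x
    have h1 : ∑ x ∈ A, w x * (f x - g x) ^ 2 =
        ∑ x ∈ A, w x * f x ^ 2 - 2 * G * ∑ x ∈ A, w x * f x + G ^ 2 * ∑ x ∈ A, w x := by
      rw [Finset.mul_sum, Finset.mul_sum, ← Finset.sum_sub_distrib, ← Finset.sum_add_distrib]
      refine Finset.sum_congr rfl fun x hx => ?_
      rw [hA' x hx]; ring
    have h2 := crit_sub_crit_le h hm A
    have h3 := crit_eq h A
    have h4 := mul_sub_sq_mul_le (u := ∑ x ∈ A, (a x - w x * f x)) (v := ∑ x ∈ A, (b x - w x))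
      (h.abs_div_le A)
    simp only [Finset.sum_sub_distrib] at h2 h4 ⊢
    linarith

end crit

/-! ### Hoeffding's inequality and weighted union bounds -/

/-- Hoeffding's inequality for the average of `n` independent copies of a bounded variable. -/
lemma hoeffding_pi {X : Type*} [MeasurableSpace X] (μ : Measure X) [IsProbabilityMeasure μ]
    {Z : X → ℝ} (hZ : Measurable Z) {c : ℝ} (hc : ∀ᵐ x ∂μ, Z x ∈ Set.Icc (-c) c) {n : ℕ}
    (hn : 0 < n) {s : ℝ} (hs : 0 ≤ s) :
    (Measure.pi fun _ : Fin n => μ).real {ω | s ≤ (∑ j, Z (ω j)) / n - ∫ x, Z x ∂μ} ≤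
      Real.exp (-(n * s ^ 2 / (2 * c ^ 2))) := by
  have hsub : ∀ j : Fin n, ProbabilityTheory.HasSubgaussianMGF
      (fun ω : Fin n → X => Z (ω j) - ∫ x, Z x ∂μ) ((‖c - -c‖₊ / 2) ^ 2)
      (Measure.pi fun _ : Fin n => μ) := by
    intro j
    have h0 := ProbabilityTheory.hasSubgaussianMGF_of_mem_Icc (μ := μ) hZ.aemeasurable hc
    have hmp := measurePreserving_eval (fun _ : Fin n => μ) j
    exact ProbabilityTheory.HasSubgaussianMGF.of_map (Y := fun ω : Fin n → X => ω j)
      (X := fun x => Z x - ∫ x, Z x ∂μ) hmp.measurable.aemeasurable (by rw [hmp.map_eq]; exact h0)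
  have hind : ProbabilityTheory.iIndepFun
      (fun (j : Fin n) (ω : Fin n → X) => Z (ω j) - ∫ x, Z x ∂μ)
      (Measure.pi fun _ : Fin n => μ) :=
    ProbabilityTheory.iIndepFun_pi (X := fun _ x => Z x - ∫ x, Z x ∂μ)
      fun j => (hZ.sub_const _).aemeasurable
  have h := ProbabilityTheory.HasSubgaussianMGF.measure_sum_ge_le_of_iIndepFun hind
    (s := Finset.univ) (fun j _ => hsub j) (ε := n * s) (by positivity)
  have hn' : (0 : ℝ) < n := by exact_mod_cast hn
  refine le_trans (le_of_eq ?_) (h.trans (le_of_eq ?_))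
  · congr 1; ext ω
    simp only [Set.mem_ofPred_eq, Finset.sum_sub_distrib, Finset.sum_const, Finset.card_univ,
      Fintype.card_fin, nsmul_eq_mul]
    rw [le_sub_iff_add_le, le_sub_iff_add_le, le_div_iff₀ hn']
    constructor <;> intro h <;> linarith
  · congr 1
    have h2 : (((‖c - -c‖₊ / 2) ^ 2 : NNReal) : ℝ) = c ^ 2 := by
      push_cast
      rw [Real.norm_eq_abs, div_pow, sq_abs]; ring
    simp only [Finset.sum_const, Finset.card_univ, Fintype.card_fin, nsmul_eq_mul, NNReal.coe_mul,
      NNReal.coe_natCast, h2]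
    rcases eq_or_ne c 0 with rfl | hc0
    · simp
    · field_simp

lemma hoeffding_pi_abs {X : Type*} [MeasurableSpace X] (μ : Measure X) [IsProbabilityMeasure μ]
    {Z : X → ℝ} (hZ : Measurable Z) {c : ℝ} (hc : ∀ᵐ x ∂μ, Z x ∈ Set.Icc (-c) c) {n : ℕ}
    (hn : 0 < n) {s : ℝ} (hs : 0 ≤ s) :
    (Measure.pi fun _ : Fin n => μ) {ω | s ≤ |(∑ j, Z (ω j)) / n - ∫ x, Z x ∂μ|} ≤
      ENNReal.ofReal (2 * Real.exp (-(n * s ^ 2 / (2 * c ^ 2)))) := by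
  have h1 := hoeffding_pi μ hZ hc hn hs
  have h2 := hoeffding_pi μ hZ.neg (c := c) (hc.mono fun x hx => ⟨by simpa using hx.2, by
    simpa using neg_le_neg hx.1⟩) hn hs
  have hsub : {ω : Fin n → X | s ≤ |(∑ j, Z (ω j)) / n - ∫ x, Z x ∂μ|} ⊆
      {ω | s ≤ (∑ j, Z (ω j)) / n - ∫ x, Z x ∂μ} ∪
        {ω | s ≤ (∑ j, (-Z) (ω j)) / n - ∫ x, (-Z) x ∂μ} := by
    intro ω hω
    rcases le_abs.1 (show s ≤ |_| from hω) with h | h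
    · exact Or.inl h
    · refine Or.inr ?_
      simp only [Set.mem_ofPred_eq, Pi.neg_apply, Finset.sum_neg_distrib, integral_neg]
      rw [neg_div, sub_neg_eq_add]
      linarith
  refine (measure_mono hsub).trans ((measure_union_le _ _).trans ?_)
  rw [two_mul, ENNReal.ofReal_add (Real.exp_pos _).le (Real.exp_pos _).le]
  refine add_le_add ?_ ?_
  · rw [← ENNReal.ofReal_toReal (measure_ne_top _ _)]
    exact ENNReal.ofReal_le_ofReal h1
  · rw [← ENNReal.ofReal_toReal (measure_ne_top _ _)]
    exact ENNReal.ofReal_le_ofReal h2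

/-- Hoeffding's inequality for a finite family of functions simultaneously; a function of weight `wt` is
allowed the deviation that a single function has with probability `η * wt`. -/
lemma hoeffding_union {X ι : Type*} [MeasurableSpace X] (μ : Measure X) [IsProbabilityMeasure μ]
    (s : Finset ι) {Z : ι → X → ℝ} (hZ : ∀ τ ∈ s, Measurable (Z τ)) {c : ℝ} (hc0 : 0 < c)
    (hc : ∀ τ ∈ s, ∀ᵐ x ∂μ, Z τ x ∈ Set.Icc (-c) c) {n : ℕ} (hn : 0 < n) {wt : ι → ℝ}
    (hwt : ∀ τ ∈ s, 0 < wt τ) (hsum : ∑ τ ∈ s, wt τ ≤ 1) {η : ℝ} (hη : 0 < η) (hη1 : η ≤ 1) :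
    (Measure.pi fun _ : Fin n => μ) {ω | ∃ τ ∈ s,
        √(2 * c ^ 2 * Real.log (2 / (η * wt τ)) / n) < |(∑ j, Z τ (ω j)) / n - ∫ x, Z τ x ∂μ|} ≤
      ENNReal.ofReal η := by
  have hsub : {ω : Fin n → X | ∃ τ ∈ s,
        √(2 * c ^ 2 * Real.log (2 / (η * wt τ)) / n) < |(∑ j, Z τ (ω j)) / n - ∫ x, Z τ x ∂μ|} ⊆
      ⋃ τ ∈ s, {ω | √(2 * c ^ 2 * Real.log (2 / (η * wt τ)) / n) ≤
        |(∑ j, Z τ (ω j)) / n - ∫ x, Z τ x ∂μ|} := by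
    rintro ω ⟨τ, hτ, h⟩
    exact Set.mem_biUnion hτ h.le
  have hn' : (0 : ℝ) < n := by exact_mod_cast hn
  refine (measure_mono hsub).trans ((measure_biUnion_finset_le _ _).trans ?_)
  calc _ ≤ ∑ τ ∈ s, ENNReal.ofReal (η * wt τ) := by
        refine Finset.sum_le_sum fun τ hτ => ?_
        refine (hoeffding_pi_abs μ (hZ τ hτ) (hc τ hτ) hn (Real.sqrt_nonneg _)).trans ?_
        refine ENNReal.ofReal_le_ofReal (le_of_eq ?_)
        have hw := hwt τ hτ
        have hw1 : wt τ ≤ 1 := (Finset.single_le_sum (fun t ht => (hwt t ht).le) hτ).trans hsum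
        have hlog : 0 ≤ Real.log (2 / (η * wt τ)) := by
          refine Real.log_nonneg ?_
          rw [le_div_iff₀ (by positivity)]
          nlinarith
        rw [Real.sq_sqrt (by positivity)]
        have : (n : ℝ) * (2 * c ^ 2 * Real.log (2 / (η * wt τ)) / n) / (2 * c ^ 2) =
            Real.log (2 / (η * wt τ)) := by field_simp
        rw [this, Real.exp_neg, Real.exp_log (by positivity)]
        field_simp
    _ = ENNReal.ofReal (∑ τ ∈ s, η * wt τ) :=
        (ENNReal.ofReal_sum_of_nonneg fun τ hτ => by have := hwt τ hτ; positivity).symm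
    _ ≤ ENNReal.ofReal η := by
        refine ENNReal.ofReal_le_ofReal ?_
        rw [← Finset.mul_sum]; nlinarith

/-! ### Signed trees -/

/-- The sign of a bit. -/
def bitSign (b : Bool) : ℝ := if b then 1 else -1

lemma exists_bitSign_mul (u : ℝ) : ∃ b, bitSign b * u = |u| := by
  rcases le_total 0 u with h | h
  · exact ⟨true, by simp [bitSign, abs_of_nonneg h]⟩
  · exact ⟨false, by simp [bitSign, abs_of_nonpos h]⟩

lemma abs_bitSign (b : Bool) : |bitSign b| = 1 := by
  cases b <;> simp [bitSign]

open Classical in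
/-- The trees of a given shape with two signs at each leaf. -/
def decorations {d : ℕ} : DTree d Unit → Finset (DTree d (Bool × Bool))
  | .leaf _ => Finset.univ.image DTree.leaf
  | .node i l r => (decorations l ×ˢ decorations r).image fun q => .node i q.1 q.2

lemma card_decorations_le {d : ℕ} (T : DTree d Unit) :
    ((decorations T).card : ℝ) ≤ 4 ^ T.leaves := by
  classical
  induction T with
  | leaf a =>
    simp only [decorations, DTree.leaves, pow_one]
    have : (Finset.univ.image (DTree.leaf (d := d) (α := Bool × Bool))).card ≤ 4 :=
      Finset.card_image_le.trans (by simp)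
    exact_mod_cast this
  | node i l r hl hr =>
    simp only [decorations, DTree.leaves, pow_add]
    refine le_trans ?_ (mul_le_mul hl hr (by positivity) (by positivity))
    rw [← Nat.cast_mul, ← Finset.card_product]
    exact_mod_cast Finset.card_image_le

/-- A sum of absolute values over the leaves of a tree is linear for a suitable choice of signs. -/
lemma exists_mem_decorations {d : ℕ} (u v : Point d → ℝ) (T : DTree d Unit) :
    ∀ p, ∃ τ ∈ decorations T,
      T.leafSum (fun q => |∑ x ∈ pathPts q, u x| + |∑ x ∈ pathPts q, v x|) p =
        ∑ x ∈ pathPts p, (bitSign (τ.eval x).1 * u x + bitSign (τ.eval x).2 * v x) := by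
  induction T with
  | leaf a =>
    intro p
    obtain ⟨b, hb⟩ := exists_bitSign_mul (∑ x ∈ pathPts p, u x)
    obtain ⟨b', hb'⟩ := exists_bitSign_mul (∑ x ∈ pathPts p, v x)
    refine ⟨.leaf (b, b'), by simp [decorations], ?_⟩
    simp only [DTree.leafSum, DTree.eval, ← hb, ← hb', Finset.mul_sum, Finset.sum_add_distrib]
  | node i l r hl hr =>
    intro p
    obtain ⟨τ, hτ, h⟩ := hl ((i, false) :: p)
    obtain ⟨τ', hτ', h'⟩ := hr ((i, true) :: p)
    refine ⟨.node i τ τ', by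
      simp only [decorations, Finset.mem_image, Finset.mem_product]
      exact ⟨(τ, τ'), ⟨hτ, hτ'⟩, rfl⟩, ?_⟩
    simp only [DTree.leafSum, h, h']
    rw [← sum_pathPts_cons _ i p]
    congr 1 <;>
    · refine Finset.sum_congr rfl fun x hx => ?_
      have hx' := (mem_pathPts.1 hx) _ List.mem_cons_self
      simp only at hx'
      simp [DTree.eval, hx']

/-! ### Empirical moments -/

/-- The empirical first moment of the label at a point. -/
def empLabel {d : ℕ} (D : List (Sample d)) (x : Point d) : ℝ :=
  (D.map fun s => if s.1 = x then s.2 else 0).sum / D.length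

/-- The empirical mass of a point. -/
def empMass {d : ℕ} (D : List (Sample d)) (x : Point d) : ℝ :=
  (D.map fun s => if s.1 = x then (1 : ℝ) else 0).sum / D.length

/-- A combination of empirical moments is the average over the samples of a function. -/
lemma sum_mul_emp {d : ℕ} (D : List (Sample d)) (g h : Point d → ℝ) :
    ∑ x, (g x * empLabel D x + h x * empMass D x) =
      (D.map fun s => g s.1 * s.2 + h s.1).sum / D.length := by
  have key : ∀ D : List (Sample d),
      ∑ x, (g x * (D.map fun s => if s.1 = x then s.2 else 0).sum +
        h x * (D.map fun s => if s.1 = x then (1 : ℝ) else 0).sum) =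
      (D.map fun s => g s.1 * s.2 + h s.1).sum := by
    intro D
    induction D with
    | nil => simp
    | cons s D ih =>
      simp only [List.map_cons, List.sum_cons, ← ih]
      have : ∀ x, g x * ((if s.1 = x then s.2 else 0) +
            (D.map fun s => if s.1 = x then s.2 else 0).sum) +
          h x * ((if s.1 = x then (1:ℝ) else 0) +
            (D.map fun s => if s.1 = x then (1 : ℝ) else 0).sum) =
          (if s.1 = x then g x * s.2 + h x else 0) +
          (g x * (D.map fun s => if s.1 = x then s.2 else 0).sum +
            h x * (D.map fun s => if s.1 = x then (1 : ℝ) else 0).sum) := by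
        intro x; split_ifs <;> ring
      simp only [this]
      rw [Finset.sum_add_distrib]
      simp
  rw [← key, Finset.sum_div]
  refine Finset.sum_congr rfl fun x _ => ?_
  rw [empLabel, empMass]; ring

/-- The mass of a point under the law of the features. -/
def pointMass {d : ℕ} (Dx : Measure (Point d)) (x : Point d) : ℝ := Dx.real {x}

section model

variable {d k : ℕ} {m : Point d → Fin k → ℝ} {Dx : Measure (Point d)} {E : Measure (Fin k → ℝ)}

lemma measurable_scoreMap (m : Point d → Fin k → ℝ) :
    Measurable fun p : Point d × (Fin k → ℝ) => (p.1, m p.1 + p.2) :=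
  measurable_fst.prodMk (((Measurable.of_discrete (f := m)).comp measurable_fst).add measurable_snd)

lemma ae_scoreLaw_label (hm : ∀ x i, m x i ∈ Set.Icc (0 : ℝ) 1) (hE : IsBoundedCenteredNoise E) :
    ∀ᵐ z ∂scoreLaw m Dx E, ∀ i, z.2 i ∈ Set.Icc (-(1 / 4) : ℝ) (5 / 4) := by
  have hmeas : MeasurableSet {z : Point d × (Fin k → ℝ) |
      ∀ i, z.2 i ∈ Set.Icc (-(1 / 4) : ℝ) (5 / 4)} := by
    rw [Set.ofPred_forall]
    exact MeasurableSet.iInter fun i =>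
      ((measurable_pi_apply i).comp measurable_snd) measurableSet_Icc
  rw [scoreLaw, ae_map_iff (measurable_scoreMap m).aemeasurable hmeas]
  have h2 : ∀ᵐ p ∂(Dx.prod E), ∀ i, p.2 i ∈ Set.Icc (-(1 / 4) : ℝ) (1 / 4) :=
    Measure.quasiMeasurePreserving_snd.ae hE.1
  filter_upwards [h2] with p hp i
  have h3 := hp i
  have h4 := hm p.1 i
  simp only [Pi.add_apply, Set.mem_Icc] at *
  constructor <;> linarith

variable [IsProbabilityMeasure Dx] [IsProbabilityMeasure E]

instance : IsProbabilityMeasure (scoreLaw m Dx E) :=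
  Measure.isProbabilityMeasure_map (measurable_scoreMap m).aemeasurable

instance (n : ℕ) : IsProbabilityMeasure (sampleLaw m Dx E n) := by
  unfold sampleLaw; infer_instance

/-- The noise is centered and independent of the features, so it drops out of the mean. -/
lemma integral_scoreLaw (hE : IsBoundedCenteredNoise E) (i : Fin k) (g h : Point d → ℝ) :
    ∫ z, (g z.1 * z.2 i + h z.1) ∂scoreLaw m Dx E =
      ∑ x, (g x * (pointMass Dx x * m x i) + h x * pointMass Dx x) := by
  have hξ : Integrable (fun ξ : Fin k → ℝ => ξ i) E :=
    Integrable.of_mem_Icc _ _ (measurable_pi_apply i).aemeasurable (hE.1.mono fun ξ h => h i)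
  have hmeas : ∀ u : Point d → ℝ, Measurable u := fun u => Measurable.of_discrete
  have hint : ∀ u : Point d → ℝ, Integrable u Dx := fun u => Integrable.of_finite
  rw [scoreLaw, integral_map (measurable_scoreMap m).aemeasurable]
  · simp only [Pi.add_apply]
    have e : (fun p : Point d × (Fin k → ℝ) => g p.1 * (m p.1 i + p.2 i) + h p.1) =
        fun p => (g p.1 * m p.1 i + h p.1) + g p.1 * p.2 i := by ext p; ring
    have i1 : Integrable (fun p : Point d × (Fin k → ℝ) => g p.1 * m p.1 i + h p.1)
        (Dx.prod E) := (hint fun x => g x * m x i + h x).comp_fst E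
    have i2 : Integrable (fun p : Point d × (Fin k → ℝ) => g p.1 * p.2 i) (Dx.prod E) :=
      (hint g).mul_prod hξ
    rw [e, integral_add i1 i2, integral_prod_mul (μ := Dx) (ν := E) g (fun ξ => ξ i), hE.2 i, mul_zero,
      add_zero, integral_fun_fst (μ := Dx) (ν := E) (fun x => g x * m x i + h x),
      integral_fintype (hint _)]
    simp only [probReal_univ, one_mul, smul_eq_mul, pointMass]
    exact Finset.sum_congr rfl fun x _ => by ring
  · exact (((hmeas g).comp measurable_fst).mul ((measurable_pi_apply i).comp measurable_snd)
      |>.add ((hmeas h).comp measurable_fst)).aestronglyMeasurable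

/-- With high probability, the empirical moments are close to those of the population, simultaneously for
the cells of all trees of a weighted family. -/
lemma measure_discrepancy_gt_le (hm : ∀ x i, m x i ∈ Set.Icc (0 : ℝ) 1)
    (hE : IsBoundedCenteredNoise E) {n : ℕ} (hn : 0 < n) (i : Fin k) {ι : Type*} (s : Finset ι)
    (T : ι → DTree d Unit) {wt : ι → ℝ} (hwt : ∀ j ∈ s, 0 < wt j) (hsum : ∑ j ∈ s, wt j ≤ 1)
    {η : ℝ} (hη : 0 < η) (hη1 : η ≤ 1) :
    sampleLaw m Dx E n {ω | ∃ j ∈ s,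
      √(81 / 8 * Real.log (2 / (η * (wt j / 4 ^ (T j).leaves))) / n) <
        discrepancy (fun x => empLabel (coordData ω i).val x - pointMass Dx x * m x i)
          (fun x => empMass (coordData ω i).val x - pointMass Dx x) (T j)} ≤ ENNReal.ofReal η := by
  classical
  -- The discrepancy of `T j` is the largest deviation of the variables `Z ⟨j, τ⟩`, for signs `τ`. Their values
  -- are in `[-9/4, 9/4]`, whence `2 * (9 / 4) ^ 2 = 81 / 8`; there are at most `4 ^ (T j).leaves` of them.
  let s' : Finset (Σ _ : ι, DTree d (Bool × Bool)) := s.sigma fun j => decorations (T j)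
  let Z : (Σ _ : ι, DTree d (Bool × Bool)) → Point d × (Fin k → ℝ) → ℝ := fun τ z =>
    bitSign (τ.2.eval z.1).1 * z.2 i + bitSign (τ.2.eval z.1).2
  have hZ : ∀ τ ∈ s', Measurable (Z τ) := by
    intro τ _
    refine Measurable.add (Measurable.mul ?_ ((measurable_pi_apply i).comp measurable_snd)) ?_
    · exact (Measurable.of_discrete (f := fun x : Point d => bitSign (τ.2.eval x).1)).comp
        measurable_fst
    · exact (Measurable.of_discrete (f := fun x : Point d => bitSign (τ.2.eval x).2)).comp
        measurable_fst
  have hc : ∀ τ ∈ s', ∀ᵐ z ∂scoreLaw m Dx E, Z τ z ∈ Set.Icc (-(9 / 4) : ℝ) (9 / 4) := by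
    intro τ _
    filter_upwards [ae_scoreLaw_label (Dx := Dx) hm hE] with z hz
    refine abs_le.1 ((abs_add_le _ _).trans ?_)
    rw [abs_mul, abs_bitSign, abs_bitSign, one_mul]
    have : |z.2 i| ≤ 5 / 4 := abs_le.2 ⟨by linarith [(hz i).1], (hz i).2⟩
    linarith
  have hs : ∑ τ ∈ s', wt τ.1 / 4 ^ (T τ.1).leaves ≤ 1 := by
    refine le_trans ?_ hsum
    rw [Finset.sum_sigma]
    refine Finset.sum_le_sum fun j hj => ?_
    simp only [Finset.sum_const, nsmul_eq_mul]
    have := card_decorations_le (T j)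
    rw [mul_div_assoc', div_le_iff₀ (by positivity), mul_comm]
    exact mul_le_mul_of_nonneg_left this (hwt j hj).le
  have key := hoeffding_union (scoreLaw m Dx E) s' hZ (by norm_num) hc hn
    (wt := fun τ => wt τ.1 / 4 ^ (T τ.1).leaves)
    (fun τ hτ => div_pos (hwt τ.1 (Finset.mem_sigma.1 hτ).1) (by positivity)) hs hη hη1
  refine le_trans (measure_mono ?_) key
  rintro ω ⟨j, hj, hlt⟩
  obtain ⟨τ, hτ, h⟩ := exists_mem_decorations
    (fun x => empLabel (coordData ω i).val x - pointMass Dx x * m x i)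
    (fun x => empMass (coordData ω i).val x - pointMass Dx x) (T j) []
  refine ⟨⟨j, τ⟩, Finset.mem_sigma.2 ⟨hj, hτ⟩, ?_⟩
  have e1 := integral_scoreLaw (m := m) (Dx := Dx) hE i (fun x => bitSign (τ.eval x).1)
    (fun x => bitSign (τ.eval x).2)
  have e2 := sum_mul_emp (coordData ω i).val (fun x => bitSign (τ.eval x).1)
    (fun x => bitSign (τ.eval x).2)
  have e3 : ((coordData ω i).val.map fun s =>
      bitSign (τ.eval s.1).1 * s.2 + bitSign (τ.eval s.1).2).sum =
      ∑ l, Z ⟨j, τ⟩ (ω l) := by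
    simp [coordData, Timed.charge, List.map_ofFn, List.sum_ofFn, Z]
  have e4 : ((coordData ω i).val.length : ℝ) = n := by simp [coordData, Timed.charge]
  rw [e3, e4] at e2
  have e5 : (∑ l, Z ⟨j, τ⟩ (ω l)) / n - ∫ z, Z ⟨j, τ⟩ z ∂scoreLaw m Dx E =
      discrepancy (fun x => empLabel (coordData ω i).val x - pointMass Dx x * m x i)
          (fun x => empMass (coordData ω i).val x - pointMass Dx x) (T j) := by
    rw [discrepancy, h, ← e2, e1, ← Finset.sum_sub_distrib, pathPts_nil]
    exact Finset.sum_congr rfl fun x _ => by ring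
  rw [e5, abs_of_nonneg (discrepancy_nonneg _ _ _)]
  convert hlt using 4
  norm_num

end model

/-! ### Loss and gain of a cell in the population -/

/-- The variance of `f` on the cell of a path, times the mass of the cell, for a law with point masses `w`. -/
def cellLoss {d : ℕ} (w f : Point d → ℝ) (p : List (Fin d × Bool)) : ℝ :=
  ∑ x ∈ pathPts p, w x * f x ^ 2 - crit (fun x => w x * f x) w (pathPts p)

/-- The decrease of the loss of a cell when it is cut in direction `i`. -/
def cellGain {d : ℕ} (w f : Point d → ℝ) (p : List (Fin d × Bool)) (i : Fin d) : ℝ :=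
  crit (fun x => w x * f x) w (pathPts ((i, false) :: p)) +
    crit (fun x => w x * f x) w (pathPts ((i, true) :: p)) - crit (fun x => w x * f x) w (pathPts p)

/-- The loss of a tree whose leaves predict the conditional means. -/
def treeLoss {d : ℕ} {α : Type} (w f : Point d → ℝ) (T : DTree d α) (p : List (Fin d × Bool)) : ℝ :=
  T.leafSum (cellLoss w f) p

section loss

variable {d : ℕ} {α : Type} {w f : Point d → ℝ}

lemma isMoment_mul (hw : ∀ x, 0 ≤ w x) (hf : ∀ x, f x ∈ Set.Icc (0 : ℝ) 1) :
    IsMoment (fun x => w x * f x) w := fun x => by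
  rw [abs_mul, abs_of_nonneg (hw x), abs_of_nonneg (hf x).1]
  nlinarith [hw x, (hf x).2]

lemma cellLoss_nonneg (hw : ∀ x, 0 ≤ w x) (hf : ∀ x, f x ∈ Set.Icc (0 : ℝ) 1)
    (p : List (Fin d × Bool)) : 0 ≤ cellLoss w f p := by
  rw [cellLoss, ← crit_eq (isMoment_mul hw hf)]
  set G := (∑ x ∈ pathPts p, w x * f x) / ∑ x ∈ pathPts p, w x
  rw [sub_nonneg, Finset.mul_sum, Finset.mul_sum, ← Finset.sum_sub_distrib]
  refine Finset.sum_le_sum fun x _ => ?_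
  nlinarith [hw x, mul_nonneg (hw x) (sq_nonneg (f x - G))]

lemma cellLoss_le_mass (hw : ∀ x, 0 ≤ w x) (hf : ∀ x, f x ∈ Set.Icc (0 : ℝ) 1)
    (p : List (Fin d × Bool)) : cellLoss w f p ≤ ∑ x ∈ pathPts p, w x := by
  have h := crit_nonneg (isMoment_mul hw hf) (pathPts p)
  have h2 : ∑ x ∈ pathPts p, w x * f x ^ 2 ≤ ∑ x ∈ pathPts p, w x :=
    Finset.sum_le_sum fun x _ => by
      have := (hf x).1; have := (hf x).2
      nlinarith [hw x, mul_nonneg (hw x) (by nlinarith : 0 ≤ 1 - f x ^ 2)]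
  rw [cellLoss]; linarith

lemma cellGain_nonneg (hw : ∀ x, 0 ≤ w x) (hf : ∀ x, f x ∈ Set.Icc (0 : ℝ) 1)
    (p : List (Fin d × Bool)) (i : Fin d) : 0 ≤ cellGain w f p i := by
  have := crit_le_crit_add_crit (isMoment_mul hw hf) i p
  rw [cellGain]; linarith

lemma cellLoss_cons (p : List (Fin d × Bool)) (i : Fin d) :
    cellLoss w f ((i, false) :: p) + cellLoss w f ((i, true) :: p) =
      cellLoss w f p - cellGain w f p i := by
  rw [cellLoss, cellLoss, cellLoss, cellGain, ← sum_pathPts_cons _ i p]; ring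

lemma treeLoss_eq (T : DTree d α) (p : List (Fin d × Bool)) :
    treeLoss w f T p =
      ∑ x ∈ pathPts p, w x * f x ^ 2 - treeCrit (fun x => w x * f x) w T p := by
  rw [treeLoss, ← T.leafSum_sum (fun x => w x * f x ^ 2), treeCrit, ← T.leafSum_sub]
  rfl

lemma treeLoss_le_cellLoss (hw : ∀ x, 0 ≤ w x) (hf : ∀ x, f x ∈ Set.Icc (0 : ℝ) 1) (T : DTree d α)
    (p : List (Fin d × Bool)) : treeLoss w f T p ≤ cellLoss w f p := by
  rw [treeLoss_eq, cellLoss]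
  have := T.le_leafSum (φ := fun q => crit (fun x => w x * f x) w (pathPts q))
    (fun i q => crit_le_crit_add_crit (isMoment_mul hw hf) i q) p
  rw [treeCrit]; linarith

/-- A cell on which `f` is constant has no loss. -/
lemma cellLoss_eq_zero {p : List (Fin d × Bool)}
    (h : ∀ x ∈ pathPts p, ∀ y ∈ pathPts p, f x = f y) : cellLoss w f p = 0 := by
  rcases (pathPts p).eq_empty_or_nonempty with h0 | ⟨x, hx⟩
  · simp [cellLoss, crit, h0]
  · have h1 : ∑ y ∈ pathPts p, w y * f y ^ 2 = (∑ y ∈ pathPts p, w y) * f x ^ 2 := by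
      rw [Finset.sum_mul]
      exact Finset.sum_congr rfl fun y hy => by rw [h y hy x hx]
    have h2 : ∑ y ∈ pathPts p, w y * f y = (∑ y ∈ pathPts p, w y) * f x := by
      rw [Finset.sum_mul]
      exact Finset.sum_congr rfl fun y hy => by rw [h y hy x hx]
    rw [cellLoss, crit, h1, h2]
    rcases eq_or_ne (∑ y ∈ pathPts p, w y) 0 with h3 | h3
    · simp [h3]
    · field_simp; ring

/-- Cutting again in a direction that the path already fixes gains nothing. -/
lemma cellGain_eq_zero_of_mem {p : List (Fin d × Bool)} {i : Fin d} (hi : i ∈ p.map Prod.fst) :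
    cellGain w f p i = 0 := by
  obtain ⟨⟨j, z⟩, hj, rfl⟩ := List.mem_map.1 hi
  have h1 : pathPts ((j, z) :: p) = pathPts p := by
    rw [pathPts_cons, Finset.filter_true_of_mem]
    exact fun x hx => mem_pathPts.1 hx (j, z) hj
  have h2 : pathPts ((j, !z) :: p) = ∅ := by
    rw [pathPts_cons, Finset.filter_false_of_mem]
    intro x hx
    have := mem_pathPts.1 hx (j, z) hj
    simp only at this
    simp [this]
  cases z <;> simp only [Bool.not_true, Bool.not_false] at h2 <;> simp [cellGain, h1, h2, crit]

lemma treeCrit_fullTree_append_sub (S : List (Fin d)) (i : Fin d) (p : List (Fin d × Bool)) :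
    treeCrit (fun x => w x * f x) w (fullTree (S ++ [i])) p -
      treeCrit (fun x => w x * f x) w (fullTree S) p =
        (fullTree S).leafSum (fun q => cellGain w f q i) p := by
  rw [fullTree_append S i p, treeCrit_refine_sub]
  rfl

lemma treeCrit_fullTree_congr {a b : Point d → ℝ} (h : IsMoment a b) {S S' : List (Fin d)}
    (hS : ∀ i, i ∈ S ↔ i ∈ S') (p : List (Fin d × Bool)) :
    treeCrit a b (fullTree S) p = treeCrit a b (fullTree S') p := by
  rw [treeCrit_fullTree h, treeCrit_fullTree h]
  simp only [hS]

/-- Splitting in all directions on which `f` depends removes the loss. -/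
lemma treeCrit_fullTree_of_relevant (hw : ∀ x, 0 ≤ w x) (hf : ∀ x, f x ∈ Set.Icc (0 : ℝ) 1)
    {S : List (Fin d)} (hS : ∀ x y : Point d, (∀ i ∈ S, x i = y i) → f x = f y)
    (p : List (Fin d × Bool)) :
    treeCrit (fun x => w x * f x) w (fullTree S) p = ∑ x ∈ pathPts p, w x * f x ^ 2 := by
  rw [treeCrit_fullTree (isMoment_mul hw hf)]
  refine Finset.sum_congr rfl fun x hx => ?_
  set A := (pathPts p).filter fun y => ∀ i ∈ S, y i = x i
  have h2 : ∑ y ∈ A, w y * f y = (∑ y ∈ A, w y) * f x := by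
    rw [Finset.sum_mul]
    exact Finset.sum_congr rfl fun y hy => by rw [hS y x (Finset.mem_filter.1 hy).2]
  rcases eq_or_ne (∑ y ∈ A, w y) 0 with h3 | h3
  · have : w x = 0 := by
      rw [Finset.sum_eq_zero_iff_of_nonneg fun y _ => hw y] at h3
      exact h3 x (Finset.mem_filter.2 ⟨hx, fun _ _ => rfl⟩)
    simp [this]
  · rw [h2]; field_simp

end loss

/-! ### The population criteria as sums over points -/

section population

variable {d : ℕ} {Dx : Measure (Point d)}

lemma pointMass_nonneg (x : Point d) : 0 ≤ pointMass Dx x := measureReal_nonneg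

variable [IsProbabilityMeasure Dx] {f : Point d → ℝ}

lemma sum_pointMass (A : Finset (Point d)) : ∑ x ∈ A, pointMass Dx x = Dx.real A := by
  simp [pointMass]

lemma sum_pointMass_univ : ∑ x, pointMass Dx x = 1 := by
  rw [sum_pointMass]; simp

lemma integral_cond_finset (g : Point d → ℝ) (A : Finset (Point d)) :
    ∫ x, g x ∂(ProbabilityTheory.cond Dx A) =
      (∑ x ∈ A, pointMass Dx x * g x) / ∑ x ∈ A, pointMass Dx x := by
  rw [ProbabilityTheory.cond, integral_smul_measure,
    setIntegral_finset (hf := Integrable.of_finite.integrableOn),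
    sum_pointMass]
  simp only [smul_eq_mul, pointMass, ENNReal.toReal_inv, measureReal_def]
  rw [div_eq_inv_mul]

lemma popLocalV_mul_mass (hf : ∀ x, f x ∈ Set.Icc (0 : ℝ) 1) (S : List (Fin d))
    (p : List (Fin d × Bool)) :
    (∑ x ∈ pathPts p, pointMass Dx x) * popLocalV f Dx (pathPts p) S.toFinset =
      treeCrit (fun x => pointMass Dx x * f x) (pointMass Dx) (fullTree S) p := by
  rw [treeCrit_fullTree (isMoment_mul pointMass_nonneg hf), popLocalV, integral_cond_finset]
  have h : ∀ x, ((pathPts p : Finset (Point d)) : Set (Point d)) ∩ cell S.toFinset x =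
      ((pathPts p).filter fun y => ∀ i ∈ S, y i = x i : Finset (Point d)) := by
    intro x; ext y
    simp [cell]
  simp only [h, integral_cond_finset]
  rcases eq_or_ne (∑ x ∈ pathPts p, pointMass Dx x) 0 with h0 | h0
  · rw [h0, zero_mul]
    rw [Finset.sum_eq_zero_iff_of_nonneg fun y _ => pointMass_nonneg y] at h0
    exact (Finset.sum_eq_zero fun x hx => by rw [h0 x hx, zero_mul]).symm
  · field_simp

lemma popV_eq (hf : ∀ x, f x ∈ Set.Icc (0 : ℝ) 1) (S : List (Fin d)) :
    popV f Dx S.toFinset =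
      treeCrit (fun x => pointMass Dx x * f x) (pointMass Dx) (fullTree S) [] := by
  have h := popLocalV_mul_mass (Dx := Dx) hf S []
  rw [pathPts_nil, sum_pointMass_univ, one_mul, Finset.coe_univ] at h
  rw [← h, popLocalV, popV]
  simp

/-- The cell of a path that does not contradict itself is a subcube. -/
lemma exists_pathPts_eq_cell {p : List (Fin d × Bool)} (hp : (pathPts p).Nonempty) :
    ∃ (I : Finset (Fin d)) (a : Point d), ((pathPts p : Finset (Point d)) : Set (Point d)) = cell I a := by
  obtain ⟨a, ha⟩ := hp
  refine ⟨(p.map Prod.fst).toFinset, a, ?_⟩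
  ext x
  simp only [Finset.mem_coe, mem_pathPts, cell, List.mem_toFinset, List.mem_map, Set.mem_ofPred_eq,
    forall_exists_index, and_imp, forall_apply_eq_imp_iff₂]
  exact forall₂_congr fun c hc => by rw [mem_pathPts.1 ha c hc]

end population

/-- All the loss of a cell can be recovered by cuts in `r` directions, so if the gains diminish, some
direction recovers a fraction of it. -/
lemma exists_le_mul_of_sum {ι : Type*} {R : Finset ι} {r : ℕ} (hR : R.card = r) (hr : 1 ≤ r)
    {C l : ℝ} (hC : 0 ≤ C) {g : ι → ℝ} (h : l ≤ C * ∑ i ∈ R, g i) : ∃ i, l ≤ C * r * g i := by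
  have hne : R.Nonempty := Finset.card_pos.1 (by omega)
  obtain ⟨i, _, hi⟩ := Finset.exists_max_image R g hne
  refine ⟨i, h.trans ?_⟩
  rw [mul_assoc]
  refine mul_le_mul_of_nonneg_left ?_ hC
  have := Finset.sum_le_card_nsmul R g (g i) hi
  rwa [hR, nsmul_eq_mul] at this

section hypotheses

variable {d r : ℕ} {Dx : Measure (Point d)} [IsProbabilityMeasure Dx] {f : Point d → ℝ} {C : ℝ}

lemma IsSparse.exists_relevant (h : IsSparse r f) :
    ∃ R : Finset (Fin d), R.card = r ∧ ∀ x y : Point d, (∀ i ∈ R, x i = y i) → f x = f y := by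
  obtain ⟨R, hR, g, hg⟩ := h
  refine ⟨R, hR, fun x y hxy => ?_⟩
  rw [hg, hg]
  congr 1; ext i; exact hxy i i.2

lemma ApproxSubmodular.exists_gain (h : ApproxSubmodular C f Dx)
    (hf : ∀ x, f x ∈ Set.Icc (0 : ℝ) 1) (hs : IsSparse r f) (hr : 1 ≤ r) (hC : 1 ≤ C)
    (S : List (Fin d)) :
    ∃ i, treeLoss (pointMass Dx) f (fullTree S) [] ≤
      C * r * (fullTree S).leafSum (fun q => cellGain (pointMass Dx) f q i) [] := by
  obtain ⟨R, hR, hdep⟩ := hs.exists_relevant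
  refine exists_le_mul_of_sum hR hr (by linarith) ?_
  -- Adding the directions of `R'` one by one gains at most `C` times what each gains at once.
  have tel : ∀ R' : Finset (Fin d), popV f Dx (S.toFinset ∪ R') - popV f Dx S.toFinset ≤
      C * ∑ i ∈ R', (popV f Dx (insert i S.toFinset) - popV f Dx S.toFinset) := by
    intro R'
    induction R' using Finset.induction_on with
    | empty => simp
    | insert j R' hj ih =>
      rw [Finset.sum_insert hj, mul_add, Finset.union_insert]
      have := h S.toFinset (S.toFinset ∪ R') Finset.subset_union_left j
      linarith
  have hl := tel R
  have e1 : S.toFinset ∪ R = (S ++ R.toList).toFinset := by ext; simp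
  have e2 : ∀ i, insert i S.toFinset = (S ++ [i]).toFinset := by
    intro i; ext; simp
  simp only [e1, e2, popV_eq hf] at hl
  rw [treeCrit_fullTree_of_relevant pointMass_nonneg hf
    (fun x y hxy => hdep x y fun i hi => hxy i (by simp [hi]))] at hl
  simp only [treeCrit_fullTree_append_sub] at hl
  rwa [treeLoss_eq]

lemma ApproxDiminishingReturns.exists_gain (h : ApproxDiminishingReturns C f Dx)
    (hf : ∀ x, f x ∈ Set.Icc (0 : ℝ) 1) (hs : IsSparse r f) (hr : 1 ≤ r) (hC : 1 ≤ C)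
    (p : List (Fin d × Bool)) :
    ∃ i, cellLoss (pointMass Dx) f p ≤ C * r * cellGain (pointMass Dx) f p i := by
  obtain ⟨R, hR, hdep⟩ := hs.exists_relevant
  refine exists_le_mul_of_sum hR hr (by linarith) ?_
  rcases (pathPts p).eq_empty_or_nonempty with h0 | h0
  · have h1 : ∀ i z, pathPts ((i, z) :: p) = ∅ := by
      intro i z; rw [pathPts_cons, h0]; simp
    simp [cellLoss, cellGain, h0, h1, crit]
  obtain ⟨I, a, hIa⟩ := exists_pathPts_eq_cell h0
  -- Cutting the cell in the directions of `R'` one by one gains at most `C` times what each gains at once.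
  have tel : ∀ R' : Finset (Fin d), popLocalV f Dx (pathPts p) R' - popLocalV f Dx (pathPts p) ∅ ≤
      C * ∑ i ∈ R', (popLocalV f Dx (pathPts p) {i} - popLocalV f Dx (pathPts p) ∅) := by
    intro R'
    induction R' using Finset.induction_on with
    | empty => simp
    | insert j R' hj ih =>
      rw [Finset.sum_insert hj, mul_add]
      have := h I I a a le_rfl R' j
      rw [← hIa] at this
      linarith
  have hl := mul_le_mul_of_nonneg_left (tel R)
    (Finset.sum_nonneg fun x (_ : x ∈ pathPts p) => pointMass_nonneg (Dx := Dx) x)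
  rw [mul_left_comm, Finset.mul_sum] at hl
  have e1 : R = R.toList.toFinset := by simp
  have e2 : ∀ i : Fin d, ({i} : Finset (Fin d)) = ([i] : List (Fin d)).toFinset := by simp
  have e3 : (∅ : Finset (Fin d)) = ([] : List (Fin d)).toFinset := by simp
  rw [e1, e3] at hl
  simp only [e2, mul_sub, popLocalV_mul_mass hf] at hl
  rw [treeCrit_fullTree_of_relevant pointMass_nonneg hf
    (fun x y hxy => hdep x y fun i hi => hxy i (by simp [hi]))] at hl
  simpa [treeCrit, fullTree, DTree.leafSum, cellLoss, cellGain] using hl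

/-- Under a product law, a direction on which `f` does not depend gains nothing. -/
lemma IsProductLaw.cellGain_eq_zero (h : IsProductLaw Dx) {i : Fin d}
    (hi : ∀ x z, f (Function.update x i z) = f x) (p : List (Fin d × Bool)) :
    cellGain (pointMass Dx) f p i = 0 := by
  by_cases hp : i ∈ p.map Prod.fst
  · exact cellGain_eq_zero_of_mem hp
  obtain ⟨μ, hμ, rfl⟩ := h
  have hmass : ∀ x : Point d, pointMass (Measure.pi μ) x = ∏ j, (μ j).real {x j} := by
    intro x
    rw [pointMass, measureReal_def, ← Set.univ_pi_singleton, Measure.pi_pi, ENNReal.toReal_prod]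
    rfl
  -- The mass of a point factors into the mass of its coordinate `i` and a rest that ignores it.
  set rest : Point d → ℝ := fun x => ∏ j ∈ Finset.univ.erase i, (μ j).real {x j}
  have hfac : ∀ x : Point d, pointMass (Measure.pi μ) x = (μ i).real {x i} * rest x := by
    intro x
    rw [hmass, ← Finset.mul_prod_erase _ _ (Finset.mem_univ i)]
  have hrest : ∀ x z, rest (Function.update x i z) = rest x := by
    intro x z
    refine Finset.prod_congr rfl fun j hj => ?_
    rw [Function.update_of_ne (Finset.ne_of_mem_erase hj)]
  have hmem : ∀ x z, x ∈ pathPts p → Function.update x i z ∈ pathPts ((i, z) :: p) := by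
    intro x z hx
    rw [mem_pathPts] at hx ⊢
    intro c hc
    rcases List.mem_cons.1 hc with rfl | hc
    · simp
    · have : c.1 ≠ i := fun h => hp (List.mem_map.2 ⟨c, hc, h⟩)
      rw [Function.update_of_ne this]; exact hx c hc
  have hsub : ∀ z, pathPts ((i, z) :: p) ⊆ pathPts p := by
    intro z; rw [pathPts_cons]; exact Finset.filter_subset _ _
  have hz : ∀ z, ∀ x ∈ pathPts ((i, z) :: p), x i = z := by
    intro z x hx; exact mem_pathPts.1 hx _ List.mem_cons_self
  have hflip : ∀ g : Point d → ℝ, (∀ x z, g (Function.update x i z) = g x) →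
      ∑ x ∈ pathPts ((i, false) :: p), g x = ∑ x ∈ pathPts ((i, true) :: p), g x := by
    intro g hg
    refine Finset.sum_bij' (fun x _ => Function.update x i true)
      (fun x _ => Function.update x i false) ?_ ?_ ?_ ?_ ?_
    · exact fun x hx => hmem x true (hsub _ hx)
    · exact fun x hx => hmem x false (hsub _ hx)
    · intro x hx
      simp only [Function.update_idem]
      rw [← hz _ x hx, Function.update_eq_self]
    · intro x hx
      simp only [Function.update_idem]
      rw [← hz _ x hx, Function.update_eq_self]
    · exact fun x _ => (hg x true).symm
  have hsum : ∀ (g : Point d → ℝ), (∀ x z, g (Function.update x i z) = g x) → ∀ z,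
      ∑ x ∈ pathPts ((i, z) :: p), pointMass (Measure.pi μ) x * g x =
        (μ i).real {z} * ∑ x ∈ pathPts ((i, true) :: p), rest x * g x := by
    intro g hg z
    have e : ∑ x ∈ pathPts ((i, z) :: p), rest x * g x =
        ∑ x ∈ pathPts ((i, true) :: p), rest x * g x := by
      cases z
      · exact hflip _ fun x z => by rw [hrest, hg]
      · rfl
    rw [← e, Finset.mul_sum]
    refine Finset.sum_congr rfl fun x hx => ?_
    rw [hfac, hz z x hx]; ring
  have hF := hsum f hi
  have hP := hsum (fun _ => 1) fun _ _ => rfl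
  simp only [mul_one] at hP
  rw [cellGain]
  simp only [crit]
  rw [← sum_pathPts_cons (fun x => pointMass (Measure.pi μ) x * f x) i p,
    ← sum_pathPts_cons (pointMass (Measure.pi μ)) i p, hF, hF, hP, hP]
  have hone : (μ i).real {false} + (μ i).real {true} = 1 := by
    have := hμ i
    have h1 : (μ i).real (Finset.univ : Finset Bool) = 1 := by
      rw [Finset.coe_univ, probReal_univ]
    rw [← sum_measureReal_singleton] at h1
    simpa [add_comm] using h1
  set F := ∑ x ∈ pathPts ((i, true) :: p), rest x * f x
  set P := ∑ x ∈ pathPts ((i, true) :: p), rest x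
  set u := (μ i).real {false}
  set v := (μ i).real {true}
  rw [← add_mul, ← add_mul, hone, one_mul, one_mul]
  -- The conditional means of the two halves agree, so their criteria are proportional to their masses.
  have hq : ∀ c : ℝ, (c * F) ^ 2 / (c * P) = c * (F ^ 2 / P) := by
    intro c
    rcases eq_or_ne c 0 with rfl | hc
    · simp
    · rw [mul_pow, pow_two c, mul_assoc, mul_div_mul_left _ _ hc, mul_div_assoc]
  rw [hq, hq, ← add_mul, hone, one_mul, sub_self]

end hypotheses

/-! ### What the subroutines compute -/

@[simp] lemma Timed.val_bind {α β : Type} (u : Timed α) (f : α → Timed β) :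
    (u >>= f).val = (f u.val).val := rfl

@[simp] lemma Timed.val_op {α : Type} (a : α) : (op a).val = a := rfl

@[simp] lemma Timed.val_charge {α : Type} (c : ℕ) (a : α) : (charge c a).val = a := rfl

/-- The average label of a list of samples, `0` for the empty list. -/
def avgLabel {d : ℕ} (D : List (Sample d)) : ℝ := (D.map Prod.snd).sum / D.length

section subroutines

variable {d : ℕ}

lemma sumCount_val (D : List (Sample d)) :
    (sumCount D).val = ((D.map Prod.snd).sum, D.length) := by
  induction D with
  | nil => rfl
  | cons s D ih => simp [sumCount, ih, add_comm]

@[simp] lemma meanLabel_val (D : List (Sample d)) : (meanLabel D).val = avgLabel D := by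
  simp [meanLabel, sumCount_val, avgLabel]

@[simp] lemma splitOn_val (i : Fin d) (D : List (Sample d)) :
    (splitOn i D).val = (D.filter fun s => s.1 i = false, D.filter fun s => s.1 i = true) := by
  induction D with
  | nil => rfl
  | cons s D ih =>
    rcases h : s.1 i with _ | _ <;> simp [splitOn, ih, h]

lemma scanMax_val (score : Fin d → Timed ℝ) {I : List (Fin d)} (hI : I ≠ []) :
    ∃ i ∈ I, (scanMax score I).val = some (i, (score i).val) ∧
      ∀ j ∈ I, (score j).val ≤ (score i).val := by
  induction I with
  | nil => exact absurd rfl hI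
  | cons i I ih =>
    rcases eq_or_ne I [] with rfl | hI'
    · exact ⟨i, by simp, by simp [scanMax], by simp⟩
    · obtain ⟨j, hj, hv, hmax⟩ := ih hI'
      by_cases hle : (score j).val ≤ (score i).val
      · refine ⟨i, by simp, by simp [scanMax, hv, hle], ?_⟩
        intro l hl
        rcases List.mem_cons.1 hl with rfl | hl
        · exact le_rfl
        · exact (hmax l hl).trans hle
      · refine ⟨j, by simp [hj], by simp [scanMax, hv, hle], ?_⟩
        intro l hl
        rcases List.mem_cons.1 hl with rfl | hl
        · exact (not_le.1 hle).le
        · exact hmax l hl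

lemma agrees_val (S : List (Fin d)) (x z : Point d) :
    (agrees S x z).val = decide (∀ i ∈ S, z i = x i) := by
  induction S with
  | nil => simp [agrees]
  | cons i S ih =>
    by_cases h : x i = z i
    · simp [agrees, ih, h]
    · simp [agrees, h, Ne.symm h]

lemma samplesAgreeing_val (S : List (Fin d)) (x : Point d) (D : List (Sample d)) :
    (samplesAgreeing S x D).val = D.filter fun s => ∀ i ∈ S, s.1 i = x i := by
  induction D with
  | nil => rfl
  | cons s D ih =>
    rw [List.filter_cons]
    simp only [samplesAgreeing, Timed.val_bind, agrees_val, ih]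
    split_ifs <;> rfl

lemma sumSqFit_val (S : List (Fin d)) (D E : List (Sample d)) :
    (sumSqFit S D E).val =
      (E.map fun s => avgLabel (D.filter fun s' => ∀ i ∈ S, s'.1 i = s.1 i) ^ 2).sum := by
  induction E with
  | nil => rfl
  | cons s E ih => simp [sumSqFit, samplesAgreeing_val, ih]

end subroutines

section empirical

variable {d : ℕ}

lemma sum_empLabel (D : List (Sample d)) (A : Finset (Point d)) :
    ∑ x ∈ A, empLabel D x = ((D.filter fun s => s.1 ∈ A).map Prod.snd).sum / D.length := by
  have h := sum_mul_emp D (fun x => if x ∈ A then 1 else 0) (fun _ => 0)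
  simp only [ite_mul, one_mul, zero_mul, add_zero, Finset.sum_ite_mem, Finset.univ_inter] at h
  rw [h]
  clear h
  congr 1
  induction D with
  | nil => rfl
  | cons s D ih => by_cases hs : s.1 ∈ A <;> simp [hs, ih]

lemma sum_empMass (D : List (Sample d)) (A : Finset (Point d)) :
    ∑ x ∈ A, empMass D x = ((D.filter fun s => s.1 ∈ A).length : ℝ) / D.length := by
  have h := sum_mul_emp D (fun _ => 0) (fun x => if x ∈ A then 1 else 0)
  simp only [ite_mul, one_mul, zero_mul, zero_add, Finset.sum_ite_mem, Finset.univ_inter] at h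
  rw [h]
  clear h
  congr 1
  induction D with
  | nil => simp
  | cons s D ih => by_cases hs : s.1 ∈ A <;> simp [hs, ih, add_comm]

lemma avgLabel_filter (D : List (Sample d)) (A : Finset (Point d)) :
    avgLabel (D.filter fun s => s.1 ∈ A) = (∑ x ∈ A, empLabel D x) / ∑ x ∈ A, empMass D x := by
  rw [sum_empLabel, sum_empMass, avgLabel]
  rcases eq_or_ne (D.length : ℝ) 0 with h | h
  · have : D = [] := List.length_eq_zero_iff.1 (by exact_mod_cast h)
    simp [this]
  · rw [div_div_div_cancel_right₀ h]

lemma isMoment_emp {D : List (Sample d)} (hD : ∀ s ∈ D, s.2 ∈ Set.Icc (-(1 / 4) : ℝ) (5 / 4)) :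
    IsMoment (empLabel D) (empMass D) := by
  intro x
  rw [empLabel, empMass, abs_div, mul_div_assoc', Nat.abs_cast]
  refine div_le_div_of_nonneg_right ?_ (by positivity)
  induction D with
  | nil => simp
  | cons s D ih =>
    have h1 := ih fun s hs => hD s (by simp [hs])
    have h2 := hD s (by simp)
    simp only [List.map_cons, List.sum_cons, mul_add]
    refine (abs_add_le _ _).trans (add_le_add ?_ h1)
    split_ifs
    · rw [mul_one]; exact abs_le.2 ⟨by linarith [h2.1], h2.2⟩
    · simp

lemma avgLabel_mem {D : List (Sample d)} (hD : ∀ s ∈ D, s.2 ∈ Set.Icc (-(1 / 4) : ℝ) (5 / 4)) :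
    avgLabel D ∈ Set.Icc (-(1 / 4) : ℝ) (5 / 4) := by
  rcases eq_or_ne D [] with rfl | hne
  · simp [avgLabel]; norm_num
  have hpos : (0 : ℝ) < D.length := by exact_mod_cast List.length_pos_iff.2 hne
  have h : ∀ D : List (Sample d), (∀ s ∈ D, s.2 ∈ Set.Icc (-(1 / 4) : ℝ) (5 / 4)) →
      -(1 / 4) * (D.length : ℝ) ≤ (D.map Prod.snd).sum ∧
        (D.map Prod.snd).sum ≤ 5 / 4 * (D.length : ℝ) := by
    intro D
    induction D with
    | nil => simp
    | cons s D ih =>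
      intro hD
      obtain ⟨h1, h2⟩ := ih fun s hs => hD s (by simp [hs])
      have h3 := hD s (by simp)
      simp only [List.map_cons, List.sum_cons, List.length_cons, Nat.cast_add, Nat.cast_one]
      constructor <;> linarith [h3.1, h3.2]
  exact ⟨(le_div_iff₀ hpos).2 (h D hD).1, (div_le_iff₀ hpos).2 (h D hD).2⟩

lemma empV_val {D : List (Sample d)} (hD : ∀ s ∈ D, s.2 ∈ Set.Icc (-(1 / 4) : ℝ) (5 / 4))
    (S : List (Fin d)) :
    (empV S D).val = treeCrit (empLabel D) (empMass D) (fullTree S) [] := by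
  rw [treeCrit_fullTree (isMoment_emp hD), pathPts_nil]
  have h := sum_mul_emp D (fun _ => 0) (fun x =>
    ((∑ y ∈ Finset.univ.filter fun y => ∀ i ∈ S, y i = x i, empLabel D y) /
      ∑ y ∈ Finset.univ.filter fun y => ∀ i ∈ S, y i = x i, empMass D y) ^ 2)
  simp only [zero_mul, zero_add, ← avgLabel_filter] at h
  simp only [← avgLabel_filter, mul_comm (empMass D _)]
  rw [h]
  simp [empV, sumSqFit_val]

end empirical

/-! ### Level-Splits -/

section level

variable {d : ℕ}

/-- Each direction chosen by the greedy rule maximizes the empirical criterion. -/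
lemma greedySplits_step {D : List (Sample d)}
    (hD : ∀ s ∈ D, s.2 ∈ Set.Icc (-(1 / 4) : ℝ) (5 / 4)) (hd : 0 < d) (S : List (Fin d)) (H : ℕ) :
    ∃ i, (greedySplits D (H + 1) S).val = (greedySplits D H (S ++ [i])).val ∧
      ∀ j, treeCrit (empLabel D) (empMass D) (fullTree (S ++ [j])) [] ≤
        treeCrit (empLabel D) (empMass D) (fullTree (S ++ [i])) [] := by
  have hne : List.finRange d ≠ [] := by
    intro h
    have := congrArg List.length h
    simp at this; omega
  obtain ⟨i, _, hv, hmax⟩ := scanMax_val (fun i => empV (i :: S) D) hne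
  refine ⟨i, by simp [greedySplits, hv], fun j => ?_⟩
  have := hmax j (List.mem_finRange j)
  rw [empV_val hD, empV_val hD] at this
  rwa [treeCrit_fullTree_congr (isMoment_emp hD) (S := S ++ [j]) (S' := j :: S) (by simp [or_comm]),
    treeCrit_fullTree_congr (isMoment_emp hD) (S := S ++ [i]) (S' := i :: S) (by simp [or_comm])]

/-- `levelTree` with the emptiness tests as propositions. -/
lemma levelTree_cons_val (i : Fin d) (S : List (Fin d)) (D : List (Sample d)) :
    (levelTree (i :: S) D).val =
      if (D.filter fun s => s.1 i = false) = [] ∨ (D.filter fun s => s.1 i = true) = [] then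
        (levelTree S D).val
      else .node i (levelTree S (D.filter fun s => s.1 i = false)).val
        (levelTree S (D.filter fun s => s.1 i = true)).val := by
  have h : ∀ (b : Bool) (X Y : Timed (DTree d ℝ)),
      (if b then X else Y).val = if b then X.val else Y.val := by
    intro b X Y; cases b <;> rfl
  refine (h ((splitOn i D).val.1.isEmpty || (splitOn i D).val.2.isEmpty) _ _).trans ?_
  simp only [splitOn_val, Bool.or_eq_true, List.isEmpty_iff]
  rfl

lemma levelTree_eval_mem {D : List (Sample d)}
    (hD : ∀ s ∈ D, s.2 ∈ Set.Icc (-(1 / 4) : ℝ) (5 / 4)) (S : List (Fin d)) (x : Point d) :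
    (levelTree S D).val.eval x ∈ Set.Icc (-(1 / 4) : ℝ) (5 / 4) := by
  induction S generalizing D with
  | nil => simpa [levelTree, DTree.eval] using avgLabel_mem hD
  | cons i S ih =>
    rw [levelTree_cons_val]
    split_ifs
    · exact ih hD
    · simp only [DTree.eval]
      split_ifs
      · exact ih fun s hs => hD s (List.mem_filter.1 hs).1
      · exact ih fun s hs => hD s (List.mem_filter.1 hs).1

/-- Where there are training samples that agree with `x` on all split directions, the tree predicts their
average label, although some cells are left unsplit at some levels. -/
lemma levelTree_eval (D : List (Sample d)) (S : List (Fin d)) (x : Point d)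
    (hne : (D.filter fun s => ∀ i ∈ S, s.1 i = x i) ≠ []) :
    (levelTree S D).val.eval x = avgLabel (D.filter fun s => ∀ i ∈ S, s.1 i = x i) := by
  induction S generalizing D with
  | nil => simp [levelTree, DTree.eval]
  | cons i S ih =>
    have hfil : (D.filter fun s => ∀ j ∈ i :: S, s.1 j = x j) =
        (D.filter fun s => s.1 i = x i).filter fun s => ∀ j ∈ S, s.1 j = x j := by
      rw [List.filter_filter]
      refine List.filter_congr fun s _ => ?_
      simp [Bool.and_comm]
    rw [hfil] at hne ⊢
    rw [levelTree_cons_val]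
    split_ifs with hb
    · -- The half of `x` is not empty, so the other one is, and the half of `x` is everything.
      have hall : (D.filter fun s => s.1 i = x i) = D := by
        rw [List.filter_eq_self]
        have hx : (D.filter fun s => s.1 i = x i) ≠ [] := by
          intro h0; rw [h0] at hne; simp at hne
        intro s hs
        rcases h : x i with _ | _ <;> rcases h' : s.1 i with _ | _ <;> simp
        · rw [h] at hx
          rcases hb with hb | hb
          · exact hx hb
          · have := List.filter_eq_nil_iff.1 hb s hs; simp [h'] at this
        · rw [h] at hx
          rcases hb with hb | hb
          · have := List.filter_eq_nil_iff.1 hb s hs; simp [h'] at this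
          · exact hx hb
      rw [hall] at hne ⊢
      exact ih D hne
    · simp only [DTree.eval]
      rcases h : x i with _ | _
      · rw [h] at hne
        simpa using ih _ hne
      · rw [h] at hne
        simpa using ih _ hne

end level

/-- The risk of an estimate that equals the empirical average on each leaf that contains samples. -/
lemma tree_risk_le {d : ℕ} {α : Type} {a b w f g : Point d → ℝ} (h : IsMoment a b)
    (hw : ∀ x, 0 ≤ w x) (hf : ∀ x, f x ∈ Set.Icc (0 : ℝ) 1)
    (hg : ∀ x, g x ∈ Set.Icc (-(1 / 4) : ℝ) (5 / 4)) (T : DTree d α)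
    (hT : ∀ x, 0 < ∑ y ∈ pathPts (T.leafPath x []), b y → g x =
      (∑ y ∈ pathPts (T.leafPath x []), a y) / ∑ y ∈ pathPts (T.leafPath x []), b y) :
    ∑ x, w x * (f x - g x) ^ 2 ≤ treeLoss w f T [] +
      6 * discrepancy (fun x => a x - w x * f x) (fun x => b x - w x) T := by
  rw [discrepancy, treeLoss, ← T.leafSum_mul, ← T.leafSum_add, ← pathPts_nil]
  have key : ∀ (T : DTree d α) (p), (∀ x ∈ pathPts p, 0 < ∑ y ∈ pathPts (T.leafPath x p), b y → g x =
      (∑ y ∈ pathPts (T.leafPath x p), a y) / ∑ y ∈ pathPts (T.leafPath x p), b y) →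
      ∑ x ∈ pathPts p, w x * (f x - g x) ^ 2 ≤ T.leafSum (fun q => cellLoss w f q +
        6 * (|∑ x ∈ pathPts q, (a x - w x * f x)| + |∑ x ∈ pathPts q, (b x - w x)|)) p := by
    intro T
    induction T with
    | leaf c => intro p hp; exact cell_risk_le h hw hf hg _ fun h0 x hx => hp x hx h0
    | node i l r hl hr =>
      intro p hp
      rw [← sum_pathPts_cons _ i p]
      have hmem : ∀ z, ∀ x ∈ pathPts ((i, z) :: p), x ∈ pathPts p ∧ x i = z := by
        intro z x hx; rwa [pathPts_cons, Finset.mem_filter] at hx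
      refine add_le_add (hl _ fun x hx => ?_) (hr _ fun x hx => ?_)
      · have := hp x (hmem _ x hx).1
        simpa only [DTree.leafPath, (hmem _ x hx).2, Bool.false_eq_true, if_false] using this
      · have := hp x (hmem _ x hx).1
        simpa only [DTree.leafPath, (hmem _ x hx).2, if_true] using this
  exact key T [] fun x _ => hT x

/-! ### Breiman's algorithm -/

section breiman

variable {d : ℕ}

/-- Each leaf carries exactly the samples of `D` in its cell. -/
def DTree.Carries (D : List (Sample d)) :
    DTree d (List (Sample d)) → List (Fin d × Bool) → Prop
  | .leaf A, p => A = D.filter fun s => s.1 ∈ pathPts p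
  | .node i l r, p => l.Carries D ((i, false) :: p) ∧ r.Carries D ((i, true) :: p)

/-- The direction in which Breiman's algorithm cuts the cell of a path, if it may be cut. -/
def breimanDir (D : List (Sample d)) (p : List (Fin d × Bool)) : Option (Fin d) :=
  if 2 ≤ (D.filter fun s => s.1 ∈ pathPts p).length then
    (scanMax (localV (D.filter fun s => s.1 ∈ pathPts p)) (List.finRange d)).val.map Prod.fst
  else none

lemma filter_pathPts_cons (D : List (Sample d)) (i : Fin d) (z : Bool) (p : List (Fin d × Bool)) :
    (D.filter fun s => s.1 ∈ pathPts ((i, z) :: p)) =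
      (D.filter fun s => s.1 ∈ pathPts p).filter fun s => s.1 i = z := by
  rw [List.filter_filter]
  refine List.filter_congr fun s _ => ?_
  rw [pathPts_cons]
  simp [and_comm]

lemma breimanLevel_leaf_val (D : List (Sample d)) (p : List (Fin d × Bool)) (b : ℕ) :
    (breimanLevel (.leaf (D.filter fun s => s.1 ∈ pathPts p)) b).val =
      if b = 0 then (.leaf (D.filter fun s => s.1 ∈ pathPts p), 0) else
      (breimanDir D p).elim (.leaf (D.filter fun s => s.1 ∈ pathPts p), b) fun i =>
        (.node i (.leaf (D.filter fun s => s.1 ∈ pathPts ((i, false) :: p)))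
          (.leaf (D.filter fun s => s.1 ∈ pathPts ((i, true) :: p))), b - 1) := by
  rcases Nat.eq_zero_or_pos b with rfl | hb
  · simp [breimanLevel]
  rw [if_neg hb.ne']
  simp only [filter_pathPts_cons]
  set A := D.filter fun s => s.1 ∈ pathPts p
  by_cases h : 2 ≤ A.length
  · have hdir : breimanDir D p = (scanMax (localV A) (List.finRange d)).val.map Prod.fst := if_pos h
    rw [hdir]
    rcases hs : (scanMax (localV A) (List.finRange d)).val with _ | ⟨i, v⟩ <;>
      simp [breimanLevel, h, hb, hs]
  · have hdir : breimanDir D p = none := if_neg h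
    rw [hdir]
    simp [breimanLevel, h]

/-- A round with enough cuts left cuts every leaf that may be cut. -/
lemma breimanLevel_full {D : List (Sample d)} (T : DTree d (List (Sample d))) :
    ∀ p b, T.Carries D p → T.leaves ≤ b →
      (breimanLevel T b).val.1.Carries D p ∧
      (breimanLevel T b).val.1.shape = T.shape.refine (breimanDir D) p ∧
      b ≤ (breimanLevel T b).val.2 + T.leaves := by
  induction T with
  | leaf A =>
    intro p b hA hb
    simp only [DTree.Carries] at hA
    simp only [DTree.leaves] at hb
    subst hA
    rw [breimanLevel_leaf_val, if_neg (by omega)]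
    simp only [DTree.shape, DTree.refine, DTree.leaves]
    cases breimanDir D p
    · simp [DTree.Carries, DTree.shape]
    · simp only [Option.elim, DTree.Carries, DTree.shape, true_and, and_self]; omega
  | node i l r hl hr =>
    intro p b hT hb
    simp only [DTree.Carries, DTree.leaves] at hT hb
    obtain ⟨l1, l2, l3⟩ := hl _ b hT.1 (by omega)
    obtain ⟨r1, r2, r3⟩ := hr _ (breimanLevel l b).val.2 hT.2 (by omega)
    simp only [breimanLevel, Timed.val_bind, Timed.val_op, DTree.Carries, DTree.shape, DTree.refine,
      DTree.leaves]
    exact ⟨⟨l1, r1⟩, by rw [l2, r2], by omega⟩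

/-- A round refines the tree and accounts for its cuts. -/
lemma breimanLevel_refines {D : List (Sample d)} {w f : Point d → ℝ} (hw : ∀ x, 0 ≤ w x)
    (hf : ∀ x, f x ∈ Set.Icc (0 : ℝ) 1) (T : DTree d (List (Sample d))) :
    ∀ p b, T.Carries D p →
      (breimanLevel T b).val.1.Carries D p ∧
      (breimanLevel T b).val.1.leaves + (breimanLevel T b).val.2 = T.leaves + b ∧
      treeLoss w f (breimanLevel T b).val.1 p ≤ treeLoss w f T p := by
  induction T with
  | leaf A =>
    intro p b hA
    simp only [DTree.Carries] at hA
    subst hA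
    rw [breimanLevel_leaf_val]
    split_ifs with h0
    · simp [DTree.Carries, DTree.leaves, h0]
    · cases breimanDir D p with
      | none => simp [DTree.Carries, DTree.leaves]
      | some i =>
        refine ⟨⟨rfl, rfl⟩, ?_, treeLoss_le_cellLoss hw hf _ p⟩
        simp only [Option.elim, DTree.leaves]; omega
  | node i l r hl hr =>
    intro p b hT
    simp only [DTree.Carries] at hT
    obtain ⟨l1, l2, l3⟩ := hl _ b hT.1
    obtain ⟨r1, r2, r3⟩ := hr _ (breimanLevel l b).val.2 hT.2
    simp only [breimanLevel, Timed.val_bind, Timed.val_op, DTree.Carries, DTree.leaves]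
    exact ⟨⟨l1, r1⟩, by omega, add_le_add l3 r3⟩

lemma breimanGrow_refines {D : List (Sample d)} {w f : Point d → ℝ} (hw : ∀ x, 0 ≤ w x)
    (hf : ∀ x, f x ∈ Set.Icc (0 : ℝ) 1) (L : ℕ) :
    ∀ (T : DTree d (List (Sample d))) (b : ℕ), T.Carries D [] →
      (breimanGrow L T b).val.Carries D [] ∧
      (breimanGrow L T b).val.leaves ≤ T.leaves + b ∧
      treeLoss w f (breimanGrow L T b).val [] ≤ treeLoss w f T [] := by
  induction L with
  | zero => intro T b hT; exact ⟨hT, Nat.le_add_right _ _, le_rfl⟩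
  | succ L ih =>
    intro T b hT
    obtain ⟨h1, h2, h3⟩ := breimanLevel_refines hw hf T [] b hT
    obtain ⟨g1, g2, g3⟩ := ih _ (breimanLevel T b).val.2 h1
    exact ⟨g1, g2.trans h2.le, g3.trans h3⟩

/-- If there is a budget for `H` complete rounds, then the tree refines the one after `H` complete rounds. -/
lemma breimanGrow_full {D : List (Sample d)} {w f : Point d → ℝ} (hw : ∀ x, 0 ≤ w x)
    (hf : ∀ x, f x ∈ Set.Icc (0 : ℝ) 1) (H L : ℕ) :
    ∀ (T : DTree d (List (Sample d))) (b N : ℕ), T.Carries D [] → T.leaves ≤ N →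
      N * 2 ^ H ≤ N + b →
      (breimanGrow (H + L) T b).val.Carries D [] ∧
      (breimanGrow (H + L) T b).val.leaves ≤ T.leaves + b ∧
      treeLoss w f (breimanGrow (H + L) T b).val [] ≤
        treeLoss w f ((fun X : DTree d Unit => X.refine (breimanDir D) [])^[H] T.shape) [] := by
  induction H with
  | zero =>
    intro T b N hT _ _
    obtain ⟨h1, h2, h3⟩ := breimanGrow_refines hw hf L T b hT
    rw [zero_add]
    exact ⟨h1, h2, by simpa [treeLoss] using h3⟩
  | succ H ih =>
    intro T b N hT hN hb
    have hpow : N * 2 ^ (H + 1) = 2 * (N * 2 ^ H) := by ring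
    have hge : N ≤ N * 2 ^ H := Nat.le_mul_of_pos_right _ (by positivity)
    obtain ⟨h1, h2, h3⟩ := breimanLevel_full T [] b hT (by omega)
    obtain ⟨_, h5, _⟩ := breimanLevel_refines hw hf T [] b hT
    have h6 : (breimanLevel T b).val.1.leaves ≤ 2 * N := by
      rw [← DTree.leaves_shape, h2]
      refine (DTree.leaves_refine_le _ _ _).trans ?_
      rw [DTree.leaves_shape]; omega
    obtain ⟨g1, g2, g3⟩ := ih _ (breimanLevel T b).val.2 (2 * N) h1 h6 (by
      rw [mul_assoc]; omega)
    have e : H + 1 + L = (H + L) + 1 := by ring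
    rw [e]
    refine ⟨g1, g2.trans h5.le, ?_⟩
    rw [Function.iterate_succ_apply, ← h2]
    exact g3

lemma fitLeaves_eval {D : List (Sample d)} (T : DTree d (List (Sample d))) (x : Point d) :
    ∀ p, T.Carries D p →
      (fitLeaves T).val.eval x = avgLabel (D.filter fun s => s.1 ∈ pathPts (T.leafPath x p)) := by
  induction T with
  | leaf A => intro p hA; simp only [DTree.Carries] at hA; simp [fitLeaves, DTree.eval, DTree.leafPath, hA]
  | node i l r hl hr =>
    intro p hT
    simp only [DTree.Carries] at hT
    simp only [fitLeaves, Timed.val_bind, Timed.val_op, DTree.eval, DTree.leafPath]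
    split_ifs
    · exact hr _ hT.2
    · exact hl _ hT.1

/-- The local criterion of a cut, weighted by the empirical mass of the cell, is the sum of the criteria of the
two halves; a half without samples contributes `0` on both sides, by the convention for division by `0`. -/
lemma localV_val {D : List (Sample d)} {p : List (Fin d × Bool)} (i : Fin d)
    (hp : (D.filter fun s => s.1 ∈ pathPts p) ≠ []) :
    (((D.filter fun s => s.1 ∈ pathPts p).length : ℝ) / D.length) *
      (localV (D.filter fun s => s.1 ∈ pathPts p) i).val =
      crit (empLabel D) (empMass D) (pathPts ((i, false) :: p)) +
        crit (empLabel D) (empMass D) (pathPts ((i, true) :: p)) := by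
  have hD : (D.length : ℝ) ≠ 0 := by
    intro h
    have : D = [] := List.length_eq_zero_iff.1 (by exact_mod_cast h)
    simp [this] at hp
  have hA : ((D.filter fun s => s.1 ∈ pathPts p).length : ℝ) ≠ 0 := by
    intro h
    exact hp (List.length_eq_zero_iff.1 (by exact_mod_cast h))
  have hadd : ((D.filter fun s => s.1 ∈ pathPts ((i, false) :: p)).length : ℝ) +
      (D.filter fun s => s.1 ∈ pathPts ((i, true) :: p)).length =
      (D.filter fun s => s.1 ∈ pathPts p).length := by
    have h := sum_pathPts_cons (empMass D) i p
    rw [sum_empMass, sum_empMass, sum_empMass, ← add_div] at h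
    exact (div_left_inj' hD).1 h
  simp only [localV, Timed.val_bind, Timed.val_charge, splitOn_val, sumCount_val, crit, sum_empLabel,
    sum_empMass]
  rw [← filter_pathPts_cons, ← filter_pathPts_cons, hadd]
  have key : ∀ s N : ℝ, (((D.filter fun s => s.1 ∈ pathPts p).length : ℝ) / D.length) *
      (N / ((D.filter fun s => s.1 ∈ pathPts p).length : ℝ) * (s / N) ^ 2) =
      (s / D.length) ^ 2 / (N / D.length) := by
    intro s N
    rcases eq_or_ne N 0 with rfl | hN
    · simp
    · field_simp
  rw [mul_add, key, key]

lemma breimanDir_eq_none {D : List (Sample d)} (hd : 0 < d) {p : List (Fin d × Bool)} :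
    breimanDir D p = none ↔ (D.filter fun s => s.1 ∈ pathPts p).length < 2 := by
  have hne : List.finRange d ≠ [] := by
    intro h
    have := congrArg List.length h
    simp at this; omega
  obtain ⟨i, _, hv, _⟩ := scanMax_val (localV (D.filter fun s => s.1 ∈ pathPts p)) hne
  rw [breimanDir, hv]
  split_ifs with h
  · simpa only [Option.map_some, reduceCtorEq, false_iff, not_lt] using h
  · simpa only [true_iff, not_le] using h

/-- The direction of a cut maximizes the empirical criterion of the cell. -/
lemma breimanDir_max {D : List (Sample d)} (hd : 0 < d) {p : List (Fin d × Bool)} {i : Fin d}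
    (hi : breimanDir D p = some i) (j : Fin d) :
    crit (empLabel D) (empMass D) (pathPts ((j, false) :: p)) +
        crit (empLabel D) (empMass D) (pathPts ((j, true) :: p)) ≤
      crit (empLabel D) (empMass D) (pathPts ((i, false) :: p)) +
        crit (empLabel D) (empMass D) (pathPts ((i, true) :: p)) := by
  have hne : List.finRange d ≠ [] := by
    intro h
    have := congrArg List.length h
    simp at this; omega
  obtain ⟨i', _, hv, hmax⟩ := scanMax_val (localV (D.filter fun s => s.1 ∈ pathPts p)) hne
  rw [breimanDir, hv] at hi
  split_ifs at hi with h
  have : i' = i := by simpa using hi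
  subst this
  have hp : (D.filter fun s => s.1 ∈ pathPts p) ≠ [] := by
    intro h0; rw [h0] at h; simp at h
  rw [← localV_val j hp, ← localV_val i' hp]
  exact mul_le_mul_of_nonneg_left (hmax j (List.mem_finRange j)) (by positivity)

end breiman

/-! ### Deterministic guarantees for Level-Splits -/

/-- The deviation of the empirical moments of `D` from those of the population with point masses `w` and
regression function `f`, summed over the leaves of a tree. -/
def sampleDisc {d : ℕ} {α : Type} (D : List (Sample d)) (w f : Point d → ℝ) (T : DTree d α) : ℝ :=
  discrepancy (fun x => empLabel D x - w x * f x) (fun x => empMass D x - w x) T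

section deterministic

variable {d : ℕ} {D : List (Sample d)} {w f : Point d → ℝ}

lemma treeLoss_leaf_le_one (hw : ∀ x, 0 ≤ w x) (hw1 : ∑ x, w x = 1)
    (hf : ∀ x, f x ∈ Set.Icc (0 : ℝ) 1) : treeLoss w f (.leaf () : DTree d Unit) [] ≤ 1 := by
  have := cellLoss_le_mass hw hf ([] : List (Fin d × Bool))
  rwa [pathPts_nil, hw1] at this

/-- A tree that is better by the empirical criterion is better in the population, up to the deviation of
the empirical moments. -/
lemma treeLoss_le_of_treeCrit_le (hD : ∀ s ∈ D, s.2 ∈ Set.Icc (-(1 / 4) : ℝ) (5 / 4))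
    (hw : ∀ x, 0 ≤ w x) (hf : ∀ x, f x ∈ Set.Icc (0 : ℝ) 1) {T T' : DTree d Unit}
    (h : treeCrit (empLabel D) (empMass D) T' [] ≤ treeCrit (empLabel D) (empMass D) T []) :
    treeLoss w f T [] ≤ treeLoss w f T' [] + 3 * sampleDisc D w f T + 3 * sampleDisc D w f T' := by
  have h1 := treeCrit_sub_le (isMoment_emp hD) (isMoment_mul hw hf) T'
  have h2 := treeCrit_sub_le (isMoment_mul hw hf) (isMoment_emp hD) T
  rw [discrepancy_comm] at h2
  rw [treeLoss_eq, treeLoss_eq, sampleDisc, sampleDisc]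
  linarith

/-- Induction along the greedy choices of Level-Splits. -/
lemma greedySplits_induction (hD : ∀ s ∈ D, s.2 ∈ Set.Icc (-(1 / 4) : ℝ) (5 / 4)) (hd : 0 < d)
    {N : ℕ} {P : List (Fin d) → Prop}
    (step : ∀ S i, S.length < N → (∀ j, treeCrit (empLabel D) (empMass D) (fullTree (S ++ [j])) [] ≤
      treeCrit (empLabel D) (empMass D) (fullTree (S ++ [i])) []) → P S → P (S ++ [i])) (H : ℕ) :
    ∀ S, S.length + H ≤ N → P S →
      P (greedySplits D H S).val ∧ (greedySplits D H S).val.length = S.length + H := by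
  induction H with
  | zero => intro S _ hS; exact ⟨hS, rfl⟩
  | succ H ih =>
    intro S hlen hS
    obtain ⟨i, hi, hmax⟩ := greedySplits_step hD hd S H
    have := ih (S ++ [i]) (by simp; omega) (step S i (by omega) hmax hS)
    rw [hi]
    refine ⟨this.1, this.2.trans ?_⟩
    simp; ring

/-- The fitted tree predicts the empirical averages of the complete partition according to the chosen
directions, except in cells that no sample reaches. -/
lemma levelSplits_risk_le (hD : ∀ s ∈ D, s.2 ∈ Set.Icc (-(1 / 4) : ℝ) (5 / 4))
    (hw : ∀ x, 0 ≤ w x) (hf : ∀ x, f x ∈ Set.Icc (0 : ℝ) 1) (H : ℕ) :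
    ∑ x, w x * (f x - (levelSplits D H).val.2.eval x) ^ 2 ≤
      treeLoss w f (fullTree (greedySplits D H []).val) [] +
        6 * sampleDisc D w f (fullTree (greedySplits D H []).val) := by
  refine tree_risk_le (isMoment_emp hD) hw hf (fun x => levelTree_eval_mem hD _ x) _ ?_
  intro x hx
  set S := (greedySplits D H []).val
  rw [pathPts_leafPath_fullTree, pathPts_nil] at hx ⊢
  have hfil : (D.filter fun s => ∀ i ∈ S, s.1 i = x i) =
      D.filter fun s => s.1 ∈ (Finset.univ.filter fun y => ∀ i ∈ S, y i = x i) := by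
    refine List.filter_congr fun s _ => ?_
    simp
  rw [← avgLabel_filter, ← hfil]
  refine levelTree_eval D S x ?_
  intro h0
  rw [sum_empMass, ← hfil, h0] at hx
  simp at hx

/-- Level-Splits when some direction always recovers a fraction `1 / B` of the loss: `a h` bounds the loss
after `h` levels. -/
lemma levelSplits_risk_le_of_gain (hD : ∀ s ∈ D, s.2 ∈ Set.Icc (-(1 / 4) : ℝ) (5 / 4)) (hd : 0 < d)
    (hw : ∀ x, 0 ≤ w x) (hw1 : ∑ x, w x = 1) (hf : ∀ x, f x ∈ Set.Icc (0 : ℝ) 1) {B : ℝ} (hB : 1 ≤ B)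
    (hgain : ∀ S : List (Fin d), ∃ i, treeLoss w f (fullTree S) [] ≤
      B * (fullTree S).leafSum (fun q => cellGain w f q i) []) {H : ℕ} {η a : ℕ → ℝ}
    (hη : ∀ S : List (Fin d), S.length ≤ H → sampleDisc D w f (fullTree S) ≤ η S.length)
    (ha0 : 1 ≤ a 0) (ha : ∀ h < H, (1 - 1 / B) * a h + 6 * η (h + 1) ≤ a (h + 1)) :
    ∑ x, w x * (f x - (levelSplits D H).val.2.eval x) ^ 2 ≤ a H + 6 * η H := by
  obtain ⟨h1, h2⟩ := greedySplits_induction (N := H) hD hd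
    (P := fun S => treeLoss w f (fullTree S) [] ≤ a S.length) (by
      intro S i hS hmax hP
      obtain ⟨j, hj⟩ := hgain S
      have e1 := treeLoss_le_of_treeCrit_le hD hw hf (hmax j)
      have e2 := hη (S ++ [i]) (by simp; omega)
      have e3 := hη (S ++ [j]) (by simp; omega)
      have e4 := treeCrit_fullTree_append_sub (w := w) (f := f) S j []
      have e5 := treeLoss_eq (w := w) (f := f) (fullTree S) []
      have e6 := treeLoss_eq (w := w) (f := f) (fullTree (S ++ [j])) []
      have e7 := ha S.length hS
      simp only [List.length_append, List.length_cons, List.length_nil, zero_add] at e2 e3 ⊢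
      have e8 : 1 / B * treeLoss w f (fullTree S) [] ≤
          (fullTree S).leafSum (fun q => cellGain w f q j) [] := by
        rw [one_div, inv_mul_le_iff₀ (by linarith)]; exact hj
      have e9 : (1 - 1 / B) * treeLoss w f (fullTree S) [] ≤ (1 - 1 / B) * a S.length :=
        mul_le_mul_of_nonneg_left hP (by rw [sub_nonneg, div_le_one (by linarith)]; exact hB)
      linarith) H [] (by simp)
      (by simpa [fullTree] using (treeLoss_leaf_le_one hw hw1 hf).trans ha0)
  have h3 := levelSplits_risk_le hD hw hf H
  have h4 := hη (greedySplits D H []).val (by rw [h2]; simp)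
  rw [h2] at h4 h1
  simp only [List.length_nil, zero_add] at h4 h1
  linarith

/-- Level-Splits when only the directions in `R` gain anything: after `R.card` levels, either all of them
have been chosen, or a direction outside of `R` was preferred, and then little loss was left. -/
lemma levelSplits_risk_le_of_relevant (hD : ∀ s ∈ D, s.2 ∈ Set.Icc (-(1 / 4) : ℝ) (5 / 4))
    (hd : 0 < d) (hw : ∀ x, 0 ≤ w x) (hf : ∀ x, f x ∈ Set.Icc (0 : ℝ) 1) {B : ℝ} (hB : 1 ≤ B)
    (hgain : ∀ S : List (Fin d), ∃ i, treeLoss w f (fullTree S) [] ≤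
      B * (fullTree S).leafSum (fun q => cellGain w f q i) [])
    {R : Finset (Fin d)} (hR : ∀ x y : Point d, (∀ i ∈ R, x i = y i) → f x = f y)
    (hirr : ∀ i ∉ R, ∀ p, cellGain w f p i = 0) {H : ℕ} (hH : R.card ≤ H) {η : ℕ → ℝ} {err : ℝ}
    (hη : ∀ S : List (Fin d), S.length ≤ H → sampleDisc D w f (fullTree S) ≤ η S.length)
    (herr : ∀ h ≤ H, B * (6 * η h) ≤ err) :
    ∑ x, w x * (f x - (levelSplits D H).val.2.eval x) ^ 2 ≤ err + 6 * η H := by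
  have hmono : ∀ S i, treeLoss w f (fullTree (S ++ [i])) [] ≤ treeLoss w f (fullTree S) [] := by
    intro S i
    have e4 := treeCrit_fullTree_append_sub (w := w) (f := f) S i []
    have e5 := treeLoss_eq (w := w) (f := f) (fullTree S) []
    have e6 := treeLoss_eq (w := w) (f := f) (fullTree (S ++ [i])) []
    have e7 := (fullTree S).leafSum_mono (fun q => cellGain_nonneg hw hf q i) []
    rw [DTree.leafSum_const, mul_zero] at e7
    linarith
  -- Either every choice so far used up a new direction of `R`, or the loss is small already.
  obtain ⟨h1, h2⟩ := greedySplits_induction (N := H) hD hd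
    (P := fun S => S.length + (R \ S.toFinset).card ≤ R.card ∨ treeLoss w f (fullTree S) [] ≤ err) (by
      intro S i hS hmax hP
      rcases hP with hP | hP
      · by_cases hi : i ∈ R \ S.toFinset
        · left
          have : R \ (S ++ [i]).toFinset = (R \ S.toFinset).erase i := by
            ext j; simp; tauto
          rw [this, Finset.card_erase_of_mem hi]
          have := Finset.card_pos.2 ⟨i, hi⟩
          simp; omega
        · right
          have hzero : (fullTree S).leafSum (fun q => cellGain w f q i) [] = 0 := by
            by_cases hiR : i ∈ R
            · have hiS : i ∈ S := by simpa [hiR] using hi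
              rw [← treeCrit_fullTree_append_sub,
                treeCrit_fullTree_congr (isMoment_mul hw hf) (S := S ++ [i]) (S' := S), sub_self]
              intro j; simp; rintro rfl; exact hiS
            · simp only [hirr i hiR, DTree.leafSum_const, mul_zero]
          obtain ⟨j, hj⟩ := hgain S
          have e1 := treeLoss_le_of_treeCrit_le hD hw hf (hmax j)
          have e2 := hη (S ++ [i]) (by simp; omega)
          have e3 := hη (S ++ [j]) (by simp; omega)
          have e4 := treeCrit_fullTree_append_sub (w := w) (f := f) S j []
          have e5 := treeLoss_eq (w := w) (f := f) (fullTree S) []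
          have e6 := treeLoss_eq (w := w) (f := f) (fullTree (S ++ [j])) []
          have e7 := treeCrit_fullTree_append_sub (w := w) (f := f) S i []
          have e8 := treeLoss_eq (w := w) (f := f) (fullTree (S ++ [i])) []
          have e9 := herr (S.length + 1) (by omega)
          simp only [List.length_append, List.length_cons, List.length_nil, zero_add] at e2 e3
          refine (hmono S i).trans (hj.trans (le_trans ?_ e9))
          exact mul_le_mul_of_nonneg_left (by linarith) (by linarith)
      · exact Or.inr ((hmono S i).trans hP)) H [] (by simp) (by simp)
  have h3 := levelSplits_risk_le hD hw hf H
  have h4 := hη (greedySplits D H []).val (by rw [h2]; simp)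
  rw [h2] at h4 h1
  simp only [List.length_nil, zero_add] at h4 h1
  have h5 : treeLoss w f (fullTree (greedySplits D H []).val) [] ≤ err := by
    rcases h1 with h1 | h1
    · have h6 : R ⊆ (greedySplits D H []).val.toFinset := by
        rw [← Finset.sdiff_eq_empty_iff_subset, ← Finset.card_eq_zero]; omega
      rw [treeLoss_eq, treeCrit_fullTree_of_relevant hw hf, sub_self]
      · have e := herr 0 (Nat.zero_le _)
        have e0 := hη [] (by simp)
        have e1 : 0 ≤ sampleDisc D w f (fullTree ([] : List (Fin d))) := discrepancy_nonneg _ _ _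
        simp only [List.length_nil] at e0
        have : 0 ≤ B * (6 * η 0) := mul_nonneg (by linarith) (by linarith)
        linarith
      · exact fun x y hxy => hR x y fun i hi => hxy i (List.mem_toFinset.1 (h6 hi))
    · exact h1
  linarith

/-! ### Deterministic guarantees for Breiman's algorithm -/

/-- The tree after a number of complete rounds of Breiman's algorithm. -/
def breimanTree (D : List (Sample d)) (h : ℕ) : DTree d Unit :=
  (fun X : DTree d Unit => X.refine (breimanDir D) [])^[h] (.leaf ())

lemma breimanTree_succ (h : ℕ) :
    breimanTree D (h + 1) = (breimanTree D h).refine (breimanDir D) [] := by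
  rw [breimanTree, Function.iterate_succ_apply']; rfl

lemma leaves_breimanTree_le (h : ℕ) : (breimanTree D h).leaves ≤ 2 ^ h := by
  induction h with
  | zero => simp [breimanTree, DTree.leaves]
  | succ h ih =>
    rw [breimanTree_succ]
    refine (DTree.leaves_refine_le _ _ _).trans ?_
    rw [pow_succ]; omega

/-- The final tree refines the one after `H` complete rounds if the number of leaves allows for these. -/
lemma breiman_risk_le (hD : ∀ s ∈ D, s.2 ∈ Set.Icc (-(1 / 4) : ℝ) (5 / 4))
    (hw : ∀ x, 0 ≤ w x) (hf : ∀ x, f x ∈ Set.Icc (0 : ℝ) 1) {H t : ℕ} (hH : 2 ^ H ≤ t) :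
    ∃ T : DTree d Unit, T.leaves ≤ t ∧
      ∑ x, w x * (f x - (breiman D t).val.eval x) ^ 2 ≤
        treeLoss w f (breimanTree D H) [] + 6 * sampleDisc D w f T := by
  have hHt : H ≤ t := (Nat.lt_two_pow_self).le.trans hH
  have ht : 1 ≤ t := Nat.one_le_two_pow.trans hH
  obtain ⟨h1, h2, h3⟩ := breimanGrow_full (D := D) hw hf H (t - H) (.leaf D) (t - 1) 1
    (by simp [DTree.Carries, pathPts_nil]) (by simp [DTree.leaves]) (by omega)
  rw [Nat.add_sub_cancel' hHt] at h1 h2 h3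
  refine ⟨(breimanGrow t (.leaf D) (t - 1)).val.shape, ?_, ?_⟩
  · rw [DTree.leaves_shape]; simp only [DTree.leaves] at h2; omega
  have heval : ∀ x, (breiman D t).val.eval x = avgLabel (D.filter fun s =>
      s.1 ∈ pathPts ((breimanGrow t (.leaf D) (t - 1)).val.leafPath x [])) :=
    fun x => fitLeaves_eval _ x [] h1
  have h4 := tree_risk_le (g := fun x => (breiman D t).val.eval x) (isMoment_emp hD) hw hf
    (fun x => by rw [heval x]; exact avgLabel_mem fun s hs => hD s (List.mem_filter.1 hs).1)
    (breimanGrow t (.leaf D) (t - 1)).val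
    (fun x _ => by rw [heval x, avgLabel_filter])
  refine h4.trans (add_le_add h3 (le_of_eq ?_))
  rw [sampleDisc, discrepancy, discrepancy, DTree.leafSum_shape]

/-- A round loses little against a round that cuts the same cells in any other directions. -/
lemma breiman_excess_le (hD : ∀ s ∈ D, s.2 ∈ Set.Icc (-(1 / 4) : ℝ) (5 / 4)) (hd : 0 < d)
    (hw : ∀ x, 0 ≤ w x) (hf : ∀ x, f x ∈ Set.Icc (0 : ℝ) 1) (T : DTree d Unit)
    (c : List (Fin d × Bool) → Fin d) :
    T.leafSum (fun q => (breimanDir D q).elim 0 fun i => cellGain w f q (c q) - cellGain w f q i) [] ≤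
      3 * sampleDisc D w f (T.refine (breimanDir D) []) +
        3 * sampleDisc D w f (T.refine (fun q => (breimanDir D q).map fun _ => c q) []) := by
  have h1 : treeCrit (empLabel D) (empMass D)
      (T.refine (fun q => (breimanDir D q).map fun _ => c q) []) [] ≤
      treeCrit (empLabel D) (empMass D) (T.refine (breimanDir D) []) [] := by
    rw [treeCrit, treeCrit, DTree.leafSum_refine, DTree.leafSum_refine]
    refine DTree.leafSum_mono (fun q => ?_) _ _
    cases h : breimanDir D q with
    | none => simp
    | some i => simpa using breimanDir_max hd h (c q)
  have h2 := treeLoss_le_of_treeCrit_le hD hw hf h1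
  rw [treeLoss_eq, treeLoss_eq] at h2
  have h3 := treeCrit_refine_sub (a := fun x => w x * f x) (b := w) T (breimanDir D) []
  have h4 := treeCrit_refine_sub (a := fun x => w x * f x) (b := w) T
    (fun q => (breimanDir D q).map fun _ => c q) []
  have h5 : T.leafSum (fun q => (breimanDir D q).elim 0 fun i =>
      cellGain w f q (c q) - cellGain w f q i) [] =
      T.leafSum (fun q => ((breimanDir D q).map fun _ => c q).elim 0 fun i => cellGain w f q i) [] -
      T.leafSum (fun q => (breimanDir D q).elim 0 fun i => cellGain w f q i) [] := by
    rw [← DTree.leafSum_sub]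
    congr 1; ext q
    cases breimanDir D q <;> simp
  rw [h5]
  simp only [cellGain]
  linarith

/-- The cells that a round leaves uncut have little mass. -/
lemma breiman_uncut_le (hd : 0 < d) (T : DTree d Unit) :
    T.leafSum (fun q => (breimanDir D q).elim (∑ x ∈ pathPts q, w x) fun _ => 0) [] ≤
      T.leaves / D.length + sampleDisc D w f T := by
  rw [sampleDisc, discrepancy, div_eq_mul_one_div, ← T.leafSum_const _ [], ← DTree.leafSum_add]
  refine DTree.leafSum_mono (fun q => ?_) _ _
  cases h : breimanDir D q with
  | some i => simp only [Option.elim]; positivity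
  | none =>
    rw [breimanDir_eq_none hd] at h
    have h1 : ∑ x ∈ pathPts q, empMass D x ≤ 1 / D.length := by
      rw [sum_empMass]
      exact div_le_div_of_nonneg_right (by exact_mod_cast Nat.lt_succ_iff.1 h) (by positivity)
    have h2 := neg_abs_le (∑ x ∈ pathPts q, (empMass D x - w x))
    have h4 := Finset.sum_sub_distrib (s := pathPts q) (empMass D) w
    have h3 := abs_nonneg (∑ x ∈ pathPts q, (empLabel D x - w x * f x))
    simp only [Option.elim]
    linarith

/-- One complete round of Breiman's algorithm, in terms of a direction `c q` of largest gain for each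
cell. A potential `φ` that is at most the loss may follow any course as long as it decreases in the cells
that are cut well. -/
lemma breiman_round (hD : ∀ s ∈ D, s.2 ∈ Set.Icc (-(1 / 4) : ℝ) (5 / 4)) (hd : 0 < d)
    (hw : ∀ x, 0 ≤ w x) (hf : ∀ x, f x ∈ Set.Icc (0 : ℝ) 1) {B : ℝ} (hB : 0 ≤ B)
    {c : List (Fin d × Bool) → Fin d} {η : ℕ → ℝ} (hmono : Monotone η) {h N : ℕ} (hN : 2 ^ (h + 1) ≤ N)
    (hη : ∀ T : DTree d Unit, T.leaves ≤ N → sampleDisc D w f T ≤ η T.leaves)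
    {φ ψ : List (Fin d × Bool) → ℝ}
    (hnone : ∀ q, ψ q ≤ φ q + cellLoss w f q)
    (hsome : ∀ q i, ψ ((i, false) :: q) + ψ ((i, true) :: q) ≤
      φ q + B * (cellGain w f q (c q) - cellGain w f q i)) :
    (breimanTree D (h + 1)).leafSum ψ [] ≤
      (breimanTree D h).leafSum φ [] + (6 * B + 1) * η (2 ^ (h + 1)) + 2 ^ h / D.length := by
  have hT := leaves_breimanTree_le (D := D) h
  set T := breimanTree D h
  have hpow : 2 ^ (h + 1) = 2 * 2 ^ h := by ring
  have hle : ∀ c', sampleDisc D w f (T.refine c' []) ≤ η (2 ^ (h + 1)) := by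
    intro c'
    have h1 := DTree.leaves_refine_le c' T []
    exact (hη _ (by omega)).trans (hmono (by omega))
  have hle' : sampleDisc D w f T ≤ η (2 ^ (h + 1)) := (hη _ (by omega)).trans (hmono (by omega))
  have h1 := breiman_excess_le hD hd hw hf T c
  have h2 := breiman_uncut_le (D := D) (w := w) (f := f) hd T
  have h3 : (T.leaves : ℝ) / D.length ≤ 2 ^ h / D.length :=
    div_le_div_of_nonneg_right (by exact_mod_cast hT) (by positivity)
  have h4 : (breimanTree D (h + 1)).leafSum ψ [] ≤ T.leafSum (fun q => φ q +
      (B * ((breimanDir D q).elim 0 fun i => cellGain w f q (c q) - cellGain w f q i) +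
        (breimanDir D q).elim (∑ x ∈ pathPts q, w x) fun _ => 0)) [] := by
    rw [breimanTree_succ, DTree.leafSum_refine]
    refine DTree.leafSum_mono (fun q => ?_) _ _
    cases breimanDir D q with
    | none =>
      simp only [Option.elim, mul_zero, zero_add]
      exact (hnone q).trans (by linarith [cellLoss_le_mass hw hf q])
    | some i => simpa only [Option.elim, add_zero] using hsome q i
  rw [DTree.leafSum_add, DTree.leafSum_add, DTree.leafSum_mul] at h4
  have h5 := mul_le_mul_of_nonneg_left (h1.trans (add_le_add
    (mul_le_mul_of_nonneg_left (hle _) (by norm_num)) (mul_le_mul_of_nonneg_left (hle _) (by norm_num)))) hB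
  linarith

/-- Breiman's algorithm when some direction always recovers a fraction `1 / B` of the loss of a cell. -/
lemma breiman_risk_le_of_gain (hD : ∀ s ∈ D, s.2 ∈ Set.Icc (-(1 / 4) : ℝ) (5 / 4)) (hd : 0 < d)
    (hw : ∀ x, 0 ≤ w x) (hw1 : ∑ x, w x = 1) (hf : ∀ x, f x ∈ Set.Icc (0 : ℝ) 1) {B : ℝ} (hB : 1 ≤ B)
    (hgain : ∀ p, ∃ i, cellLoss w f p ≤ B * cellGain w f p i) {η a : ℕ → ℝ} (hmono : Monotone η)
    {H t : ℕ} (hH : 2 ^ H ≤ t)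
    (hη : ∀ T : DTree d Unit, T.leaves ≤ t → sampleDisc D w f T ≤ η T.leaves) (ha0 : 1 ≤ a 0)
    (ha : ∀ h < H, (1 - 1 / B) * a h + 7 * η (2 ^ (h + 1)) + 2 ^ h / D.length ≤ a (h + 1)) :
    ∑ x, w x * (f x - (breiman D t).val.eval x) ^ 2 ≤ a H + 6 * η t := by
  choose c hc using hgain
  have hB1 : 1 / B ≤ 1 := by rw [div_le_one (by linarith)]; exact hB
  have hB0 : 0 ≤ 1 / B := by positivity
  have key : ∀ h ≤ H, treeLoss w f (breimanTree D h) [] ≤ a h := by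
    intro h
    induction h with
    | zero => exact fun _ => (treeLoss_leaf_le_one hw hw1 hf).trans ha0
    | succ h ih =>
      intro hh
      have h1 := breiman_round (c := c) hD hd hw hf zero_le_one hmono
        ((Nat.pow_le_pow_right two_pos hh).trans hH) hη
        (φ := fun q => (1 - 1 / B) * cellLoss w f q) (ψ := cellLoss w f)
        (fun q => by
          have := mul_nonneg (sub_nonneg.2 hB1) (cellLoss_nonneg hw hf q)
          linarith)
        (fun q i => by
          rw [cellLoss_cons]
          have : 1 / B * cellLoss w f q ≤ cellGain w f q (c q) := by
            rw [one_div, inv_mul_le_iff₀ (by linarith)]; exact hc q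
          linarith)
      rw [DTree.leafSum_mul] at h1
      have h2 := mul_le_mul_of_nonneg_left (ih (by omega)) (sub_nonneg.2 hB1)
      have h3 := ha h (by omega)
      rw [treeLoss] at h2 ⊢
      linarith
  obtain ⟨T, hT, h1⟩ := breiman_risk_le hD hw hf hH
  have h2 := (hη T hT).trans (hmono hT)
  linarith [key H le_rfl]

/-- Breiman's algorithm when only the directions in `R` gain anything. The potential is the loss of the
cells that are behind schedule: those that, after `h` rounds, are still to be cut in more than `R.card - h`
directions of `R`. -/
lemma breiman_risk_le_of_relevant (hD : ∀ s ∈ D, s.2 ∈ Set.Icc (-(1 / 4) : ℝ) (5 / 4)) (hd : 0 < d)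
    (hw : ∀ x, 0 ≤ w x) (hf : ∀ x, f x ∈ Set.Icc (0 : ℝ) 1) {B : ℝ} (hB : 1 ≤ B)
    (hgain : ∀ p, ∃ i, cellLoss w f p ≤ B * cellGain w f p i)
    {R : Finset (Fin d)} (hR : ∀ x y : Point d, (∀ i ∈ R, x i = y i) → f x = f y)
    (hirr : ∀ i ∉ R, ∀ p, cellGain w f p i = 0) {η : ℕ → ℝ} (hmono : Monotone η) {t : ℕ}
    (hRt : 2 ^ R.card ≤ t) (hη : ∀ T : DTree d Unit, T.leaves ≤ t → sampleDisc D w f T ≤ η T.leaves) :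
    ∑ x, w x * (f x - (breiman D t).val.eval x) ^ 2 ≤
      R.card * ((6 * B + 1) * η (2 ^ R.card) + 2 ^ R.card / D.length) + 6 * η t := by
  choose c hc using hgain
  -- Some direction gains at least as much as any other.
  obtain ⟨c', hc'⟩ : ∃ c' : List (Fin d × Bool) → Fin d, ∀ q i,
      cellGain w f q i ≤ cellGain w f q (c' q) := by
    have : Nonempty (Fin d) := ⟨⟨0, hd⟩⟩
    have : ∀ q, ∃ i', ∀ i, cellGain w f q i ≤ cellGain w f q i' :=
      fun q => Finite.exists_max fun i => cellGain w f q i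
    choose c' hc' using this
    exact ⟨c', hc'⟩
  -- `rem q` counts the directions of `R` that the path `q` does not fix yet.
  let rem : List (Fin d × Bool) → ℕ := fun q => (R \ (q.map Prod.fst).toFinset).card
  let φ : ℕ → List (Fin d × Bool) → ℝ := fun h q => if R.card < h + rem q then cellLoss w f q else 0
  have hφ : ∀ h q, φ h q ≤ cellLoss w f q := by
    intro h q
    simp only [φ]
    split_ifs
    · exact le_rfl
    · exact cellLoss_nonneg hw hf q
  have hφ0 : ∀ h q, 0 ≤ φ h q := by
    intro h q
    simp only [φ]
    split_ifs
    · exact cellLoss_nonneg hw hf q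
    · exact le_rfl
  have key : ∀ h ≤ R.card, (breimanTree D h).leafSum (φ h) [] ≤
      h * ((6 * B + 1) * η (2 ^ R.card) + 2 ^ R.card / D.length) := by
    intro h
    induction h with
    | zero =>
      intro _
      simp [breimanTree, DTree.leafSum, φ, rem]
    | succ h ih =>
      intro hh
      have h1 := breiman_round (c := c') hD hd hw hf (by linarith : 0 ≤ B) hmono
        ((Nat.pow_le_pow_right two_pos hh).trans hRt) hη (φ := φ h) (ψ := φ (h + 1))
        (fun q => by linarith [hφ (h + 1) q, hφ0 h q])
        (fun q i => by
          have hcons := cellLoss_cons (w := w) (f := f) q i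
          have hg0 := cellGain_nonneg hw hf q i
          have hgmax := mul_nonneg (by linarith : 0 ≤ B) (sub_nonneg.2 (hc' q i))
          have e0 := hφ (h + 1) ((i, false) :: q)
          have e1 := hφ (h + 1) ((i, true) :: q)
          -- The cell is behind schedule already, and its loss cannot grow.
          by_cases hb : R.card < h + rem q
          · have : φ h q = cellLoss w f q := if_pos hb
            linarith
          -- The cut uses up a direction of `R`, and the halves stay on schedule.
          by_cases hi : i ∈ R \ (q.map Prod.fst).toFinset
          · have hrem : ∀ z, φ (h + 1) ((i, z) :: q) = 0 := by
              intro z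
              refine if_neg ?_
              have e : R \ (((i, z) :: q).map Prod.fst).toFinset =
                  (R \ (q.map Prod.fst).toFinset).erase i := by
                ext j; simp; tauto
              have hpos := Finset.card_pos.2 ⟨i, hi⟩
              simp only [rem, e, Finset.card_erase_of_mem hi] at hb ⊢
              omega
            rw [hrem, hrem]
            linarith [hφ0 h q]
          -- The halves fall behind; but the cut gains nothing, so that the excess bounds the best gain.
          · have hzero : cellGain w f q i = 0 := by
              by_cases hiR : i ∈ R
              · refine cellGain_eq_zero_of_mem ?_
                by_contra hmem
                exact hi (Finset.mem_sdiff.2 ⟨hiR, fun h => hmem (List.mem_toFinset.1 h)⟩)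
              · exact hirr i hiR q
            have h5 : cellLoss w f q ≤ B * cellGain w f q (c' q) :=
              (hc q).trans (mul_le_mul_of_nonneg_left (hc' q _) (by linarith))
            rw [hzero] at hcons ⊢
            linarith [hφ0 h q])
      have h2 := ih (by omega)
      have h3 : (6 * B + 1) * η (2 ^ (h + 1)) ≤ (6 * B + 1) * η (2 ^ R.card) :=
        mul_le_mul_of_nonneg_left (hmono (Nat.pow_le_pow_right two_pos hh)) (by linarith)
      have h4 : (2 : ℝ) ^ h / D.length ≤ 2 ^ R.card / D.length :=
        div_le_div_of_nonneg_right (pow_le_pow_right₀ (by norm_num) (by omega)) (by positivity)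
      push_cast
      linarith
  obtain ⟨T, hT, h1⟩ := breiman_risk_le hD hw hf hRt
  have h2 := (hη T hT).trans (hmono hT)
  have h3 : treeLoss w f (breimanTree D R.card) [] ≤ (breimanTree D R.card).leafSum (φ R.card) [] := by
    refine DTree.leafSum_mono (fun q => ?_) _ _
    simp only [φ]
    split_ifs with hq
    · exact le_rfl
    · refine (cellLoss_eq_zero fun x hx y hy => hR x y fun i hi => ?_).le
      have hsub : R ⊆ (q.map Prod.fst).toFinset := by
        rw [← Finset.sdiff_eq_empty_iff_subset, ← Finset.card_eq_zero]
        simp only [rem] at hq; omega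
      obtain ⟨⟨j, z⟩, hj, hji⟩ := List.mem_map.1 (List.mem_toFinset.1 (hsub hi))
      simp only at hji
      subst hji
      have ex := mem_pathPts.1 hx _ hj
      have ey := mem_pathPts.1 hy _ hj
      simp only at ex ey
      rw [ex, ey]
  linarith [key R.card le_rfl]

end deterministic

/-! ### Uniform deviation bounds for the two families of trees -/

open Classical in
/-- The tree shapes of bounded depth. -/
def treeShapes (d : ℕ) : ℕ → Finset (DTree d Unit)
  | 0 => {.leaf ()}
  | N + 1 => insert (.leaf ()) ((Finset.univ ×ˢ treeShapes d N ×ˢ treeShapes d N).image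
      fun q => .node q.1 q.2.1 q.2.2)

lemma mem_treeShapes {d : ℕ} (T : DTree d Unit) : ∀ N, T.leaves ≤ N + 1 → T ∈ treeShapes d N := by
  induction T with
  | leaf a => intro N _; cases N <;> simp [treeShapes]
  | node i l r hl hr =>
    intro N hN
    simp only [DTree.leaves] at hN
    have h1 := l.one_le_leaves
    have h2 := r.one_le_leaves
    cases N with
    | zero => omega
    | succ N =>
      simp only [treeShapes, Finset.mem_insert, Finset.mem_image, Finset.mem_product]
      exact Or.inr ⟨(i, l, r), ⟨Finset.mem_univ _, hl N (by omega), hr N (by omega)⟩, rfl⟩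

/-- With weight `(4 d)⁻¹` per leaf, the total weight `Z` of the trees satisfies `Z ≤ 1 / (4 d) + d Z²` in
the passage to the next depth, so it stays below `1 / (2 d)`. -/
lemma sum_treeShapes_le {d : ℕ} (hd : 0 < d) (N : ℕ) :
    ∑ T ∈ treeShapes d N, (1 / (4 * d) : ℝ) ^ T.leaves ≤ 1 / (2 * d) := by
  classical
  have hd' : (0 : ℝ) < d := by exact_mod_cast hd
  induction N with
  | zero =>
    simp only [treeShapes, Finset.sum_singleton, DTree.leaves, pow_one]
    exact one_div_le_one_div_of_le (by positivity) (by linarith)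
  | succ N ih =>
    set Z := ∑ T ∈ treeShapes d N, (1 / (4 * d) : ℝ) ^ T.leaves
    have hZ : 0 ≤ Z := Finset.sum_nonneg fun T _ => by positivity
    have h1 : ∑ T ∈ (Finset.univ ×ˢ treeShapes d N ×ˢ treeShapes d N).image
        (fun q => DTree.node q.1 q.2.1 q.2.2), (1 / (4 * d) : ℝ) ^ T.leaves ≤ d * Z ^ 2 := by
      refine (Finset.sum_image_le_of_nonneg fun T _ => by positivity).trans (le_of_eq ?_)
      rw [Finset.sum_product]
      simp only [Finset.sum_product, DTree.leaves, pow_add, Finset.sum_const, Finset.card_univ,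
        Fintype.card_fin, nsmul_eq_mul]
      rw [pow_two, Finset.sum_mul_sum]
    have h2 : ∑ T ∈ treeShapes d (N + 1), (1 / (4 * d) : ℝ) ^ T.leaves ≤ 1 / (4 * d) + d * Z ^ 2 := by
      rw [treeShapes]
      rw [Finset.sum_insert (by simp)]
      simp only [DTree.leaves, pow_one]
      linarith
    have h3 : d * Z ^ 2 ≤ d * (1 / (2 * d)) ^ 2 := by gcongr
    have h4 : (1 : ℝ) / (4 * d) + d * (1 / (2 * d)) ^ 2 = 1 / (2 * d) := by field_simp; ring
    linarith

/-- The deviation that `2 ^ h` cells of a level partition may have, up to a constant; `L` and `L'` stand for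
`log (d / δ)` and `log (d k / δ)`. -/
def levelDev (n : ℕ) (L L' : ℝ) (h : ℕ) : ℝ := 6 * (√(2 ^ h / n) + √(h * L / n) + √(L' / n))

/-- The deviation that the `t` cells of an arbitrary tree may have, up to a constant. -/
def leafDev (n : ℕ) (L L' : ℝ) (t : ℕ) : ℝ := 8 * (√(t * L / n) + √(L' / n))

lemma leafDev_mono {n : ℕ} {L L' : ℝ} (hL : 0 ≤ L) : Monotone (leafDev n L L') := by
  intro s t hst
  have : (s : ℝ) ≤ t := by exact_mod_cast hst
  unfold leafDev
  gcongr

lemma sqrt_add_le (x y : ℝ) (hx : 0 ≤ x) (hy : 0 ≤ y) : √(x + y) ≤ √x + √y := by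
  rw [Real.sqrt_le_left (by positivity)]
  nlinarith [Real.sq_sqrt hx, Real.sq_sqrt hy, mul_nonneg (Real.sqrt_nonneg x) (Real.sqrt_nonneg y)]

lemma log_le_mul_logb {c x : ℝ} (hc : 7 / 10 ≤ c) (hx : 1 ≤ x) : Real.log x ≤ c * Real.logb 2 x := by
  have h1 : Real.log x = Real.log 2 * Real.logb 2 x := by
    rw [Real.logb]; field_simp
  rw [h1]
  exact mul_le_mul_of_nonneg_right (by linarith [Real.log_two_lt_d9])
    (Real.logb_nonneg (by norm_num) hx)

section

variable {d k n : ℕ} {δ : ℝ}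

lemma one_le_logb_div (hδ : 0 < δ) (hd : 2 * δ ≤ d) : 1 ≤ Real.logb 2 (d / δ) := by
  have h : (2 : ℝ) ≤ d / δ := by rwa [le_div_iff₀ hδ]
  rw [Real.le_logb_iff_rpow_le (by norm_num) (by linarith), Real.rpow_one]
  exact h

lemma logb_div_le_logb_mul_div (hδ : 0 < δ) (hd : 2 * δ ≤ d) (hk : 1 ≤ k) :
    Real.logb 2 (d / δ) ≤ Real.logb 2 (d * k / δ) := by
  have h : (2 : ℝ) ≤ d / δ := by rwa [le_div_iff₀ hδ]
  have hk' : (1 : ℝ) ≤ k := by exact_mod_cast hk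
  refine Real.logb_le_logb_of_le (by norm_num) (by linarith) ?_
  rw [mul_div_right_comm]
  nlinarith

/-- The threshold of the union bound for lists of `h` directions, of weight `(2 d) ^ (-h) / 2` each. -/
lemma level_threshold_le (hδ : 0 < δ) (hδ1 : δ ≤ 1) (hd : 2 * δ ≤ d) (hk : 1 ≤ k) (h : ℕ) :
    √(81 / 8 * Real.log (2 / (δ / k * (1 / (2 * d) ^ h / 2 / 4 ^ 2 ^ h))) / n) ≤
      levelDev n (Real.logb 2 (d / δ)) (Real.logb 2 (d * k / δ)) h := by
  have hk' : (1 : ℝ) ≤ k := by exact_mod_cast hk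
  have hd0 : (0 : ℝ) < d := by linarith
  have hd1 : (1 : ℝ) ≤ d := by exact_mod_cast Nat.one_le_iff_ne_zero.2 (by rintro rfl; simp at hd0)
  have hy : (2 : ℝ) ≤ d / δ := by rwa [le_div_iff₀ hδ]
  have hyd : (d : ℝ) ≤ d / δ := by rw [le_div_iff₀ hδ]; nlinarith
  have hL := one_le_logb_div hδ hd
  have hL' := hL.trans (logb_div_le_logb_mul_div hδ hd hk)
  have e1 : 2 / (δ / k * (1 / (2 * d) ^ h / 2 / 4 ^ 2 ^ h)) =
      (4 * k / δ) * (2 * d : ℝ) ^ h * 4 ^ 2 ^ h := by field_simp; ring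
  have e2 : Real.log (4 * k / δ) ≤ 21 / 10 * Real.logb 2 (d * k / δ) := by
    have h1 : Real.log (4 * k / δ) ≤ Real.log ((d * k / δ) ^ 3) := by
      refine Real.log_le_log (by positivity) ?_
      have h2 : (k / δ : ℝ) ≤ d * k / δ := by
        rw [mul_div_assoc]; exact le_mul_of_one_le_left (by positivity) hd1
      have h3 : (2 : ℝ) ≤ d * k / δ := by rw [mul_div_right_comm]; nlinarith
      have h4 : (4 : ℝ) ≤ (d * k / δ) ^ 2 := by nlinarith
      calc (4 * k / δ : ℝ) = 4 * (k / δ) := by ring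
        _ ≤ (d * k / δ) ^ 2 * (d * k / δ) := by gcongr
        _ = _ := by ring
    rw [Real.log_pow] at h1
    have h3 : (1 : ℝ) ≤ d * k / δ := by rw [mul_div_right_comm]; nlinarith
    have h4 := log_le_mul_logb (c := 7 / 10) le_rfl h3
    push_cast at h1
    linarith
  have e3 : Real.log (2 * d) ≤ 14 / 10 * Real.logb 2 (d / δ) := by
    have h1 : Real.log (2 * d) ≤ Real.log ((d / δ) ^ 2) := by
      refine Real.log_le_log (by positivity) ?_
      rw [pow_two]; gcongr
    rw [Real.log_pow] at h1
    have h4 := log_le_mul_logb (c := 7 / 10) le_rfl (by linarith : (1:ℝ) ≤ d / δ)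
    push_cast at h1
    linarith
  have e4 : Real.log 4 ≤ 14 / 10 := by
    rw [show (4 : ℝ) = 2 ^ 2 by norm_num, Real.log_pow]
    push_cast
    linarith [Real.log_two_lt_d9]
  have e5 : Real.log (2 / (δ / k * (1 / (2 * d) ^ h / 2 / 4 ^ 2 ^ h))) ≤
      21 / 10 * Real.logb 2 (d * k / δ) + h * (14 / 10 * Real.logb 2 (d / δ)) + 2 ^ h * (14 / 10) := by
    rw [e1, Real.log_mul (by positivity) (by positivity), Real.log_mul (by positivity) (by positivity),
      Real.log_pow, Real.log_pow]
    push_cast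
    gcongr
  have hA : (0 : ℝ) ≤ 2 ^ h / n := by positivity
  have hB : (0 : ℝ) ≤ h * Real.logb 2 (d / δ) / n := by positivity
  have hC : (0 : ℝ) ≤ Real.logb 2 (d * k / δ) / n := by positivity
  have e6 : 81 / 8 * Real.log (2 / (δ / k * (1 / (2 * d) ^ h / 2 / 4 ^ 2 ^ h))) / n ≤
      6 ^ 2 * (2 ^ h / n + h * Real.logb 2 (d / δ) / n + Real.logb 2 (d * k / δ) / n) := by
    rw [← add_div, ← add_div, ← mul_div_assoc (6 ^ 2 : ℝ)]
    refine div_le_div_of_nonneg_right ?_ (by positivity)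
    have : (0 : ℝ) ≤ h * Real.logb 2 (d / δ) := by positivity
    have : (0 : ℝ) ≤ 2 ^ h := by positivity
    linarith
  refine (Real.sqrt_le_sqrt e6).trans ?_
  rw [Real.sqrt_mul (by norm_num), Real.sqrt_sq (by norm_num), levelDev]
  refine mul_le_mul_of_nonneg_left ?_ (by norm_num)
  exact (sqrt_add_le _ _ (by positivity) hC).trans (by gcongr; exact sqrt_add_le _ _ hA hB)

/-- The threshold of the union bound for trees with `t` leaves, of weight `(4 d) ^ (-t)` each. -/
lemma leaf_threshold_le (hδ : 0 < δ) (hδ1 : δ ≤ 1) (hd : 2 * δ ≤ d) (hk : 1 ≤ k) (t : ℕ) :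
    √(81 / 8 * Real.log (2 / (δ / k * ((1 / (4 * d)) ^ t / 4 ^ t))) / n) ≤
      leafDev n (Real.logb 2 (d / δ)) (Real.logb 2 (d * k / δ)) t := by
  have hk' : (1 : ℝ) ≤ k := by exact_mod_cast hk
  have hd0 : (0 : ℝ) < d := by linarith
  have hd1 : (1 : ℝ) ≤ d := by exact_mod_cast Nat.one_le_iff_ne_zero.2 (by rintro rfl; simp at hd0)
  have hy : (2 : ℝ) ≤ d / δ := by rwa [le_div_iff₀ hδ]
  have hyd : (d : ℝ) ≤ d / δ := by rw [le_div_iff₀ hδ]; nlinarith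
  have hL := one_le_logb_div hδ hd
  have hL' := hL.trans (logb_div_le_logb_mul_div hδ hd hk)
  have e1 : 2 / (δ / k * ((1 / (4 * d)) ^ t / 4 ^ t)) = (2 * k / δ) * (16 * d : ℝ) ^ t := by
    rw [show (16 * d : ℝ) = (4 * d) * 4 by ring, mul_pow, one_div, inv_pow]
    field_simp
  have e2 : Real.log (2 * k / δ) ≤ 14 / 10 * Real.logb 2 (d * k / δ) := by
    have h1 : Real.log (2 * k / δ) ≤ Real.log ((d * k / δ) ^ 2) := by
      refine Real.log_le_log (by positivity) ?_
      have h2 : (k / δ : ℝ) ≤ d * k / δ := by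
        rw [mul_div_assoc]; exact le_mul_of_one_le_left (by positivity) hd1
      have h3 : (2 : ℝ) ≤ d * k / δ := by rw [mul_div_right_comm]; nlinarith
      calc (2 * k / δ : ℝ) = 2 * (k / δ) := by ring
        _ ≤ (d * k / δ) * (d * k / δ) := by gcongr
        _ = _ := by ring
    rw [Real.log_pow] at h1
    have h3 : (1 : ℝ) ≤ d * k / δ := by rw [mul_div_right_comm]; nlinarith
    have h4 := log_le_mul_logb (c := 7 / 10) le_rfl h3
    push_cast at h1
    linarith
  have e3 : Real.log (16 * d) ≤ 35 / 10 * Real.logb 2 (d / δ) := by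
    have h1 : Real.log (16 * d) ≤ Real.log ((d / δ) ^ 5) := by
      refine Real.log_le_log (by positivity) ?_
      have h4 : (16 : ℝ) ≤ (d / δ) ^ 4 := by
        calc (16 : ℝ) = 2 ^ 4 := by norm_num
          _ ≤ _ := by gcongr
      calc (16 * d : ℝ) ≤ (d / δ) ^ 4 * (d / δ) := by gcongr
        _ = _ := by ring
    rw [Real.log_pow] at h1
    have h4 := log_le_mul_logb (c := 7 / 10) le_rfl (by linarith : (1:ℝ) ≤ d / δ)
    push_cast at h1
    linarith
  have e5 : Real.log (2 / (δ / k * ((1 / (4 * d)) ^ t / 4 ^ t))) ≤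
      14 / 10 * Real.logb 2 (d * k / δ) + t * (35 / 10 * Real.logb 2 (d / δ)) := by
    rw [e1, Real.log_mul (by positivity) (by positivity), Real.log_pow]
    gcongr
  have hB : (0 : ℝ) ≤ t * Real.logb 2 (d / δ) / n := by positivity
  have hC : (0 : ℝ) ≤ Real.logb 2 (d * k / δ) / n := by positivity
  have e6 : 81 / 8 * Real.log (2 / (δ / k * ((1 / (4 * d)) ^ t / 4 ^ t))) / n ≤
      8 ^ 2 * (t * Real.logb 2 (d / δ) / n + Real.logb 2 (d * k / δ) / n) := by
    rw [← add_div, ← mul_div_assoc (8 ^ 2 : ℝ)]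
    refine div_le_div_of_nonneg_right ?_ (by positivity)
    have : (0 : ℝ) ≤ t * Real.logb 2 (d / δ) := by positivity
    linarith
  refine (Real.sqrt_le_sqrt e6).trans ?_
  rw [Real.sqrt_mul (by norm_num), Real.sqrt_sq (by norm_num), leafDev]
  exact mul_le_mul_of_nonneg_left (sqrt_add_le _ _ hB hC) (by norm_num)

end

section events

variable {d k n : ℕ} {m : Point d → Fin k → ℝ} {Dx : Measure (Point d)} {E : Measure (Fin k → ℝ)}
  [IsProbabilityMeasure Dx] [IsProbabilityMeasure E] {δ : ℝ}

/-- Level partitions of every depth have a small discrepancy simultaneously. -/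
lemma measure_levelDev_lt_le (hm : ∀ x i, m x i ∈ Set.Icc (0 : ℝ) 1)
    (hE : IsBoundedCenteredNoise E) (hn : 0 < n) (i : Fin k) (hδ : 0 < δ) (hδ1 : δ ≤ 1)
    (hd : 2 * δ ≤ d) (N : ℕ) :
    sampleLaw m Dx E n {ω | ∃ S : List (Fin d), S.length ≤ N ∧
      levelDev n (Real.logb 2 (d / δ)) (Real.logb 2 (d * k / δ)) S.length <
        sampleDisc (coordData ω i).val (pointMass Dx) (fun x => m x i) (fullTree S)} ≤
      ENNReal.ofReal (δ / k) := by
  have hk : 1 ≤ k := Nat.one_le_of_lt i.2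
  have hk' : (1 : ℝ) ≤ k := by exact_mod_cast hk
  have hd0 : (0 : ℝ) < d := by linarith
  have hsum : ∑ j ∈ (Finset.univ : Finset (Σ h : Fin (N + 1), (Fin h → Fin d))),
      (1 / (2 * d : ℝ) ^ (j.1 : ℕ) / 2) ≤ 1 := by
    rw [← Finset.univ_sigma_univ, Finset.sum_sigma]
    have h1 : ∀ h : Fin (N + 1), ∑ _j : (Fin h → Fin d), (1 / (2 * d : ℝ) ^ (h : ℕ) / 2) =
        (1 / 2) ^ (h : ℕ) / 2 := by
      intro h
      simp only [Finset.sum_const, Finset.card_univ, Fintype.card_fun, Fintype.card_fin, nsmul_eq_mul]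
      push_cast
      rw [mul_pow, one_div, one_div, inv_pow]; field_simp
    simp only [h1]
    rw [Fin.sum_univ_eq_sum_range (fun h => (1 / 2 : ℝ) ^ h / 2), ← Finset.sum_div]
    have h2 : ∑ h ∈ Finset.range (N + 1), (1 / 2 : ℝ) ^ h ≤ 2 := by
      rw [geom_sum_eq (by norm_num)]
      have : (0 : ℝ) ≤ (1 / 2) ^ (N + 1) := by positivity
      rw [div_le_iff_of_neg (by norm_num)]
      linarith
    linarith
  have key := measure_discrepancy_gt_le (m := m) (Dx := Dx) hm hE hn i
    (Finset.univ : Finset (Σ h : Fin (N + 1), (Fin h → Fin d)))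
    (fun j => fullTree (List.ofFn j.2)) (wt := fun j => 1 / (2 * d : ℝ) ^ (j.1 : ℕ) / 2)
    (fun j _ => by positivity) hsum (η := δ / k) (by positivity)
    (by rw [div_le_one (by linarith)]; linarith)
  refine le_trans (measure_mono ?_) key
  rintro ω ⟨S, hS, hlt⟩
  refine ⟨⟨⟨S.length, by omega⟩, S.get⟩, Finset.mem_univ _, ?_⟩
  simp only [leaves_fullTree, List.ofFn_get]
  exact (level_threshold_le hδ hδ1 hd hk S.length).trans_lt hlt

/-- Trees with every number of leaves have a small discrepancy simultaneously. -/
lemma measure_leafDev_lt_le (hm : ∀ x i, m x i ∈ Set.Icc (0 : ℝ) 1)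
    (hE : IsBoundedCenteredNoise E) (hn : 0 < n) (i : Fin k) (hδ : 0 < δ) (hδ1 : δ ≤ 1)
    (hd : 2 * δ ≤ d) (N : ℕ) :
    sampleLaw m Dx E n {ω | ∃ T : DTree d Unit, T.leaves ≤ N ∧
      leafDev n (Real.logb 2 (d / δ)) (Real.logb 2 (d * k / δ)) T.leaves <
        sampleDisc (coordData ω i).val (pointMass Dx) (fun x => m x i) T} ≤
      ENNReal.ofReal (δ / k) := by
  have hk : 1 ≤ k := Nat.one_le_of_lt i.2
  have hk' : (1 : ℝ) ≤ k := by exact_mod_cast hk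
  have hd0 : (0 : ℝ) < d := by linarith
  have hd1 : (1 : ℝ) ≤ d := by exact_mod_cast Nat.one_le_iff_ne_zero.2 (by rintro rfl; simp at hd0)
  have hsum := (sum_treeShapes_le (d := d) (by exact_mod_cast hd0) N).trans
    (by rw [div_le_one (by positivity)]; linarith)
  have key := measure_discrepancy_gt_le (m := m) (Dx := Dx) hm hE hn i (treeShapes d N)
    (fun T => T) (wt := fun T => (1 / (4 * d) : ℝ) ^ T.leaves)
    (fun j _ => by positivity) hsum (η := δ / k) (by positivity)
    (by rw [div_le_one (by linarith)]; linarith)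
  refine le_trans (measure_mono ?_) key
  rintro ω ⟨T, hT, hlt⟩
  exact ⟨T, mem_treeShapes T N (by omega), (leaf_threshold_le hδ hδ1 hd hk _).trans_lt hlt⟩

/-- Reduction to one coordinate of the label, and to labels in `[-1/4, 5/4]`: it is enough that the risk of
each coordinate is small outside of an event of probability `δ / k`. -/
lemma measure_risk_gt_le (hm : ∀ x i, m x i ∈ Set.Icc (0 : ℝ) 1) (hE : IsBoundedCenteredNoise E)
    (hk : 1 ≤ k) (hδ : 0 < δ) {ε : ℝ} {g : ScoreData d k n → Point d → Fin k → ℝ}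
    {Bad : Fin k → Set (ScoreData d k n)}
    (hBad : ∀ i, sampleLaw m Dx E n (Bad i) ≤ ENNReal.ofReal (δ / k))
    (hgood : ∀ i, ∀ ω ∉ Bad i,
      (∀ s ∈ (coordData ω i).val, s.2 ∈ Set.Icc (-(1 / 4) : ℝ) (5 / 4)) →
      ∑ x, pointMass Dx x * (m x i - g ω x i) ^ 2 ≤ ε / k) :
    sampleLaw m Dx E n {ω | ε < risk m Dx (g ω)} ≤ ENNReal.ofReal δ := by
  have hk' : (0 : ℝ) < k := by exact_mod_cast hk
  have hae : ∀ᵐ ω ∂sampleLaw m Dx E n, ∀ j i, (ω j).2 i ∈ Set.Icc (-(1 / 4) : ℝ) (5 / 4) := by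
    rw [ae_all_iff]
    intro j
    exact (measurePreserving_eval (fun _ : Fin n => scoreLaw m Dx E) j).quasiMeasurePreserving.ae
      (ae_scoreLaw_label hm hE)
  have hsub : {ω | ε < risk m Dx (g ω)} ≤ᵐ[sampleLaw m Dx E n] ⋃ i, Bad i := by
    filter_upwards [hae] with ω hω hlt
    by_contra hnot
    have hnot' : ω ∉ ⋃ i, Bad i := hnot
    simp only [Set.mem_iUnion, not_exists] at hnot'
    have hle : risk m Dx (g ω) ≤ ε := by
      rw [risk, integral_fintype Integrable.of_finite]
      simp only [smul_eq_mul, Finset.mul_sum]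
      rw [Finset.sum_comm]
      refine (Finset.sum_le_sum fun i _ => hgood i ω (hnot' i) ?_).trans (le_of_eq ?_)
      · intro s hs
        simp only [coordData, Timed.val_charge, List.mem_ofFn] at hs
        obtain ⟨j, rfl⟩ := hs
        exact hω j i
      · simp only [Finset.sum_const, Finset.card_univ, Fintype.card_fin, nsmul_eq_mul]
        field_simp
    exact absurd hlt (not_lt.2 hle)
  refine (measure_mono_ae hsub).trans ((measure_iUnion_le _).trans ?_)
  rw [tsum_fintype]
  refine (Finset.sum_le_sum fun i _ => hBad i).trans ?_
  rw [Finset.sum_const, Finset.card_univ, Fintype.card_fin, ← ENNReal.ofReal_nsmul, nsmul_eq_mul]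
  refine ENNReal.ofReal_le_ofReal (le_of_eq ?_)
  field_simp

end events

/-! ### Sample sizes -/

section numbers

variable {B κ K : ℝ} {M : ℕ}

/-- The constant `M ^ (M + 3)` in front of a sample size replaces the factor `B` in the base of the power by
any absolute constant `M`: either `B` is at least `M`, or the exponent is bounded. -/
lemma mul_rpow_le_const_mul (hM : 1 ≤ M) (hK : (M : ℝ) ^ (M + 3) ≤ K) (hB : 1 ≤ B) (hκ : 0 < κ) {e : ℝ}
    (he0 : 0 ≤ e) (he : e ≤ 3) : (M * κ) ^ (B + e) ≤ K * (B * κ) ^ (B + e) := by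
  have hM' : (1 : ℝ) ≤ M := by exact_mod_cast hM
  have hK1 : 1 ≤ K := (one_le_pow₀ hM').trans hK
  rw [Real.mul_rpow (by linarith) hκ.le, Real.mul_rpow (by linarith) hκ.le, ← mul_assoc]
  refine mul_le_mul_of_nonneg_right ?_ (by positivity)
  rcases le_total (M : ℝ) B with h | h
  · calc (M : ℝ) ^ (B + e) ≤ B ^ (B + e) := Real.rpow_le_rpow (by linarith) h (by linarith)
      _ ≤ K * B ^ (B + e) := le_mul_of_one_le_left (by positivity) hK1
  · calc (M : ℝ) ^ (B + e) ≤ (M : ℝ) ^ ((M + 3 : ℕ) : ℝ) :=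
          Real.rpow_le_rpow_of_exponent_le hM' (by push_cast; linarith)
      _ = (M : ℝ) ^ (M + 3) := Real.rpow_natCast _ _
      _ ≤ K := hK
      _ ≤ K * B ^ (B + e) := le_mul_of_one_le_right (by linarith)
          (Real.one_le_rpow hB (by linarith))

variable {x u e : ℝ}

lemma mul_log_le_log (hx : 16 ≤ x) (hu : x ^ (B + e) ≤ u) : (B + e) * Real.log x ≤ Real.log u := by
  rw [← Real.log_rpow (by linarith)]
  exact Real.log_le_log (by positivity) hu

lemma two_le_log_of_sixteen_le (hx : 16 ≤ x) : 2 ≤ Real.log x := by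
  have h1 : Real.log 16 ≤ Real.log x := Real.log_le_log (by norm_num) hx
  rw [show (16 : ℝ) = 2 ^ 4 by norm_num, Real.log_pow] at h1
  push_cast at h1
  linarith [Real.log_two_gt_d9]

/-- Polynomials in `B ≤ log u` and `log u` are absorbed by `u`. -/
lemma sq_mul_div_le (hB : 1 ≤ B) (he : 2 ≤ e) (hx : 16 ≤ x) (hu : x ^ (B + e) ≤ u) {H : ℝ}
    (hH0 : 0 ≤ H) (hH : H ≤ 3 * Real.log u) : B ^ 2 * H / u ≤ (23 / x) ^ 2 := by
  have hx0 : 0 < x := by linarith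
  have hu0 : 0 < u := lt_of_lt_of_le (by positivity) hu
  have h1 := mul_log_le_log hx hu
  have h2 := two_le_log_of_sixteen_le hx
  set y := Real.log u
  have hBy : B ≤ y := by nlinarith
  have hy0 : 0 ≤ y := by linarith
  have h3 : 3 * Real.log x ≤ y := by nlinarith
  have h4 : y ^ 3 ≤ 162 * Real.exp (y / 3) := by
    have := Real.pow_div_factorial_le_exp (y / 3) (by positivity) 3
    simp only [Nat.factorial] at this
    push_cast at this
    nlinarith
  have h5 : Real.exp y = u := Real.exp_log hu0
  have h6 : B ^ 2 * H ≤ 3 * y ^ 3 := by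
    have : B ^ 2 ≤ y ^ 2 := by gcongr
    calc B ^ 2 * H ≤ y ^ 2 * (3 * y) := by gcongr
      _ = _ := by ring
  have h7 : x ^ 2 * Real.exp (y / 3) ≤ u := by
    have h8 : x ^ 2 ≤ Real.exp (y / 3 + y / 3) := by
      rw [Real.exp_add, pow_two]
      have : x ≤ Real.exp (y / 3) := by
        rw [← Real.log_le_iff_le_exp hx0]; linarith
      gcongr
    rw [← h5]
    calc x ^ 2 * Real.exp (y / 3) ≤ Real.exp (y / 3 + y / 3) * Real.exp (y / 3) := by gcongr
      _ = Real.exp y := by rw [← Real.exp_add]; congr 1; ring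
  rw [div_pow, div_le_div_iff₀ hu0 (by positivity)]
  calc B ^ 2 * H * x ^ 2 ≤ 3 * (162 * Real.exp (y / 3)) * x ^ 2 :=
        mul_le_mul_of_nonneg_right (by linarith) (by positivity)
    _ = 486 * (x ^ 2 * Real.exp (y / 3)) := by ring
    _ ≤ 486 * u := by gcongr
    _ ≤ 23 ^ 2 * u := by nlinarith

/-- The facts about the depth `q = B / (B + e) * log u` that the choice of the sample size ensures. -/
lemma depth_facts (hB : 1 ≤ B) (he : 2 ≤ e) (hx : 16 ≤ x) (hu : x ^ (B + e) ≤ u) {q : ℝ}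
    (hq : q = B / (B + e) * Real.logb 2 u) :
    0 ≤ q ∧ Real.exp (-(q / B)) ≤ 1 / x ∧ (2 : ℝ) ^ q / u ≤ (1 / x) ^ 2 ∧
      q + 2 ≤ 3 * Real.log u ∧ (2 : ℝ) ^ q ≤ u := by
  have hx0 : 0 < x := by linarith
  have hu0 : 0 < u := lt_of_lt_of_le (by positivity) hu
  have h1 := mul_log_le_log hx hu
  have h2 := two_le_log_of_sixteen_le hx
  have hBe : 0 < B + e := by linarith
  have hy : 2 ≤ Real.log u := by nlinarith
  have hlog2 : 0 < Real.log 2 := Real.log_pos (by norm_num)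
  have hlogb : Real.logb 2 u = Real.log u / Real.log 2 := rfl
  have h3 : Real.log u ≤ Real.logb 2 u := by
    rw [hlogb, le_div_iff₀ hlog2]; nlinarith [Real.log_two_lt_d9]
  have h4 : Real.logb 2 u ≤ 2 * Real.log u := by
    rw [hlogb, div_le_iff₀ hlog2]; nlinarith [Real.log_two_gt_d9]
  have hq0 : 0 ≤ q := by rw [hq]; have : 0 ≤ Real.logb 2 u := by linarith
                         positivity
  have hfrac : B / (B + e) ≤ 1 := by rw [div_le_one hBe]; linarith
  have h5 : (2 : ℝ) ^ q = Real.exp (B / (B + e) * Real.log u) := by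
    rw [Real.rpow_def_of_pos (by norm_num), hq, hlogb]
    congr 1; field_simp
  have h6 : Real.exp (Real.log u) = u := Real.exp_log hu0
  refine ⟨hq0, ?_, ?_, ?_, ?_⟩
  · rw [Real.exp_neg, one_div]
    refine inv_anti₀ hx0 ?_
    rw [← Real.log_le_iff_le_exp hx0, hq, le_div_iff₀ (by linarith), div_mul_eq_mul_div,
      le_div_iff₀ hBe]
    nlinarith
  · rw [h5]
    have h7 : x ^ 2 * Real.exp (B / (B + e) * Real.log u) ≤ u := by
      have h8 : x ^ 2 = Real.exp (2 * Real.log x) := by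
        rw [mul_comm, Real.exp_mul, Real.exp_log hx0]; norm_cast
      rw [h8, ← Real.exp_add]
      conv_rhs => rw [← h6]
      refine Real.exp_le_exp.2 ?_
      have h9 : 2 * Real.log x ≤ e / (B + e) * Real.log u := by
        rw [div_mul_eq_mul_div, le_div_iff₀ hBe]; nlinarith
      have h10 : B / (B + e) * Real.log u + e / (B + e) * Real.log u = Real.log u := by
        field_simp
      linarith
    rw [div_pow, one_pow, div_le_div_iff₀ hu0 (by positivity)]
    linarith
  · have : q ≤ Real.logb 2 u := by
      rw [hq]; exact mul_le_of_le_one_left (by linarith) hfrac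
    linarith
  · rw [h5]
    conv_rhs => rw [← h6]
    exact Real.exp_le_exp.2 (mul_le_of_le_one_left (by linarith) hfrac)

/-- A recursion that loses a fraction `1 / B` and gains a geometric and a constant term: the geometric terms
add up to a multiple of the last one, the constant terms to at most `B` of them. -/
lemma loss_recursion (hB : 1 ≤ B) {α β : ℝ} (hα : 0 ≤ α) (h : ℕ) :
    (1 - 1 / B) * (Real.exp (-(h / B)) + 4 * α * √2 ^ h + B * β) + (α * √2 ^ (h + 1) + β) ≤
      Real.exp (-(((h + 1 : ℕ) : ℝ) / B)) + 4 * α * √2 ^ (h + 1) + B * β := by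
  have hB0 : 0 < B := by linarith
  have h1 : (1 - 1 / B) * Real.exp (-(h / B)) ≤ Real.exp (-(((h + 1 : ℕ) : ℝ) / B)) := by
    have e1 : -(((h + 1 : ℕ) : ℝ) / B) = -(1 / B) + -(h / B) := by push_cast; field_simp; ring
    rw [e1, Real.exp_add]
    refine mul_le_mul_of_nonneg_right ?_ (Real.exp_pos _).le
    linarith [Real.add_one_le_exp (-(1 / B))]
  have h2 : (4 : ℝ) ≤ 3 * √2 := by
    have : (4 / 3 : ℝ) ≤ √2 := Real.le_sqrt_of_sq_le (by norm_num)
    linarith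
  have h3 : 0 ≤ α * √2 ^ h := by positivity
  have h4 : (1 - 1 / B) * (4 * α * √2 ^ h) + α * √2 ^ (h + 1) ≤ 4 * α * √2 ^ (h + 1) := by
    rw [pow_succ]
    have : 0 ≤ 1 / B * (4 * (α * √2 ^ h)) := by positivity
    nlinarith
  have h5 : (1 - 1 / B) * (B * β) + β = B * β := by field_simp; ring
  linarith

lemma sqrt_two_pow_mul (h : ℕ) (z : ℝ) : √(2 ^ h * z) = √z * √2 ^ h := by
  rw [Real.sqrt_mul (by positivity), mul_comm]
  congr 1
  rw [Real.sqrt_eq_iff_mul_self_eq (by positivity) (by positivity), ← mul_pow,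
    Real.mul_self_sqrt (by norm_num)]

lemma mul_sqrt_le {b z c : ℝ} (hb : 0 ≤ b) (hc : 0 ≤ c) (h : b ^ 2 * z ≤ c ^ 2) : b * √z ≤ c := by
  rw [← Real.sqrt_sq hb, ← Real.sqrt_mul (sq_nonneg b), Real.sqrt_le_left hc]
  exact h

end numbers

/-! ### Accuracy of one coordinate -/

section coordinate

variable {d k r n : ℕ} {C ε δ K : ℝ} {M : ℕ}

lemma softO_ge {p : ℕ} {X : ℝ} (hK : 0 ≤ K) (hX : 0 ≤ X) : K * X ≤ softO K p X := by
  have h1 : 1 ≤ Real.logb 2 (2 + X) := by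
    rw [Real.le_logb_iff_rpow_le (by norm_num) (by linarith), Real.rpow_one]; linarith
  exact le_mul_of_one_le_right (by positivity) (one_le_pow₀ h1)

/-- In terms of `κ = k / ε`, the general sample size is `log (d k / δ) (M κ) ^ (C r + e)` for a large constant
`M`, and more. -/
lemma rpow_le_of_rateGeneral {p : ℕ} (hM : 1 ≤ M) (hK : (M : ℝ) ^ (M + 3) ≤ K) (hk : 1 ≤ k) (hr : 1 ≤ r)
    (hC : 1 ≤ C) (hε : 0 < ε) (hL' : 1 ≤ Real.logb 2 (d * k / δ)) {e : ℝ} (he0 : 0 ≤ e) (he : e ≤ 3)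
    (hn : softO K p (rateGeneral e d k r C ε δ) ≤ n) :
    (M * (k / ε)) ^ (C * r + e) ≤ n / Real.logb 2 (d * k / δ) := by
  have hk' : (0 : ℝ) < k := by exact_mod_cast hk
  have hr' : (1 : ℝ) ≤ r := by exact_mod_cast hr
  have hM' : (1 : ℝ) ≤ M := by exact_mod_cast hM
  have hB : 1 ≤ C * r := by nlinarith
  have hK1 : 1 ≤ K := (one_le_pow₀ hM').trans hK
  have e1 : rateGeneral e d k r C ε δ =
      Real.logb 2 (d * k / δ) * (C * r * (k / ε)) ^ (C * r + e) := by
    rw [rateGeneral, mul_assoc, ← Real.mul_rpow hk'.le (by positivity)]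
    congr 2; ring
  rw [le_div_iff₀ (by linarith)]
  refine le_trans ?_ ((softO_ge (by linarith) (by rw [e1]; positivity)).trans hn)
  rw [e1]
  have := mul_rpow_le_const_mul hM hK hB (κ := k / ε) (by positivity) he0 he
  calc _ ≤ K * (C * r * (k / ε)) ^ (C * r + e) * Real.logb 2 (d * k / δ) := by gcongr
    _ = _ := by ring

/-- The general rate for Level-Splits: a bound `a h` on the loss after `h` levels. -/
lemma level_general_bound {B κ L L' : ℝ} (hM : 4000 ≤ M) (hB : 1 ≤ B) (hκ : 16 / 25 < κ) (hL : 1 ≤ L)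
    (hLL' : L ≤ L') (hn : (M * κ) ^ (B + 2) ≤ n / L') {q : ℝ}
    (hq : q = B / (B + 2) * Real.logb 2 (n / L)) {H : ℕ} (hH : IsDepth q H) :
    ∃ a : ℕ → ℝ, 1 ≤ a 0 ∧ (∀ h < H, (1 - 1 / B) * a h + 6 * levelDev n L L' (h + 1) ≤ a (h + 1)) ∧
      a H + 6 * levelDev n L L' H ≤ 1 / κ := by
  have hM' : (4000 : ℝ) ≤ M := by exact_mod_cast hM
  have hκ0 : 0 < κ := by linarith
  set x := M * κ with hx_def
  have hx : 16 ≤ x := by nlinarith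
  have hx0 : 0 < x := by linarith
  have hL0 : 0 < L := by linarith
  have hn' : (0 : ℝ) ≤ n := Nat.cast_nonneg n
  have hu : x ^ (B + 2) ≤ n / L := hn.trans (by gcongr)
  have hn0 : (0 : ℝ) < n := by
    have : 0 < n / L := lt_of_lt_of_le (by positivity) hu
    by_contra h0
    have : (n : ℝ) = 0 := le_antisymm (not_lt.1 h0) hn'
    simp [this] at *
  obtain ⟨q0, q1, q2, q3, -⟩ := depth_facts hB le_rfl hx hu hq
  have hHq : (H : ℝ) ≤ q + 2 := by
    have h1 : (H : ℝ) ≤ ⌈q⌉₊ + 1 := by exact_mod_cast hH.2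
    linarith [Nat.ceil_lt_add_one q0]
  have hqH : q ≤ H := (Nat.le_ceil q).trans (by exact_mod_cast hH.1)
  -- `d1` and `d2` bound the deviations that do not grow with the level, `d3` the one that does.
  have d1 : B * √(H * L / n) ≤ 23 / x := by
    have h1 := sq_mul_div_le hB le_rfl hx hu (Nat.cast_nonneg H) (hHq.trans q3)
    exact mul_sqrt_le (by linarith) (by positivity) (by convert h1 using 1; field_simp)
  have d2 : B * √(L' / n) ≤ 23 / x := by
    have h0 := mul_log_le_log hx hn
    have h0' := two_le_log_of_sixteen_le hx
    have h1 := sq_mul_div_le hB le_rfl hx hn zero_le_one (by nlinarith)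
    exact mul_sqrt_le (by linarith) (by positivity) (by convert h1 using 1; field_simp)
  have d3 : √(2 ^ H / n) ≤ 2 / x := by
    rw [Real.sqrt_le_left (by positivity)]
    have h1 : (2 : ℝ) ^ H ≤ 4 * 2 ^ q := by
      rw [← Real.rpow_natCast]
      calc (2 : ℝ) ^ (H : ℝ) ≤ 2 ^ (q + 2) := Real.rpow_le_rpow_of_exponent_le (by norm_num) hHq
        _ = 4 * 2 ^ q := by rw [Real.rpow_add (by norm_num)]; norm_num; ring
    have h2 : (2 : ℝ) ^ q / n ≤ (2 : ℝ) ^ q / (n / L) := by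
      gcongr
      exact div_le_self hn0.le hL
    calc (2 : ℝ) ^ H / n ≤ 4 * 2 ^ q / n := by gcongr
      _ = 4 * (2 ^ q / n) := by ring
      _ ≤ 4 * (1 / x) ^ 2 := by linarith
      _ = (2 / x) ^ 2 := by ring
  have d4 : Real.exp (-(H / B)) ≤ 1 / x := by
    refine le_trans (Real.exp_le_exp.2 ?_) q1
    have : q / B ≤ H / B := by gcongr
    linarith
  set α := 36 * √(1 / n)
  set β := 36 * (√(H * L / n) + √(L' / n))
  have hpow : ∀ h : ℕ, √(2 ^ h / n) = √(1 / n) * √2 ^ h := by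
    intro h
    rw [← sqrt_two_pow_mul, mul_one_div]
  refine ⟨fun h => Real.exp (-(h / B)) + 4 * α * √2 ^ h + B * β, ?_, ?_, ?_⟩
  · have : 0 ≤ B * β := by positivity
    have : 0 ≤ α := by positivity
    simp; linarith
  · intro h hh
    refine le_trans ?_ (loss_recursion (β := β) hB (by positivity : 0 ≤ α) h)
    have h1 : 6 * levelDev n L L' (h + 1) ≤ α * √2 ^ (h + 1) + β := by
      have h2 : √(((h + 1 : ℕ) : ℝ) * L / n) ≤ √(H * L / n) := by
        refine Real.sqrt_le_sqrt ?_
        have : ((h + 1 : ℕ) : ℝ) ≤ H := by exact_mod_cast hh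
        gcongr
      rw [levelDev, hpow]
      simp only [α, β]
      linarith
    linarith
  · have e1 : 4 * α * √2 ^ H = 144 * √(2 ^ H / n) := by rw [hpow]; ring
    have e2 : √(H * L / n) ≤ B * √(H * L / n) := le_mul_of_one_le_left (Real.sqrt_nonneg _) hB
    have e3 : √(L' / n) ≤ B * √(L' / n) := le_mul_of_one_le_left (Real.sqrt_nonneg _) hB
    have e4 : B * β = 36 * (B * √(H * L / n) + B * √(L' / n)) := by simp only [β]; ring
    have e5 : Real.exp (-(H / B)) + 4 * α * √2 ^ H + B * β + 6 * levelDev n L L' H ≤ 3673 / x := by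
      rw [e1, e4, levelDev]
      have h1 : 3673 / x = 1 / x + 180 * (2 / x) + 72 * (23 / x + 23 / x) := by ring
      linarith
    refine e5.trans ?_
    rw [div_le_div_iff₀ hx0 hκ0, hx_def]
    nlinarith

/-- The general rate for Breiman's algorithm: a bound `a h` on the loss after `h` complete rounds. -/
lemma breiman_general_bound {B κ L L' : ℝ} (hM : 4000 ≤ M) (hK : (M : ℝ) ^ 2 ≤ K) (hB : 1 ≤ B)
    (hκ : 16 / 25 < κ) (hL : 1 ≤ L)
    (hLL' : L ≤ L') (hn : (M * κ) ^ (B + 3) ≤ n / L') {q : ℝ}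
    (hq : q = B / (B + 3) * Real.logb 2 (n / L)) {t : ℕ} (ht1 : 1 ≤ t) (hqt : q ≤ Real.logb 2 t)
    (ht : (t : ℝ) ≤ max (2 * 2 ^ q) (n / (K * (B * κ) ^ 2 * L'))) :
    ∃ (H : ℕ) (a : ℕ → ℝ), 2 ^ H ≤ t ∧ 1 ≤ a 0 ∧
      (∀ h < H, (1 - 1 / B) * a h + 7 * leafDev n L L' (2 ^ (h + 1)) + 2 ^ h / n ≤ a (h + 1)) ∧
      a H + 6 * leafDev n L L' t ≤ 1 / κ := by
  have hM' : (4000 : ℝ) ≤ M := by exact_mod_cast hM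
  have hκ0 : 0 < κ := by linarith
  set x := M * κ with hx_def
  have hx : 16 ≤ x := by nlinarith
  have hx0 : 0 < x := by linarith
  have hL0 : 0 < L := by linarith
  have hn' : (0 : ℝ) ≤ n := Nat.cast_nonneg n
  have hu : x ^ (B + 3) ≤ n / L := hn.trans (by gcongr)
  have hn0 : (0 : ℝ) < n := by
    have : 0 < n / L := lt_of_lt_of_le (by positivity) hu
    by_contra h0
    have : (n : ℝ) = 0 := le_antisymm (not_lt.1 h0) hn'
    simp [this] at *
  have he : (2 : ℝ) ≤ 3 := by norm_num
  obtain ⟨q0, q1, q2, q3, q4⟩ := depth_facts hB he hx hu hq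
  have ht0 : (0 : ℝ) < t := by exact_mod_cast ht1
  have h2q : (2 : ℝ) ^ q ≤ t := by
    rwa [Real.le_logb_iff_rpow_le (by norm_num) ht0] at hqt
  set H := ⌊q⌋₊ with hH_def
  have hHq : (H : ℝ) ≤ q := Nat.floor_le q0
  have hqH : q - 1 ≤ H := by linarith [Nat.lt_floor_add_one q]
  have h2H : (2 : ℝ) ^ H ≤ 2 ^ q := by
    rw [← Real.rpow_natCast]
    exact Real.rpow_le_rpow_of_exponent_le (by norm_num) hHq
  have d2 : B * √(L' / n) ≤ 23 / x := by
    have h0 := mul_log_le_log hx hn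
    have h0' := two_le_log_of_sixteen_le hx
    have h1 := sq_mul_div_le hB he hx hn zero_le_one (by nlinarith)
    exact mul_sqrt_le (by linarith) (by positivity) (by convert h1 using 1; field_simp)
  have d3 : √(2 ^ H * (L / n)) ≤ 1 / x := by
    rw [Real.sqrt_le_left (by positivity)]
    calc (2 : ℝ) ^ H * (L / n) ≤ 2 ^ q * (L / n) := by gcongr
      _ = 2 ^ q / (n / L) := by field_simp
      _ ≤ _ := q2
  have d4 : Real.exp (-(H / B)) ≤ 3 / x := by
    have h1 : Real.exp (-(H / B)) ≤ Real.exp 1 * Real.exp (-(q / B)) := by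
      rw [← Real.exp_add]
      refine Real.exp_le_exp.2 ?_
      have h3 : (q - 1) / B ≤ H / B := by gcongr
      have h4 : 1 / B ≤ 1 := by rw [div_le_one (by linarith)]; exact hB
      rw [sub_div] at h3
      linarith
    calc _ ≤ Real.exp 1 * Real.exp (-(q / B)) := h1
      _ ≤ 3 * (1 / x) := by
        gcongr
        linarith [Real.exp_one_lt_d9]
      _ = _ := by ring
  have d5 : √(t * L / n) ≤ 2 / x := by
    rw [Real.sqrt_le_left (by positivity)]
    rcases le_max_iff.1 ht with h | h
    · calc t * L / n ≤ 2 * 2 ^ q * L / n := by gcongr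
        _ = 2 * (2 ^ q / (n / L)) := by field_simp
        _ ≤ 2 * (1 / x) ^ 2 := by gcongr
        _ ≤ (2 / x) ^ 2 := by
          have : 0 ≤ (1 / x) ^ 2 := by positivity
          rw [show (2 / x) ^ 2 = 4 * (1 / x) ^ 2 by ring]; linarith
    · have hK0 : 0 < K := lt_of_lt_of_le (by positivity) hK
      have hL'0 : 0 < L' := by linarith
      calc t * L / n ≤ n / (K * (B * κ) ^ 2 * L') * L' / n := by gcongr
        _ = 1 / (K * (B * κ) ^ 2) := by field_simp
        _ ≤ 1 / (M ^ 2 * (1 * κ) ^ 2) := by gcongr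
        _ = (1 / x) ^ 2 := by rw [hx_def, one_mul]; ring
        _ ≤ (2 / x) ^ 2 := by gcongr; norm_num
  set α := 57 * √(L / n)
  set β := 56 * √(L' / n)
  refine ⟨H, fun h => Real.exp (-(h / B)) + 4 * α * √2 ^ h + B * β, ?_, ?_, ?_, ?_⟩
  · exact_mod_cast h2H.trans h2q
  · have : 0 ≤ B * β := by positivity
    have : 0 ≤ α := by positivity
    simp; linarith
  · intro h hh
    refine le_trans ?_ (loss_recursion (β := β) hB (by positivity : 0 ≤ α) h)
    have e1 : √(((2 ^ (h + 1) : ℕ) : ℝ) * L / n) = √(L / n) * √2 ^ (h + 1) := by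
      rw [← sqrt_two_pow_mul]; push_cast; rw [mul_div_assoc]
    have e2 : (2 : ℝ) ^ h / n ≤ √(L / n) * √2 ^ (h + 1) := by
      have h1 : (2 : ℝ) ^ h ≤ n := by
        calc (2 : ℝ) ^ h ≤ 2 ^ H := pow_le_pow_right₀ (by norm_num) hh.le
          _ ≤ 2 ^ q := h2H
          _ ≤ n / L := q4
          _ ≤ n := div_le_self hn0.le hL
      have h2 : (2 : ℝ) ^ h / n ≤ 1 := by rwa [div_le_one hn0]
      rw [← sqrt_two_pow_mul]
      refine Real.le_sqrt_of_sq_le ?_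
      calc ((2 : ℝ) ^ h / n) ^ 2 ≤ 2 ^ h / n := by
            rw [pow_two]; exact mul_le_of_le_one_left (by positivity) h2
        _ ≤ 2 ^ (h + 1) * (L / n) := by
            rw [div_eq_mul_one_div]
            gcongr
            · norm_num
            · exact Nat.le_succ h
    rw [leafDev, e1]
    simp only [α, β]
    linarith
  · have e1 : 4 * α * √2 ^ H = 228 * √(2 ^ H * (L / n)) := by rw [sqrt_two_pow_mul]; ring
    have e3 : √(L' / n) ≤ B * √(L' / n) := le_mul_of_one_le_left (Real.sqrt_nonneg _) hB
    have e4 : B * β = 56 * (B * √(L' / n)) := by simp only [β]; ring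
    have e5 : Real.exp (-(H / B)) + 4 * α * √2 ^ H + B * β + 6 * leafDev n L L' t ≤ 2719 / x := by
      rw [e1, e4, leafDev]
      have h1 : 2719 / x = 3 / x + 228 * (1 / x) + 104 * (23 / x) + 48 * (2 / x) := by ring
      linarith
    refine e5.trans ?_
    rw [div_le_div_iff₀ hx0 hκ0, hx_def]
    nlinarith

/-- Under a product law, the logarithmic factor of the sample size absorbs the powers of `r`. -/
lemma le_four_mul_logb {X : ℝ} (hX : 2 ^ r ≤ 32 * X) : (r : ℝ) ≤ 4 * Real.logb 2 (2 + X) := by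
  have hX0 : 0 < X := by
    have : (0 : ℝ) < 2 ^ r := by positivity
    linarith
  have h1 : (2 : ℝ) ^ r ≤ (2 + X) ^ 4 := by nlinarith [sq_nonneg X, pow_pos hX0 3, pow_pos hX0 4]
  have h2 := Real.logb_le_logb_of_le (b := 2) (by norm_num) (by positivity) h1
  rw [Real.logb_pow, Real.logb_pow, Real.logb_self_eq_one (by norm_num)] at h2
  push_cast at h2
  linarith

/-- The rate for Level-Splits under a product law. -/
lemma level_product_bound {κ L L' Λ : ℝ} (hM : 4000 ≤ M) (hK : (M : ℝ) ^ 2 ≤ K) (hC : 1 ≤ C)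
    (hr : 1 ≤ r) (hκ : 0 < κ) (hL : 1 ≤ L) (hLL' : L ≤ L') (hΛ : 1 ≤ Λ) (hrΛ : r ≤ 4 * Λ)
    (hn : K * (L' * 2 ^ r * (C * κ) ^ 2) * Λ ^ 4 ≤ n) {H : ℕ} (hH : H ≤ r + 1) :
    ∃ err : ℝ, (∀ h ≤ H, C * r * (6 * levelDev n L L' h) ≤ err) ∧
      err + 6 * levelDev n L L' H ≤ 1 / κ := by
  have hM' : (4000 : ℝ) ≤ M := by exact_mod_cast hM
  have hr' : (1 : ℝ) ≤ r := by exact_mod_cast hr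
  have hK0 : 0 < K := lt_of_lt_of_le (by positivity) hK
  have hL'0 : 0 < L' := by linarith
  have hn0 : (0 : ℝ) < n := lt_of_lt_of_le (by positivity) hn
  set s := √(2 ^ r * L' / n) with hs
  have hs0 : 0 ≤ s := Real.sqrt_nonneg _
  have hB : 1 ≤ C * r := by nlinarith
  have h1 : C * r * s ≤ 4 / (M * κ) := by
    refine mul_sqrt_le (by positivity) (by positivity) ?_
    have h2 : 2 ^ r * L' / n ≤ 2 ^ r * L' / (K * (L' * 2 ^ r * (C * κ) ^ 2) * Λ ^ 4) := by gcongr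
    calc (C * r) ^ 2 * (2 ^ r * L' / n)
        ≤ (C * r) ^ 2 * (2 ^ r * L' / (K * (L' * 2 ^ r * (C * κ) ^ 2) * Λ ^ 4)) := by gcongr
      _ = r ^ 2 / (K * κ ^ 2 * Λ ^ 4) := by field_simp
      _ ≤ (4 * Λ) ^ 2 / (M ^ 2 * κ ^ 2 * Λ ^ 2) := by
          gcongr
          norm_num
      _ = (4 / (M * κ)) ^ 2 := by field_simp
  have h3 : ∀ h ≤ H, levelDev n L L' h ≤ 36 * s := by
    intro h hh
    have hh' : (h : ℝ) ≤ 2 ^ (r + 1) := by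
      have h5 : h ≤ 2 ^ (r + 1) := (hh.trans hH).trans Nat.lt_two_pow_self.le
      exact_mod_cast h5
    have hle : ∀ z : ℝ, z ≤ 4 * (2 ^ r * L') → √(z / n) ≤ 2 * s := by
      intro z hz
      rw [Real.sqrt_le_left (by positivity), mul_pow, hs, Real.sq_sqrt (by positivity), ← mul_div_assoc]
      refine div_le_div_of_nonneg_right ?_ hn0.le
      linarith
    have hpr : (2 : ℝ) ^ (r + 1) = 2 * 2 ^ r := by ring
    have hp1 : (1 : ℝ) ≤ 2 ^ r := one_le_pow₀ (by norm_num)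
    have a1 := hle (2 ^ h) (by
      have : (2 : ℝ) ^ h ≤ 2 ^ (r + 1) := pow_le_pow_right₀ (by norm_num) (hh.trans hH)
      nlinarith)
    have a2 := hle (h * L) (by
      calc h * L ≤ 2 ^ (r + 1) * L' := by gcongr
        _ ≤ _ := by rw [hpr]; nlinarith [mul_pos (by linarith : (0:ℝ) < 2 ^ r) hL'0])
    have a3 := hle L' (by nlinarith)
    rw [levelDev]; linarith
  refine ⟨C * r * (6 * (36 * s)), ?_, ?_⟩
  · intro h hh
    exact mul_le_mul_of_nonneg_left (by linarith [h3 h hh]) (by linarith)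
  · have h4 := h3 H le_rfl
    have h5 : s ≤ C * r * s := le_mul_of_one_le_left hs0 hB
    have h6 : 432 * (4 / (M * κ)) ≤ 1 / κ := by
      rw [← mul_div_assoc, div_le_div_iff₀ (by positivity) hκ]
      nlinarith
    linarith

/-- The rate for Breiman's algorithm under a product law. -/
lemma breiman_product_bound {κ L L' Λ : ℝ} (hM : 10000 ≤ M) (hK : (M : ℝ) ^ 2 ≤ K) (hC : 1 ≤ C)
    (hr : 1 ≤ r) (hκ : 16 / 25 < κ) (hL : 1 ≤ L) (hLL' : L ≤ L') (hΛ : 1 ≤ Λ) (hrΛ : r ≤ 4 * Λ)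
    (hn : K * (L' * κ ^ 3 * C ^ 2 * 2 ^ r) * Λ ^ 4 ≤ n) {t : ℕ}
    (ht : (t : ℝ) ≤ max (2 * 2 ^ (r : ℝ)) (n / (K * (C * r * κ) ^ 2 * L'))) :
    r * ((6 * (C * r) + 1) * leafDev n L L' (2 ^ r) + 2 ^ r / n) + 6 * leafDev n L L' t ≤ 1 / κ := by
  have hM' : (10000 : ℝ) ≤ M := by exact_mod_cast hM
  have hr' : (1 : ℝ) ≤ r := by exact_mod_cast hr
  have hK0 : 0 < K := lt_of_lt_of_le (by positivity) hK
  have hL'0 : 0 < L' := by linarith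
  have hκ0 : 0 < κ := by linarith
  have hn0 : (0 : ℝ) < n := lt_of_lt_of_le (by positivity) hn
  set s := √(2 ^ r * L' / n) with hs
  have hs0 : 0 ≤ s := Real.sqrt_nonneg _
  have hB : 1 ≤ C * r := by nlinarith
  have hB2 : 1 ≤ C * r ^ 2 := by nlinarith
  have hp1 : (1 : ℝ) ≤ 2 ^ r := one_le_pow₀ (by norm_num)
  have h1 : C * r ^ 2 * s ≤ 20 / (M * κ) := by
    refine mul_sqrt_le (by positivity) (by positivity) ?_
    have h2 : 2 ^ r * L' / n ≤ 2 ^ r * L' / (K * (L' * κ ^ 3 * C ^ 2 * 2 ^ r) * Λ ^ 4) := by gcongr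
    calc (C * r ^ 2) ^ 2 * (2 ^ r * L' / n)
        ≤ (C * r ^ 2) ^ 2 * (2 ^ r * L' / (K * (L' * κ ^ 3 * C ^ 2 * 2 ^ r) * Λ ^ 4)) := by gcongr
      _ = r ^ 4 / (K * (κ * κ ^ 2) * Λ ^ 4) := by field_simp
      _ ≤ (4 * Λ) ^ 4 / (M ^ 2 * (16 / 25 * κ ^ 2) * Λ ^ 4) := by gcongr
      _ = 400 / (M * κ) ^ 2 := by field_simp; norm_num
      _ = (20 / (M * κ)) ^ 2 := by ring
  have hle : ∀ z c : ℝ, 0 ≤ c → z ≤ c ^ 2 * (2 ^ r * L') → √(z / n) ≤ c * s := by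
    intro z c hc hz
    rw [Real.sqrt_le_left (by positivity), mul_pow, hs, Real.sq_sqrt (by positivity), ← mul_div_assoc]
    exact div_le_div_of_nonneg_right hz hn0.le
  have a1 : √(((2 ^ r : ℕ) : ℝ) * L / n) ≤ 1 * s := 
    hle _ _ zero_le_one (by push_cast; rw [one_pow, one_mul]; gcongr)
  have a2 : √(L' / n) ≤ 1 * s := hle _ _ zero_le_one (by nlinarith)
  have h5 : s ≤ C * r ^ 2 * s := le_mul_of_one_le_left hs0 hB2
  have hs1 : s ≤ 1 := by
    refine (h5.trans h1).trans ?_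
    rw [div_le_one (by positivity)]; nlinarith
  have a3 : (2 : ℝ) ^ r / n ≤ s := by
    have h6 : (2 : ℝ) ^ r / n ≤ s ^ 2 := by
      rw [hs, Real.sq_sqrt (by positivity)]
      refine div_le_div_of_nonneg_right ?_ hn0.le
      nlinarith
    nlinarith
  have a4 : √(t * L / n) ≤ 2 * s + 1 / (M * κ) := by
    rcases le_max_iff.1 ht with h | h
    · rw [Real.rpow_natCast] at h
      have h6 := hle (t * L) 2 (by norm_num) (by
        calc t * L ≤ 2 * 2 ^ r * L' := by gcongr
          _ ≤ _ := by nlinarith [mul_pos (by linarith : (0:ℝ) < 2 ^ r) hL'0])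
      have : 0 ≤ 1 / (M * κ) := by positivity
      linarith
    · have h6 : √(t * L / n) ≤ 1 / (M * κ) := by
        rw [Real.sqrt_le_left (by positivity)]
        calc t * L / n ≤ n / (K * (C * r * κ) ^ 2 * L') * L' / n := by gcongr
          _ = 1 / (K * (C * r * κ) ^ 2) := by field_simp
          _ ≤ 1 / (M ^ 2 * (1 * κ) ^ 2) := by gcongr
          _ = (1 / (M * κ)) ^ 2 := by rw [one_mul]; ring
      linarith
  have b1 : leafDev n L L' (2 ^ r) ≤ 16 * s := by rw [leafDev]; linarith
  have b0 : 0 ≤ leafDev n L L' (2 ^ r) := by rw [leafDev]; positivity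
  have b2 : r * ((6 * (C * r) + 1) * leafDev n L L' (2 ^ r) + 2 ^ r / n) ≤ 113 * (C * r ^ 2 * s) := by
    calc r * ((6 * (C * r) + 1) * leafDev n L L' (2 ^ r) + 2 ^ r / n)
        ≤ r * ((7 * (C * r)) * (16 * s) + s) := by
          gcongr
          linarith
      _ ≤ r * ((7 * (C * r)) * (16 * s) + C * r * s) := by
          gcongr
          exact le_mul_of_one_le_left hs0 hB
      _ = 113 * (C * r ^ 2 * s) := by ring
  have b3 : leafDev n L L' t ≤ 24 * s + 8 * (1 / (M * κ)) := by rw [leafDev]; linarith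
  have h6 : 5188 * (1 / (M * κ)) ≤ 1 / κ := by
    rw [← mul_div_assoc, mul_one, div_le_div_iff₀ (by positivity) hκ0, one_mul]
    exact mul_le_mul_of_nonneg_right (by linarith) hκ0.le
  have h7 : (20 : ℝ) / (M * κ) = 20 * (1 / (M * κ)) := by ring
  rw [h7] at h1
  have h8 : r * ((6 * (C * r) + 1) * leafDev n L L' (2 ^ r) + 2 ^ r / n) ≤
      2260 * (1 / (M * κ)) := b2.trans (by linarith)
  have h9 : leafDev n L L' t ≤ 488 * (1 / (M * κ)) := b3.trans (by linarith)
  exact le_trans (by linarith) h6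

end coordinate

/-! ### Accuracy -/

section

variable {d k n r : ℕ} {C ε δ : ℝ} {m : Point d → Fin k → ℝ} {Dx : Measure (Point d)}
  {E : Measure (Fin k → ℝ)} [IsProbabilityMeasure Dx] [IsProbabilityMeasure E]

/-- If there are no labels, if the failure probability is at least `1`, or if the error allowed for each
coordinate is at least `25/16`, then any estimate with values in `[-1/4, 5/4]` will do. -/
lemma measure_risk_gt_le_of_trivial (hm : ∀ x i, m x i ∈ Set.Icc (0 : ℝ) 1)
    (hE : IsBoundedCenteredNoise E) (hε : 0 < ε) (hδ : 0 < δ)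
    {g : ScoreData d k n → Point d → Fin k → ℝ}
    (hg : ∀ i ω, (∀ s ∈ (coordData ω i).val, s.2 ∈ Set.Icc (-(1 / 4) : ℝ) (5 / 4)) →
      ∀ x, g ω x i ∈ Set.Icc (-(1 / 4) : ℝ) (5 / 4))
    (h : ¬(1 ≤ k ∧ δ ≤ 1 ∧ 16 / 25 < k / ε)) :
    sampleLaw m Dx E n {ω | ε < risk m Dx (g ω)} ≤ ENNReal.ofReal δ := by
  by_cases hk : 1 ≤ k
  · by_cases hδ1 : δ ≤ 1
    · have hκ : k / ε ≤ 16 / 25 := by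
        by_contra h'
        exact h ⟨hk, hδ1, not_le.1 h'⟩
      have hk' : (0 : ℝ) < k := by exact_mod_cast hk
      refine measure_risk_gt_le (Bad := fun _ => ∅) hm hE hk hδ (by simp) ?_
      intro i ω _ hω
      have h1 : ∀ x, pointMass Dx x * (m x i - g ω x i) ^ 2 ≤ pointMass Dx x * (25 / 16) := by
        intro x
        refine mul_le_mul_of_nonneg_left ?_ (pointMass_nonneg x)
        obtain ⟨a1, a2⟩ := hm x i
        obtain ⟨b1, b2⟩ := hg i ω hω x
        nlinarith
      refine (Finset.sum_le_sum fun x _ => h1 x).trans ?_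
      rw [← Finset.sum_mul, sum_pointMass_univ, one_mul]
      rw [div_le_iff₀ hε] at hκ
      rw [le_div_iff₀ hk']
      linarith
    · refine prob_le_one.trans ?_
      rw [ENNReal.one_le_ofReal]
      exact (not_le.1 hδ1).le
  · obtain rfl : k = 0 := by omega
    have : {ω : ScoreData d 0 n | ε < risk m Dx (g ω)} = ∅ := by
      ext ω
      simp [risk, hε.le]
    rw [this]
    simp

/-- A bound for Level-Splits on all data sets with small discrepancies holds with high probability. -/
lemma measure_levelSplits_risk_gt_le (hm : ∀ x i, m x i ∈ Set.Icc (0 : ℝ) 1)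
    (hE : IsBoundedCenteredNoise E) (hε : 0 < ε) (hδ : 0 < δ) (hd : 2 * δ ≤ d) (H : ℕ)
    (hmain : 1 ≤ k → 16 / 25 < k / ε → 0 < n ∧ ∀ (i : Fin k) (D : List (Sample d)),
      D.length = n → (∀ s ∈ D, s.2 ∈ Set.Icc (-(1 / 4) : ℝ) (5 / 4)) →
      (∀ S : List (Fin d), S.length ≤ H →
        sampleDisc D (pointMass Dx) (fun x => m x i) (fullTree S) ≤
          levelDev n (Real.logb 2 (d / δ)) (Real.logb 2 (d * k / δ)) S.length) →
      ∑ x, pointMass Dx x * (m x i - (levelSplits D H).val.2.eval x) ^ 2 ≤ 1 / (k / ε)) :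
    sampleLaw m Dx E n {ω | ε < risk m Dx (levelSplitsEstimate H ω)} ≤ ENNReal.ofReal δ := by
  by_cases h : 1 ≤ k ∧ δ ≤ 1 ∧ 16 / 25 < k / ε
  · obtain ⟨hk, hδ1, hκ⟩ := h
    obtain ⟨hn, hmain⟩ := hmain hk hκ
    refine measure_risk_gt_le hm hE hk hδ
      (fun i => measure_levelDev_lt_le hm hE hn i hδ hδ1 hd H) ?_
    intro i ω hbad hω
    rw [← one_div_div]
    refine hmain i (coordData ω i).val (by simp [coordData, Timed.charge]) hω ?_
    intro S hS
    by_contra h'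
    exact hbad ⟨S, hS, not_le.1 h'⟩
  · exact measure_risk_gt_le_of_trivial hm hE hε hδ
      (fun i ω hω x => levelTree_eval_mem hω _ x) h

lemma breiman_eval_mem {D : List (Sample d)}
    (hD : ∀ s ∈ D, s.2 ∈ Set.Icc (-(1 / 4) : ℝ) (5 / 4)) (t : ℕ) (x : Point d) :
    (breiman D t).val.eval x ∈ Set.Icc (-(1 / 4) : ℝ) (5 / 4) := by
  obtain ⟨h1, -, -⟩ := breimanGrow_refines (D := D) (w := 0) (f := 0) (fun _ => le_rfl) (by simp)
    t (.leaf D) (t - 1) (by simp [DTree.Carries, pathPts_nil])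
  have h2 : (breiman D t).val.eval x = _ := fitLeaves_eval _ x [] h1
  rw [h2]
  exact avgLabel_mem fun s hs => hD s (List.mem_filter.1 hs).1

/-- A bound for Breiman's algorithm on all data sets with small discrepancies holds with high
probability. -/
lemma measure_breiman_risk_gt_le (hm : ∀ x i, m x i ∈ Set.Icc (0 : ℝ) 1)
    (hE : IsBoundedCenteredNoise E) (hε : 0 < ε) (hδ : 0 < δ) (hd : 2 * δ ≤ d) (t : ℕ)
    (hmain : 1 ≤ k → 16 / 25 < k / ε → 0 < n ∧ ∀ (i : Fin k) (D : List (Sample d)),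
      D.length = n → (∀ s ∈ D, s.2 ∈ Set.Icc (-(1 / 4) : ℝ) (5 / 4)) →
      (∀ T : DTree d Unit, T.leaves ≤ t →
        sampleDisc D (pointMass Dx) (fun x => m x i) T ≤
          leafDev n (Real.logb 2 (d / δ)) (Real.logb 2 (d * k / δ)) T.leaves) →
      ∑ x, pointMass Dx x * (m x i - (breiman D t).val.eval x) ^ 2 ≤ 1 / (k / ε)) :
    sampleLaw m Dx E n {ω | ε < risk m Dx (breimanEstimate t ω)} ≤ ENNReal.ofReal δ := by
  by_cases h : 1 ≤ k ∧ δ ≤ 1 ∧ 16 / 25 < k / ε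
  · obtain ⟨hk, hδ1, hκ⟩ := h
    obtain ⟨hn, hmain⟩ := hmain hk hκ
    refine measure_risk_gt_le hm hE hk hδ
      (fun i => measure_leafDev_lt_le hm hE hn i hδ hδ1 hd t) ?_
    intro i ω hbad hω
    rw [← one_div_div]
    refine hmain i (coordData ω i).val (by simp [coordData, Timed.charge]) hω ?_
    intro T hT
    by_contra h'
    exact hbad ⟨T, hT, not_le.1 h'⟩
  · exact measure_risk_gt_le_of_trivial hm hE hε hδ
      (fun i ω hω x => breiman_eval_mem hω t x) h

/-- A sparse function ignores the directions outside its relevant set. -/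
lemma IsProductLaw.exists_relevant {f : Point d → ℝ} (h : IsProductLaw Dx) (hs : IsSparse r f) :
    ∃ R : Finset (Fin d), R.card = r ∧ (∀ x y : Point d, (∀ i ∈ R, x i = y i) → f x = f y) ∧
      ∀ i ∉ R, ∀ p, cellGain (pointMass Dx) f p i = 0 := by
  obtain ⟨R, hR, hdep⟩ := hs.exists_relevant
  refine ⟨R, hR, hdep, fun i hi p => h.cellGain_eq_zero (fun x z => hdep _ _ fun j hj => ?_) p⟩
  rw [Function.update_of_ne (ne_of_mem_of_not_mem hj hi)]

lemma logLeaves_eq {e : ℝ} (hn : 0 < n) (hδ : 0 < δ) (hd : 2 * δ ≤ d) :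
    logLeaves e d n r C δ = C * r / (C * r + e) * Real.logb 2 (n / Real.logb 2 (d / δ)) := by
  have hn' : (n : ℝ) ≠ 0 := by exact_mod_cast hn.ne'
  have hL := one_le_logb_div hδ hd
  rw [logLeaves, Real.logb_div hn' (by linarith)]

variable {K : ℝ} {M : ℕ}

/-- A natural number that is at least a positive sample size is positive. -/
lemma pos_of_softO_le {p : ℕ} {X : ℝ} (hK : 0 < K) (hX : 0 < X) (hn : softO K p X ≤ n) : 0 < n := by
  have h1 : 0 < K * X := by positivity
  exact_mod_cast h1.trans_le ((softO_ge (p := p) hK.le hX.le).trans hn)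

lemma rateGeneral_pos {e : ℝ} (hk : 1 ≤ k) (hr : 1 ≤ r) (hC : 1 ≤ C) (hε : 0 < ε)
    (hL' : 1 ≤ Real.logb 2 (d * k / δ)) : 0 < rateGeneral e d k r C ε δ := by
  have hk' : (0 : ℝ) < k := by exact_mod_cast hk
  have hr' : (0 : ℝ) < r := by exact_mod_cast hr
  rw [rateGeneral]
  positivity

theorem levelSplits_general (hM : 10000 ≤ M) (hK : (M : ℝ) ^ (M + 3) ≤ K) (hr : 1 ≤ r) (hC : 1 ≤ C)
    (hε : 0 < ε) (hδ : 0 < δ) (hd : 2 * δ ≤ d) (hm : ∀ x i, m x i ∈ Set.Icc (0 : ℝ) 1)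
    (hE : IsBoundedCenteredNoise E) (hs : ∀ i, IsSparse r fun x => m x i)
    (hV : ∀ i, ApproxSubmodular C (fun x => m x i) Dx) {p : ℕ}
    (hn : softO K p (rateGeneral 2 d k r C ε δ) ≤ n) {H : ℕ} (hH : IsDepth (logLeaves 2 d n r C δ) H) :
    sampleLaw m Dx E n {ω | ε < risk m Dx (levelSplitsEstimate H ω)} ≤ ENNReal.ofReal δ := by
  refine measure_levelSplits_risk_gt_le hm hE hε hδ hd H fun hk hκ => ?_
  have hM' : (10000 : ℝ) ≤ M := by exact_mod_cast hM
  have hr' : (1 : ℝ) ≤ r := by exact_mod_cast hr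
  have hK0 : 0 < K := lt_of_lt_of_le (by positivity) hK
  have hL := one_le_logb_div hδ hd
  have hLL' := logb_div_le_logb_mul_div hδ hd hk
  have hd0 : 0 < d := by
    have : (0 : ℝ) < d := by linarith
    exact_mod_cast this
  have hn0 := pos_of_softO_le hK0 (rateGeneral_pos hk hr hC hε (hL.trans hLL')) hn
  refine ⟨hn0, fun i D hD hlab hdisc => ?_⟩
  have hu := rpow_le_of_rateGeneral (by omega) hK hk hr hC hε (hL.trans hLL') (by norm_num)
    (by norm_num) hn
  have hB : 1 ≤ C * r := one_le_mul_of_one_le_of_one_le hC hr'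
  obtain ⟨a, h0, h1, h2⟩ := level_general_bound (by omega) hB hκ hL hLL' hu
    (logLeaves_eq hn0 hδ hd) hH
  exact (levelSplits_risk_le_of_gain hlab hd0 pointMass_nonneg sum_pointMass_univ
    (fun x => hm x i) hB ((hV i).exists_gain (fun x => hm x i) (hs i) hr hC) hdisc h0 h1).trans h2

theorem breiman_general (hM : 10000 ≤ M) (hK : (M : ℝ) ^ (M + 3) ≤ K) (hr : 1 ≤ r) (hC : 1 ≤ C)
    (hε : 0 < ε) (hδ : 0 < δ) (hd : 2 * δ ≤ d) (hm : ∀ x i, m x i ∈ Set.Icc (0 : ℝ) 1)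
    (hE : IsBoundedCenteredNoise E) (hs : ∀ i, IsSparse r fun x => m x i)
    (hV : ∀ i, ApproxDiminishingReturns C (fun x => m x i) Dx) {p : ℕ}
    (hn : softO K p (rateGeneral 3 d k r C ε δ) ≤ n) {t : ℕ}
    (ht : IsLeafBudget K (logLeaves 3 d n r C δ) d k n r C ε δ t) :
    sampleLaw m Dx E n {ω | ε < risk m Dx (breimanEstimate t ω)} ≤ ENNReal.ofReal δ := by
  refine measure_breiman_risk_gt_le hm hE hε hδ hd t fun hk hκ => ?_
  have hM' : (10000 : ℝ) ≤ M := by exact_mod_cast hM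
  have hr' : (1 : ℝ) ≤ r := by exact_mod_cast hr
  have hk' : (0 : ℝ) < k := by exact_mod_cast hk
  have hK0 : 0 < K := lt_of_lt_of_le (by positivity) hK
  have hK2 : (M : ℝ) ^ 2 ≤ K :=
    (pow_le_pow_right₀ (by linarith) (by omega : 2 ≤ M + 3)).trans hK
  have hL := one_le_logb_div hδ hd
  have hLL' := logb_div_le_logb_mul_div hδ hd hk
  have hd0 : 0 < d := by
    have : (0 : ℝ) < d := by linarith
    exact_mod_cast this
  have hn0 := pos_of_softO_le hK0 (rateGeneral_pos hk hr hC hε (hL.trans hLL')) hn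
  refine ⟨hn0, fun i D hD hlab hdisc => ?_⟩
  have hu := rpow_le_of_rateGeneral (by omega) hK hk hr hC hε (hL.trans hLL') (by norm_num)
    le_rfl hn
  have hB : 1 ≤ C * r := one_le_mul_of_one_le_of_one_le hC hr'
  obtain ⟨ht1, hqt, ht⟩ := ht
  obtain ⟨H, a, hHt, h0, h1, h2⟩ := breiman_general_bound (t := t) (by omega) hK2 hB hκ hL hLL' hu
    (logLeaves_eq hn0 hδ hd) ht1 hqt (ht.trans (max_le_max_left _ ((min_le_right _ _).trans (le_of_eq (by
      field_simp)))))
  refine (breiman_risk_le_of_gain hlab hd0 pointMass_nonneg sum_pointMass_univ (fun x => hm x i) hB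
    ((hV i).exists_gain (fun x => hm x i) (hs i) hr hC) (leafDev_mono (by linarith)) hHt hdisc h0
    ?_).trans h2
  rwa [hD]

/-- The rates under a product law are at least a constant times `2 ^ r`. -/
lemma two_pow_le_rate {X : ℝ} {κ L' : ℝ} (hC : 1 ≤ C) (hκ : 16 / 25 < κ) (hL' : 1 ≤ L')
    (hX : L' * 2 ^ r * (C * κ) ^ 2 ≤ 8 * X) : (2 : ℝ) ^ r ≤ 32 * X := by
  have h0 : κ ≤ C * κ := le_mul_of_one_le_left (by linarith) hC
  have h1 : 1 / 4 ≤ (C * κ) ^ 2 := by nlinarith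
  have h2 : (2 : ℝ) ^ r ≤ L' * 2 ^ r := le_mul_of_one_le_left (by positivity) hL'
  have h3 : (2 : ℝ) ^ r * (1 / 4) ≤ L' * 2 ^ r * (C * κ) ^ 2 :=
    mul_le_mul h2 h1 (by norm_num) (by positivity)
  linarith

lemma one_le_logb_two_add {X : ℝ} (hX : 0 ≤ X) : 1 ≤ Real.logb 2 (2 + X) := by
  rw [Real.le_logb_iff_rpow_le (by norm_num) (by linarith), Real.rpow_one]; linarith

theorem levelSplits_product (hM : 10000 ≤ M) (hK : (M : ℝ) ^ (M + 3) ≤ K) (hr : 1 ≤ r) (hC : 1 ≤ C)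
    (hε : 0 < ε) (hδ : 0 < δ) (hd : 2 * δ ≤ d) (hm : ∀ x i, m x i ∈ Set.Icc (0 : ℝ) 1)
    (hE : IsBoundedCenteredNoise E) (hs : ∀ i, IsSparse r fun x => m x i)
    (hV : ∀ i, ApproxSubmodular C (fun x => m x i) Dx) (hDx : IsProductLaw Dx)
    (hn : softO K 4 (rateLevelProduct d k r C ε δ) ≤ n) {H : ℕ} (hH : IsDepth r H) :
    sampleLaw m Dx E n {ω | ε < risk m Dx (levelSplitsEstimate H ω)} ≤ ENNReal.ofReal δ := by
  refine measure_levelSplits_risk_gt_le hm hE hε hδ hd H fun hk hκ => ?_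
  have hM' : (10000 : ℝ) ≤ M := by exact_mod_cast hM
  have hr' : (1 : ℝ) ≤ r := by exact_mod_cast hr
  have hk' : (0 : ℝ) < k := by exact_mod_cast hk
  have hK0 : 0 < K := lt_of_lt_of_le (by positivity) hK
  have hK2 : (M : ℝ) ^ 2 ≤ K :=
    (pow_le_pow_right₀ (by linarith) (by omega : 2 ≤ M + 3)).trans hK
  have hL := one_le_logb_div hδ hd
  have hLL' := logb_div_le_logb_mul_div hδ hd hk
  have hL' := hL.trans hLL'
  have hd0 : 0 < d := by
    have : (0 : ℝ) < d := by linarith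
    exact_mod_cast this
  have hX : rateLevelProduct d k r C ε δ = Real.logb 2 (d * k / δ) * 2 ^ r * (C * (k / ε)) ^ 2 := by
    rw [rateLevelProduct]; ring
  have hX0 : 0 < rateLevelProduct d k r C ε δ := by rw [hX]; positivity
  have hn0 := pos_of_softO_le hK0 hX0 hn
  refine ⟨hn0, fun i D hD hlab hdisc => ?_⟩
  have hB : 1 ≤ C * r := one_le_mul_of_one_le_of_one_le hC hr'
  obtain ⟨hH1, hH2⟩ := hH
  rw [Nat.ceil_natCast] at hH1 hH2
  have h2r : (2 : ℝ) ^ r ≤ 32 * rateLevelProduct d k r C ε δ :=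
    two_pow_le_rate hC hκ hL' (by rw [← hX]; linarith)
  rw [softO, hX] at hn
  rw [hX] at h2r hX0
  obtain ⟨err, h1, h2⟩ := level_product_bound (by omega) hK2 hC hr (by positivity) hL hLL'
    (one_le_logb_two_add hX0.le) (le_four_mul_logb h2r) hn hH2
  obtain ⟨R, hR, hdep, hirr⟩ := hDx.exists_relevant (hs i)
  exact (levelSplits_risk_le_of_relevant hlab hd0 pointMass_nonneg (fun x => hm x i) hB
    ((hV i).exists_gain (fun x => hm x i) (hs i) hr hC) hdep hirr (hR.trans_le hH1) hdisc h1).trans h2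

theorem breiman_product (hM : 10000 ≤ M) (hK : (M : ℝ) ^ (M + 3) ≤ K) (hr : 1 ≤ r) (hC : 1 ≤ C)
    (hε : 0 < ε) (hδ : 0 < δ) (hd : 2 * δ ≤ d) (hm : ∀ x i, m x i ∈ Set.Icc (0 : ℝ) 1)
    (hE : IsBoundedCenteredNoise E) (hs : ∀ i, IsSparse r fun x => m x i)
    (hV : ∀ i, ApproxDiminishingReturns C (fun x => m x i) Dx) (hDx : IsProductLaw Dx)
    (hn : softO K 4 (rateBreimanProduct d k r C ε δ) ≤ n) {t : ℕ}
    (ht : IsLeafBudget K r d k n r C ε δ t) :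
    sampleLaw m Dx E n {ω | ε < risk m Dx (breimanEstimate t ω)} ≤ ENNReal.ofReal δ := by
  refine measure_breiman_risk_gt_le hm hE hε hδ hd t fun hk hκ => ?_
  have hM' : (10000 : ℝ) ≤ M := by exact_mod_cast hM
  have hr' : (1 : ℝ) ≤ r := by exact_mod_cast hr
  have hk' : (0 : ℝ) < k := by exact_mod_cast hk
  have hK0 : 0 < K := lt_of_lt_of_le (by positivity) hK
  have hK2 : (M : ℝ) ^ 2 ≤ K :=
    (pow_le_pow_right₀ (by linarith) (by omega : 2 ≤ M + 3)).trans hK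
  have hL := one_le_logb_div hδ hd
  have hLL' := logb_div_le_logb_mul_div hδ hd hk
  have hL' := hL.trans hLL'
  have hd0 : 0 < d := by
    have : (0 : ℝ) < d := by linarith
    exact_mod_cast this
  have hX : rateBreimanProduct d k r C ε δ =
      Real.logb 2 (d * k / δ) * (k / ε) ^ 3 * C ^ 2 * 2 ^ r := by
    rw [rateBreimanProduct]; ring
  have hX0 : 0 < rateBreimanProduct d k r C ε δ := by rw [hX]; positivity
  have hn0 := pos_of_softO_le hK0 hX0 hn
  refine ⟨hn0, fun i D hD hlab hdisc => ?_⟩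
  have hB : 1 ≤ C * r := one_le_mul_of_one_le_of_one_le hC hr'
  obtain ⟨ht1, hqt, ht⟩ := ht
  have h2r : (2 : ℝ) ^ r ≤ 32 * rateBreimanProduct d k r C ε δ := by
    refine two_pow_le_rate hC hκ hL' ?_
    rw [hX]
    have h3 : 0 ≤ Real.logb 2 (d * k / δ) * 2 ^ r * (C * (k / ε)) ^ 2 := by positivity
    calc Real.logb 2 (d * k / δ) * 2 ^ r * (C * (k / ε)) ^ 2
        ≤ Real.logb 2 (d * k / δ) * 2 ^ r * (C * (k / ε)) ^ 2 * (8 * (k / ε)) :=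
          le_mul_of_one_le_right h3 (by linarith)
      _ = _ := by ring
  rw [softO, hX] at hn
  rw [hX] at h2r hX0
  have h1 := breiman_product_bound (t := t) (by omega) hK2 hC hr hκ hL hLL'
    (one_le_logb_two_add hX0.le) (le_four_mul_logb h2r) hn
    (ht.trans (max_le_max_left _ ((min_le_right _ _).trans (le_of_eq (by field_simp)))))
  obtain ⟨R, hR, hdep, hirr⟩ := hDx.exists_relevant (hs i)
  have hRt : 2 ^ R.card ≤ t := by
    rw [hR]
    rw [Real.le_logb_iff_rpow_le (by norm_num) (by exact_mod_cast ht1), Real.rpow_natCast] at hqt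
    exact_mod_cast hqt
  have h2 := breiman_risk_le_of_relevant hlab hd0 pointMass_nonneg (fun x => hm x i) hB
    ((hV i).exists_gain (fun x => hm x i) (hs i) hr hC) hdep hirr (leafDev_mono (by linarith)) hRt hdisc
  rw [hD, hR] at h2
  exact h2.trans h1

end

/-! ### Step counts -/

section

variable {α β : Type} {d : ℕ}

@[simp] lemma Timed.steps_bind (u : Timed α) (f : α → Timed β) :
    (u >>= f).steps = u.steps + (f u.val).steps := rfl

@[simp] lemma Timed.steps_op (a : α) : (op a).steps = 1 := rfl

@[simp] lemma Timed.steps_charge (c : ℕ) (a : α) : (charge c a).steps = c := rfl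

lemma sumCount_steps (D : List (Sample d)) : (sumCount D).steps = 2 * D.length + 1 := by
  induction D with
  | nil => rfl
  | cons s D ih => simp only [sumCount, steps_bind, steps_charge, ih, List.length_cons]; ring

lemma meanLabel_steps (D : List (Sample d)) : (meanLabel D).steps = 2 * D.length + 2 := by
  simp [meanLabel, sumCount_steps]

lemma splitOn_steps (i : Fin d) (D : List (Sample d)) : (splitOn i D).steps = 2 * D.length + 1 := by
  induction D with
  | nil => rfl
  | cons s D ih =>
    simp only [splitOn, steps_bind, ih, List.length_cons]
    split_ifs <;> simp only [steps_charge] <;> ring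

lemma splitOn_length (i : Fin d) (D : List (Sample d)) :
    (splitOn i D).val.1.length + (splitOn i D).val.2.length = D.length := by
  induction D with
  | nil => rfl
  | cons s D ih =>
    simp only [splitOn, val_bind, List.length_cons]
    split_ifs <;> simp only [val_charge, List.length_cons] <;> omega

lemma scanMax_steps_le {score : Fin d → Timed ℝ} {c : ℕ} (hc : ∀ i, (score i).steps ≤ c)
    (I : List (Fin d)) : (scanMax score I).steps ≤ I.length * (c + 1) + 1 := by
  induction I with
  | nil => simp [scanMax]
  | cons i I ih =>
    have h : (scanMax score (i :: I)).steps ≤ (score i).steps + ((scanMax score I).steps + 1) := by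
      simp only [scanMax, steps_bind]
      gcongr
      rcases (scanMax score I).val with - | ⟨j, w⟩
      · simp
      · dsimp only; split_ifs <;> simp
    have := hc i
    rw [List.length_cons, add_mul, one_mul]
    omega

/-! #### Level-Splits -/

lemma agrees_steps_le (S : List (Fin d)) (x z : Point d) : (agrees S x z).steps ≤ 2 * S.length + 1 := by
  induction S with
  | nil => simp [agrees]
  | cons i S ih =>
    have h : (agrees (i :: S) x z).steps =
        1 + (if x i == z i then agrees S x z else op false).steps := rfl
    rw [h, List.length_cons]
    split_ifs
    · omega
    · rw [steps_op]; omega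

lemma samplesAgreeing_length_le (S : List (Fin d)) (x : Point d) (D : List (Sample d)) :
    (samplesAgreeing S x D).val.length ≤ D.length := by
  induction D with
  | nil => simp [samplesAgreeing]
  | cons s D ih =>
    simp only [samplesAgreeing, val_bind, List.length_cons]
    split_ifs <;> simp only [val_op, List.length_cons] <;> omega

lemma samplesAgreeing_steps_le (S : List (Fin d)) (x : Point d) (D : List (Sample d)) :
    (samplesAgreeing S x D).steps ≤ D.length * (2 * S.length + 2) + 1 := by
  induction D with
  | nil => simp [samplesAgreeing]
  | cons s D ih =>
    have := agrees_steps_le S x s.1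
    simp only [samplesAgreeing, steps_bind, List.length_cons, add_mul, one_mul]
    split_ifs <;> simp only [steps_op] <;> omega

lemma sumSqFit_steps_le (S : List (Fin d)) (D E : List (Sample d)) :
    (sumSqFit S D E).steps ≤ E.length * (D.length * (2 * S.length + 4) + 5) + 1 := by
  induction E with
  | nil => simp [sumSqFit]
  | cons s E ih =>
    have h1 := samplesAgreeing_steps_le S s.1 D
    have h2 := samplesAgreeing_length_le S s.1 D
    simp only [sumSqFit, steps_bind, steps_charge, meanLabel_steps, List.length_cons, add_mul, one_mul]
    have h3 : D.length * (2 * S.length + 4) = D.length * (2 * S.length + 2) + 2 * D.length := by ring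
    omega

lemma empV_steps_le (S : List (Fin d)) (D : List (Sample d)) :
    (empV S D).steps ≤ D.length * (D.length * (2 * S.length + 4) + 5) + 1 + (D.length + 1) := by
  simp only [empV, steps_bind, steps_charge]
  gcongr
  exact sumSqFit_steps_le S D D

/-- Each level evaluates the criterion once for every direction. -/
lemma greedySplits_steps_le {D : List (Sample d)} {N c : ℕ}
    (hc : ∀ S : List (Fin d), S.length ≤ N → (empV S D).steps ≤ c) (H : ℕ) :
    ∀ S : List (Fin d), S.length + H ≤ N →
      (greedySplits D H S).steps ≤ H * (d * (c + 1) + N + 2) + 1 ∧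
        (greedySplits D H S).val.length ≤ N := by
  induction H with
  | zero => intro S hS; simpa [greedySplits] using hS
  | succ H ih =>
    intro S hS
    have h1 := scanMax_steps_le (score := fun i => empV (i :: S) D) (c := c)
      (fun i => hc _ (by simp; omega)) (List.finRange d)
    rw [List.length_finRange] at h1
    simp only [greedySplits, steps_bind, val_bind]
    rcases (scanMax (fun i => empV (i :: S) D) (List.finRange d)).val with - | ⟨i, v⟩
    · simp only [steps_op, val_op, add_mul, one_mul]
      omega
    · obtain ⟨h2, h3⟩ := ih (S ++ [i]) (by simp; omega)
      simp only [steps_bind, val_bind, steps_charge, val_charge, add_mul, one_mul]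
      omega

/-- A level costs time linear in the number of samples; a cell without samples is never split. -/
lemma levelTree_steps_le (S : List (Fin d)) (D : List (Sample d)) :
    (levelTree S D).steps ≤ if D = [] then 3 * (S.length + 1) else 6 * (S.length + 1) * D.length := by
  induction S generalizing D with
  | nil =>
    simp only [levelTree, steps_bind, steps_op, meanLabel_steps, List.length_nil]
    split_ifs with h
    · simp [h]
    · have := List.length_pos_iff.2 h
      omega
  | cons i S ih =>
    have hstep : (levelTree (i :: S) D).steps = (splitOn i D).steps + (2 +
        (if (splitOn i D).val.1.isEmpty || (splitOn i D).val.2.isEmpty then levelTree S D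
          else do
            let l ← levelTree S (splitOn i D).val.1
            let r ← levelTree S (splitOn i D).val.2
            op (DTree.node i l r)).steps) := rfl
    rw [hstep, splitOn_steps, List.length_cons]
    have hlen := splitOn_length i D
    by_cases hb : ((splitOn i D).val.1.isEmpty || (splitOn i D).val.2.isEmpty) = true
    · rw [if_pos hb]
      have h1 := ih D
      by_cases h : D = []
      · rw [if_pos h] at h1 ⊢
        subst h
        simp only [List.length_nil]
        omega
      · rw [if_neg h] at h1 ⊢
        have := List.length_pos_iff.2 h
        calc _ ≤ 6 * D.length + 6 * (S.length + 1) * D.length := by omega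
          _ = _ := by ring
    · rw [if_neg hb]
      simp only [Bool.or_eq_true, List.isEmpty_iff, not_or] at hb
      have h1 := ih (splitOn i D).val.1
      have h2 := ih (splitOn i D).val.2
      have h3 := List.length_pos_iff.2 hb.1
      rw [if_neg hb.1] at h1
      rw [if_neg hb.2] at h2
      have h : D ≠ [] := by rintro rfl; rw [List.length_nil] at hlen; omega
      rw [if_neg h]
      simp only [steps_bind, steps_op]
      calc _ ≤ 6 * D.length + (6 * (S.length + 1) * (splitOn i D).val.1.length +
            6 * (S.length + 1) * (splitOn i D).val.2.length) := by omega
        _ = 6 * (S.length + 1 + 1) * D.length := by rw [← mul_add, hlen]; ring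

lemma levelSplits_steps_le {D : List (Sample d)} {H N : ℕ} (hN : 1 ≤ N) (hd : d ≤ N)
    (hD : D.length ≤ N) (hH : H ≤ N) : (levelSplits D H).steps ≤ 60 * N ^ 5 := by
  have hc : ∀ S : List (Fin d), S.length ≤ N → (empV S D).steps ≤ 14 * N ^ 3 := by
    intro S hS
    calc _ ≤ _ := empV_steps_le S D
      _ ≤ N * (N * (2 * N + 4) + 5) + 1 + (N + 1) := by gcongr
      _ = 2 * N ^ 3 + 4 * N ^ 2 + 6 * N ^ 1 + 2 * 1 ^ 3 := by ring
      _ ≤ 2 * N ^ 3 + 4 * N ^ 3 + 6 * N ^ 3 + 2 * N ^ 3 := by gcongr <;> norm_num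
      _ = _ := by ring
  obtain ⟨h1, h2⟩ := greedySplits_steps_le hc H [] (by simpa using hH)
  have h3 := levelTree_steps_le (greedySplits D H []).val D
  have h4 : (levelTree (greedySplits D H []).val D).steps ≤ 24 * N ^ 5 := by
    have h5 : (greedySplits D H []).val.length + 1 ≤ 2 * N := by omega
    split_ifs at h3
    · calc _ ≤ _ := h3
        _ ≤ 3 * (2 * N) := by gcongr
        _ = 6 * N ^ 1 := by ring
        _ ≤ 24 * N ^ 5 := by gcongr <;> norm_num
    · calc _ ≤ _ := h3
        _ ≤ 6 * (2 * N) * N := by gcongr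
        _ = 12 * N ^ 2 := by ring
        _ ≤ 24 * N ^ 5 := by gcongr <;> norm_num
  have h5 : H * (d * (14 * N ^ 3 + 1) + N + 2) + 1 ≤ 20 * N ^ 5 := by
    calc _ ≤ N * (N * (14 * N ^ 3 + 1) + N + 2) + 1 := by gcongr
      _ = 14 * N ^ 5 + 2 * N ^ 2 + 2 * N ^ 1 + 1 ^ 5 := by ring
      _ ≤ 14 * N ^ 5 + 2 * N ^ 5 + 2 * N ^ 5 + N ^ 5 := by gcongr <;> norm_num
      _ ≤ 20 * N ^ 5 := by omega
  have h6 : 1 ≤ N ^ 5 := Nat.one_le_pow _ _ hN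
  simp only [levelSplits, steps_bind, steps_op]
  omega

/-! #### Breiman -/

lemma localV_steps (A : List (Sample d)) (i : Fin d) : (localV A i).steps = 4 * A.length + 13 := by
  have := splitOn_length i A
  simp only [localV, steps_bind, steps_charge, splitOn_steps, sumCount_steps]
  omega

/-- The number of samples in the leaves of a tree. -/
def DTree.numSamples : DTree d (List (Sample d)) → ℕ
  | .leaf A => A.length
  | .node _ l r => l.numSamples + r.numSamples

/-- A round costs at most a multiple of `d` for every sample and every leaf. It keeps the samples, and each cut
adds one leaf. -/
lemma breimanLevel_steps_le (T : DTree d (List (Sample d))) : ∀ b,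
    (breimanLevel T b).steps + 1 ≤ (4 * d + 2) * T.numSamples + (14 * d + 8) * T.leaves ∧
      (breimanLevel T b).val.1.numSamples = T.numSamples ∧
      (breimanLevel T b).val.1.leaves + (breimanLevel T b).val.2 = T.leaves + b := by
  induction T with
  | leaf A =>
    intro b
    have h1 := scanMax_steps_le (score := localV A) (fun i => (localV_steps A i).le) (List.finRange d)
    rw [List.length_finRange] at h1
    have h2 : (4 * d + 2) * A.length + (14 * d + 8) * 1 =
        d * (4 * A.length + 13 + 1) + 2 * A.length + 8 := by ring
    set X : Timed (DTree d (List (Sample d)) × ℕ) :=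
      if decide (2 ≤ A.length) && decide (0 < b) then do
        let o ← scanMax (localV A) (List.finRange d)
        match o with
        | none => op (DTree.leaf A, b)
        | some (i, _) => do
            let q ← splitOn i A
            charge 2 (DTree.node i (DTree.leaf q.1) (DTree.leaf q.2), b - 1)
      else op (DTree.leaf A, b) with hX
    have h3 : breimanLevel (.leaf A) b = ⟨X.val, 3 + X.steps⟩ := rfl
    simp only [h3, DTree.numSamples, DTree.leaves, h2]
    split_ifs at hX with hc
    · simp only [Bool.and_eq_true, decide_eq_true_eq] at hc
      rw [hX]
      simp only [steps_bind, val_bind]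
      rcases (scanMax (localV A) (List.finRange d)).val with - | ⟨i, v⟩
      · simp only [steps_op, val_op, DTree.numSamples, DTree.leaves, and_true]
        omega
      · have := splitOn_length i A
        simp only [steps_bind, val_bind, steps_charge, val_charge, splitOn_steps, DTree.numSamples,
          DTree.leaves]
        omega
    · rw [hX]
      simp only [steps_op, val_op, DTree.numSamples, DTree.leaves, and_true]
      omega
  | node i l r hl hr =>
    intro b
    obtain ⟨l1, l2, l3⟩ := hl b
    obtain ⟨r1, r2, r3⟩ := hr (breimanLevel l b).val.2
    simp only [breimanLevel, steps_bind, val_bind, steps_op, val_op, DTree.numSamples, DTree.leaves,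
      mul_add]
    omega

lemma breimanGrow_steps_le (L : ℕ) : ∀ (T : DTree d (List (Sample d))) (b : ℕ),
    (breimanGrow L T b).steps ≤
        L * ((4 * d + 2) * T.numSamples + (14 * d + 8) * (T.leaves + b)) + 1 ∧
      (breimanGrow L T b).val.numSamples = T.numSamples ∧
      (breimanGrow L T b).val.leaves ≤ T.leaves + b := by
  induction L with
  | zero => intro T b; simp [breimanGrow]
  | succ L ih =>
    intro T b
    obtain ⟨h1, h2, h3⟩ := breimanLevel_steps_le T b
    obtain ⟨g1, g2, g3⟩ := ih (breimanLevel T b).val.1 (breimanLevel T b).val.2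
    rw [h2, h3] at g1
    rw [h2] at g2
    rw [h3] at g3
    have h4 : (14 * d + 8) * T.leaves ≤ (14 * d + 8) * (T.leaves + b) := by gcongr; omega
    simp only [breimanGrow, steps_bind, val_bind]
    refine ⟨?_, g2, g3⟩
    rw [add_mul L, one_mul]
    omega

lemma fitLeaves_steps_le (T : DTree d (List (Sample d))) :
    (fitLeaves T).steps + 1 ≤ 2 * T.numSamples + 4 * T.leaves := by
  induction T with
  | leaf A =>
    simp only [fitLeaves, steps_bind, steps_op, meanLabel_steps, DTree.numSamples, DTree.leaves]
    omega
  | node i l r hl hr =>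
    simp only [fitLeaves, steps_bind, steps_op, DTree.numSamples, DTree.leaves]
    omega

lemma breiman_steps_le {D : List (Sample d)} {t N : ℕ} (hN : 1 ≤ N) (hd : d ≤ N)
    (hD : D.length ≤ N) (ht : t ≤ N) : (breiman D t).steps ≤ 60 * N ^ 5 := by
  obtain ⟨h1, h2, h3⟩ := breimanGrow_steps_le t (.leaf D) (t - 1)
  have h4 := fitLeaves_steps_le (breimanGrow t (.leaf D) (t - 1)).val
  simp only [DTree.numSamples, DTree.leaves] at h1 h2 h3
  have h5 : 1 + (t - 1) ≤ N := by omega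
  have h6 : t * ((4 * d + 2) * D.length + (14 * d + 8) * (1 + (t - 1))) + 1 ≤ 29 * N ^ 5 := by
    calc _ ≤ N * ((4 * N + 2) * N + (14 * N + 8) * N) + 1 := by gcongr
      _ = 18 * N ^ 3 + 10 * N ^ 2 + 1 ^ 5 := by ring
      _ ≤ 18 * N ^ 5 + 10 * N ^ 5 + N ^ 5 := by gcongr <;> norm_num
      _ = _ := by ring
  have h7 : N ≤ N ^ 5 := Nat.le_self_pow (by norm_num) N
  have h8 : (breimanGrow t (.leaf D) (t - 1)).val.leaves ≤ N := h3.trans h5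
  simp only [breiman, steps_bind]
  omega

/-! #### Score learning -/

variable {k n N : ℕ}

lemma forAll_coordData_steps_le {α : Type} (hN : 1 ≤ N) (hd : d ≤ N) (hk : k ≤ N) (hn : n ≤ N)
    (ω : ScoreData d k n) {f : List (Sample d) → Timed α}
    (hf : ∀ D : List (Sample d), D.length = n → (f D).steps ≤ 60 * N ^ 5) :
    (forAll fun i : Fin k => do
      let D ← coordData ω i
      f D).steps ≤ 64 * N ^ 6 := by
  have h1 : ∀ i : Fin k, (coordData ω i >>= f).steps + 1 ≤ 64 * N ^ 5 := by
    intro i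
    have h2 := hf (coordData ω i).val (by simp [coordData, charge])
    have h3 : n * (d + 2) + 1 ≤ 4 * N ^ 5 := by
      calc _ ≤ N * (N + 2) + 1 := by gcongr
        _ = N ^ 2 + 2 * N ^ 1 + 1 ^ 5 := by ring
        _ ≤ N ^ 5 + 2 * N ^ 5 + N ^ 5 := by gcongr <;> norm_num
        _ = _ := by ring
    have h4 : (coordData ω i).steps = n * (d + 2) := rfl
    rw [steps_bind]
    omega
  calc (∑ i, ((coordData ω i >>= f).steps + 1)) ≤ ∑ _i : Fin k, 64 * N ^ 5 :=
        Finset.sum_le_sum fun i _ => h1 i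
    _ = k * (64 * N ^ 5) := by simp
    _ ≤ N * (64 * N ^ 5) := by gcongr
    _ = 64 * N ^ 6 := by ring

lemma learnLevelSplits_steps_le {H : ℕ} (hN : 1 ≤ N) (hd : d ≤ N) (hk : k ≤ N) (hn : n ≤ N) (hH : H ≤ N)
    (ω : ScoreData d k n) : (learnLevelSplits H ω).steps ≤ 64 * N ^ 6 :=
  forAll_coordData_steps_le hN hd hk hn ω
    fun _ hD => levelSplits_steps_le hN hd (hD.trans_le hn) hH

lemma learnBreiman_steps_le {t : ℕ} (hN : 1 ≤ N) (hd : d ≤ N) (hk : k ≤ N) (hn : n ≤ N) (ht : t ≤ N)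
    (ω : ScoreData d k n) : (learnBreiman t ω).steps ≤ 64 * N ^ 6 :=
  forAll_coordData_steps_le hN hd hk hn ω
    fun _ hD => breiman_steps_le hN hd (hD.trans_le hn) ht

end

/-! ### Polynomial bounds -/

section

lemma mul_pow_le_mul_pow_of_le {a b : ℕ} (h : a ≤ b) {Z : ℝ} (hZ : 1 ≤ Z) :
    (a : ℝ) * Z ^ a ≤ b * Z ^ b := by
  have : (a : ℝ) ≤ b := by exact_mod_cast h
  have h2 : Z ^ a ≤ Z ^ b := pow_le_pow_right₀ hZ h
  gcongr

lemma logb_two_le {x : ℝ} (hx : 0 < x) : Real.logb 2 x ≤ x := by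
  have h1 := Real.log_le_sub_one_of_pos (by positivity : 0 < x / 2)
  rw [Real.log_div hx.ne' two_ne_zero] at h1
  have h2 := Real.log_two_gt_d9
  have h3 := Real.log_two_lt_d9
  rw [Real.logb, div_le_iff₀ (by linarith)]
  nlinarith

/-- If `X` is polynomial in `Z`, then so is every fixed power of the sample size `Õ(X)`. -/
lemma exists_pow_sampleSize_le {K : ℝ} (hK : 0 ≤ K) (p c q A : ℕ) : ∃ a : ℕ,
    ∀ (d k : ℕ) (Z X : ℝ), 1 ≤ Z → d ≤ Z → k ≤ Z → 0 ≤ X → X ≤ A * Z ^ A →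
      (c * (d + k + 2 * (⌈softO K p X⌉₊ : ℝ) + c) ^ q : ℝ) ≤ a * Z ^ a := by
  set G : ℝ := K * (2 + A) ^ (p + 1) with hG
  have hG0 : 0 ≤ G := by positivity
  set w : ℕ := A * (p + 1) + 1 with hw
  set G' : ℝ := 2 + 2 * (G + 1) + c
  refine ⟨⌈c * G' ^ q⌉₊ + w * q, fun d k Z X hZ hd hk hX hXA => ?_⟩
  have h1 : softO K p X ≤ G * Z ^ w := by
    have h2 : Real.logb 2 (2 + X) ≤ 2 + X := logb_two_le (by linarith)
    have h3 : 0 ≤ Real.logb 2 (2 + X) := Real.logb_nonneg (by norm_num) (by linarith)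
    have hZA : 1 ≤ Z ^ A := one_le_pow₀ hZ
    calc softO K p X = K * X * Real.logb 2 (2 + X) ^ p := rfl
      _ ≤ K * (2 + X) * (2 + X) ^ p := by gcongr; linarith
      _ = K * (2 + X) ^ (p + 1) := by ring
      _ ≤ K * ((2 + A) * Z ^ A) ^ (p + 1) := by gcongr; nlinarith
      _ = G * Z ^ (A * (p + 1)) := by rw [hG, mul_pow, pow_mul]; ring
      _ ≤ G * Z ^ w := by gcongr; omega
  have hZw : Z ≤ Z ^ w := le_self_pow₀ hZ (by omega)
  have hn : (⌈softO K p X⌉₊ : ℝ) ≤ G * Z ^ w + 1 := by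
    rcases le_total (softO K p X) 0 with h | h
    · rw [Nat.ceil_eq_zero.2 h]
      push_cast
      positivity
    · linarith [(Nat.ceil_lt_add_one h).le]
  have hN : d + k + 2 * (⌈softO K p X⌉₊ : ℝ) + c ≤ G' * Z ^ w := by
    have h4 : 1 ≤ Z ^ w := hZ.trans hZw
    have h5 : (c : ℝ) ≤ c * Z ^ w := le_mul_of_one_le_right (by positivity) h4
    simp only [G']
    linarith
  calc (c * (d + k + 2 * (⌈softO K p X⌉₊ : ℝ) + c) ^ q : ℝ) ≤ c * (G' * Z ^ w) ^ q := by gcongr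
    _ = c * G' ^ q * Z ^ (w * q) := by rw [mul_pow, ← pow_mul]; ring
    _ ≤ _ := by
      gcongr
      · push_cast
        linarith [Nat.le_ceil ((c : ℝ) * G' ^ q), (by positivity : (0 : ℝ) ≤ w * q)]
      · omega

variable {d k n r : ℕ} {C ε δ K : ℝ}

lemma logb_mul_div_le (hd : 2 * δ ≤ d) (hδ : 0 < δ) (hε : 0 < ε) (hk : 1 ≤ k) :
    Real.logb 2 (d * k / δ) ≤ d + k + 1 / ε + Real.logb 2 (2 + 1 / δ) := by
  have hd0 : (0 : ℝ) < d := by linarith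
  have hk0 : (0 : ℝ) < k := by exact_mod_cast hk
  have h1 : Real.logb 2 (1 / δ) ≤ Real.logb 2 (2 + 1 / δ) :=
    Real.logb_le_logb_of_le (by norm_num) (by positivity) (by linarith)
  rw [div_eq_mul_one_div, Real.logb_mul (by positivity) (by positivity),
    Real.logb_mul hd0.ne' hk0.ne']
  have h2 : 0 < 1 / ε := by positivity
  linarith [logb_two_le hd0, logb_two_le hk0]

lemma one_le_size (hδ : 0 < δ) (hε : 0 < ε) : 1 ≤ (d : ℝ) + k + 1 / ε + Real.logb 2 (2 + 1 / δ) := by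
  have h1 := one_le_logb_two_add (X := 1 / δ) (by positivity)
  have h2 : 0 < 1 / ε := by positivity
  have h3 : (0 : ℝ) ≤ d + k := by positivity
  linarith

lemma le_size (hδ : 0 < δ) (hε : 0 < ε) :
    (d : ℝ) ≤ (d : ℝ) + k + 1 / ε + Real.logb 2 (2 + 1 / δ) ∧
    (k : ℝ) ≤ (d : ℝ) + k + 1 / ε + Real.logb 2 (2 + 1 / δ) ∧
    1 / ε ≤ (d : ℝ) + k + 1 / ε + Real.logb 2 (2 + 1 / δ) := by
  have h1 := one_le_logb_two_add (X := 1 / δ) (by positivity)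
  have h2 : 0 < 1 / ε := by positivity
  have h3 : (0 : ℝ) ≤ d := by positivity
  have h4 : (0 : ℝ) ≤ k := by positivity
  refine ⟨?_, ?_, ?_⟩ <;> linarith

/-- A product of a constant and a power is at most polynomial. -/
lemma exists_const_mul_rpow_le (c w : ℝ) :
    ∃ A : ℕ, ∀ Z : ℝ, 1 ≤ Z → c * Z ^ w ≤ A * Z ^ A := by
  refine ⟨⌈c⌉₊ + ⌈w⌉₊, fun Z hZ => ?_⟩
  have h1 : c ≤ ((⌈c⌉₊ + ⌈w⌉₊ : ℕ) : ℝ) := by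
    push_cast
    linarith [Nat.le_ceil c, (Nat.cast_nonneg ⌈w⌉₊ : (0 : ℝ) ≤ _)]
  have h2 : w ≤ ((⌈c⌉₊ + ⌈w⌉₊ : ℕ) : ℝ) := by
    push_cast
    linarith [Nat.le_ceil w, (Nat.cast_nonneg ⌈c⌉₊ : (0 : ℝ) ≤ _)]
  have h3 : Z ^ w ≤ Z ^ (⌈c⌉₊ + ⌈w⌉₊) := by
    rw [← Real.rpow_natCast]
    exact Real.rpow_le_rpow_of_exponent_le hZ h2
  have h4 : 0 ≤ Z ^ w := by positivity
  exact mul_le_mul h1 h3 h4 (Nat.cast_nonneg _)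

lemma exists_rateGeneral_le (r : ℕ) (C : ℝ) {e : ℝ} (hr : 1 ≤ r) (hC : 1 ≤ C) (he : 0 ≤ e) :
    ∃ A : ℕ, ∀ (d k : ℕ) (ε δ : ℝ), 0 < ε → 0 < δ → 2 * δ ≤ d →
      0 ≤ rateGeneral e d k r C ε δ ∧ rateGeneral e d k r C ε δ ≤
        A * ((d : ℝ) + k + 1 / ε + Real.logb 2 (2 + 1 / δ)) ^ A := by
  have hr' : (1 : ℝ) ≤ r := by exact_mod_cast hr
  have hB : 1 ≤ C * r := one_le_mul_of_one_le_of_one_le hC hr'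
  set w := C * r + e
  have hw : 0 < w := by positivity
  obtain ⟨A, hA⟩ := exists_const_mul_rpow_le ((C * r) ^ w) (1 + w + w)
  refine ⟨A, fun d k ε δ hε hδ hd => ?_⟩
  rcases Nat.eq_zero_or_pos k with rfl | hk
  · have h0 : rateGeneral e d 0 r C ε δ = 0 := by simp [rateGeneral]
    rw [h0]
    have h1 : 1 ≤ (d : ℝ) + (0 : ℕ) + 1 / ε + Real.logb 2 (2 + 1 / δ) := one_le_size hδ hε
    exact ⟨le_rfl, by positivity⟩
  have hL' := (one_le_logb_div hδ hd).trans (logb_div_le_logb_mul_div hδ hd hk)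
  refine ⟨by rw [rateGeneral]; positivity, ?_⟩
  refine le_trans ?_ (hA _ (one_le_size hδ hε))
  have h1 := logb_mul_div_le hd hδ hε hk
  obtain ⟨-, h2, h3⟩ := le_size (d := d) (k := k) hδ hε
  have h4 := one_le_size (d := d) (k := k) hδ hε
  set Z := (d : ℝ) + k + 1 / ε + Real.logb 2 (2 + 1 / δ)
  calc rateGeneral e d k r C ε δ
      = Real.logb 2 (d * k / δ) * (k : ℝ) ^ w * (C * r * (1 / ε)) ^ w := by
        rw [rateGeneral, mul_one_div]
    _ ≤ Z * Z ^ w * (C * r * Z) ^ w := by gcongr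
    _ = (C * r) ^ w * Z ^ (1 + w + w) := by
        have hZ : 0 < Z := by linarith
        rw [Real.rpow_add hZ (1 + w) w, Real.rpow_add hZ 1 w, Real.rpow_one, Real.mul_rpow (by positivity) hZ.le]
        ring

lemma exists_rateLevelProduct_le (r : ℕ) {C : ℝ} (hC : 1 ≤ C) :
    ∃ A : ℕ, ∀ (d k : ℕ) (ε δ : ℝ), 0 < ε → 0 < δ → 2 * δ ≤ d →
      0 ≤ rateLevelProduct d k r C ε δ ∧ rateLevelProduct d k r C ε δ ≤
        A * ((d : ℝ) + k + 1 / ε + Real.logb 2 (2 + 1 / δ)) ^ A := by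
  obtain ⟨A, hA⟩ := exists_const_mul_rpow_le (2 ^ r * C ^ 2) (5 : ℕ)
  refine ⟨A, fun d k ε δ hε hδ hd => ?_⟩
  rcases Nat.eq_zero_or_pos k with rfl | hk
  · have h0 : rateLevelProduct d 0 r C ε δ = 0 := by simp [rateLevelProduct]
    rw [h0]
    have h1 : 1 ≤ (d : ℝ) + (0 : ℕ) + 1 / ε + Real.logb 2 (2 + 1 / δ) := one_le_size hδ hε
    exact ⟨le_rfl, by positivity⟩
  have hL' := (one_le_logb_div hδ hd).trans (logb_div_le_logb_mul_div hδ hd hk)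
  refine ⟨by rw [rateLevelProduct]; positivity, ?_⟩
  refine le_trans ?_ (hA _ (one_le_size hδ hε))
  have h1 := logb_mul_div_le hd hδ hε hk
  obtain ⟨-, h2, h3⟩ := le_size (d := d) (k := k) hδ hε
  have h4 := one_le_size (d := d) (k := k) hδ hε
  set Z := (d : ℝ) + k + 1 / ε + Real.logb 2 (2 + 1 / δ)
  rw [Real.rpow_natCast]
  calc rateLevelProduct d k r C ε δ
      = Real.logb 2 (d * k / δ) * 2 ^ r * (k : ℝ) ^ 2 * (C * (1 / ε)) ^ 2 := by
        rw [rateLevelProduct, mul_one_div]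
    _ ≤ Z * 2 ^ r * Z ^ 2 * (C * Z) ^ 2 := by gcongr
    _ = 2 ^ r * C ^ 2 * Z ^ 5 := by ring

lemma exists_rateBreimanProduct_le (r : ℕ) {C : ℝ} (hC : 1 ≤ C) :
    ∃ A : ℕ, ∀ (d k : ℕ) (ε δ : ℝ), 0 < ε → 0 < δ → 2 * δ ≤ d →
      0 ≤ rateBreimanProduct d k r C ε δ ∧ rateBreimanProduct d k r C ε δ ≤
        A * ((d : ℝ) + k + 1 / ε + Real.logb 2 (2 + 1 / δ)) ^ A := by
  obtain ⟨A, hA⟩ := exists_const_mul_rpow_le (2 ^ r * C ^ 2) (7 : ℕ)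
  refine ⟨A, fun d k ε δ hε hδ hd => ?_⟩
  rcases Nat.eq_zero_or_pos k with rfl | hk
  · have h0 : rateBreimanProduct d 0 r C ε δ = 0 := by simp [rateBreimanProduct]
    rw [h0]
    have h1 : 1 ≤ (d : ℝ) + (0 : ℕ) + 1 / ε + Real.logb 2 (2 + 1 / δ) := one_le_size hδ hε
    exact ⟨le_rfl, by positivity⟩
  have hL' := (one_le_logb_div hδ hd).trans (logb_div_le_logb_mul_div hδ hd hk)
  refine ⟨by rw [rateBreimanProduct]; positivity, ?_⟩
  refine le_trans ?_ (hA _ (one_le_size hδ hε))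
  have h1 := logb_mul_div_le hd hδ hε hk
  obtain ⟨-, h2, h3⟩ := le_size (d := d) (k := k) hδ hε
  have h4 := one_le_size (d := d) (k := k) hδ hε
  set Z := (d : ℝ) + k + 1 / ε + Real.logb 2 (2 + 1 / δ)
  rw [Real.rpow_natCast]
  calc rateBreimanProduct d k r C ε δ
      = Real.logb 2 (d * k / δ) * (k : ℝ) ^ 3 * C ^ 2 * 2 ^ r * (1 / ε) ^ 3 := by
        rw [rateBreimanProduct]; ring
    _ ≤ Z * Z ^ 3 * C ^ 2 * 2 ^ r * Z ^ 3 := by gcongr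
    _ = 2 ^ r * C ^ 2 * Z ^ 7 := by ring

lemma logLeaves_le {e : ℝ} (hr : 1 ≤ r) (hC : 1 ≤ C) (he : 0 ≤ e) (hδ : 0 < δ) (hd : 2 * δ ≤ d) :
    logLeaves e d n r C δ ≤ Real.logb 2 n := by
  have hr' : (1 : ℝ) ≤ r := by exact_mod_cast hr
  have hB : 1 ≤ C * r := one_le_mul_of_one_le_of_one_le hC hr'
  have h1 : 0 ≤ Real.logb 2 (n : ℝ) := by
    rcases Nat.eq_zero_or_pos n with rfl | hn
    · simp
    · exact Real.logb_nonneg (by norm_num) (by exact_mod_cast hn)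
  have h2 := Real.logb_nonneg (b := 2) (by norm_num) (one_le_logb_div hδ hd)
  have h3 : 0 ≤ C * r / (C * r + e) := by positivity
  have h4 : C * r / (C * r + e) ≤ 1 := by rw [div_le_one (by linarith)]; linarith
  rw [logLeaves]
  calc _ ≤ C * r / (C * r + e) * Real.logb 2 n := by gcongr; linarith
    _ ≤ 1 * Real.logb 2 n := by gcongr
    _ = _ := one_mul _

lemma IsDepth.le_of_logLeaves {e : ℝ} (hr : 1 ≤ r) (hC : 1 ≤ C) (he : 0 ≤ e) (hδ : 0 < δ)
    (hd : 2 * δ ≤ d) {H : ℕ} (hH : IsDepth (logLeaves e d n r C δ) H) : H ≤ n + 1 := by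
  refine hH.2.trans (Nat.add_le_add_right (Nat.ceil_le.2 ?_) 1)
  refine (logLeaves_le hr hC he hδ hd).trans ?_
  rcases Nat.eq_zero_or_pos n with rfl | hn
  · simp
  · exact logb_two_le (by exact_mod_cast hn)

lemma IsLeafBudget.le_of_logLeaves {e : ℝ} (hr : 1 ≤ r) (hC : 1 ≤ C) (he : 0 ≤ e) (hδ : 0 < δ)
    (hd : 2 * δ ≤ d) {t : ℕ} (ht : IsLeafBudget K (logLeaves e d n r C δ) d k n r C ε δ t) :
    t ≤ 2 * n + 2 := by
  have h1 : (2 : ℝ) ^ logLeaves e d n r C δ ≤ n + 1 := by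
    calc (2 : ℝ) ^ logLeaves e d n r C δ ≤ 2 ^ Real.logb 2 (n : ℝ) :=
          Real.rpow_le_rpow_of_exponent_le (by norm_num) (logLeaves_le hr hC he hδ hd)
      _ ≤ n + 1 := by
          rcases Nat.eq_zero_or_pos n with rfl | hn
          · simp
          · rw [Real.rpow_logb (by norm_num) (by norm_num) (by exact_mod_cast hn)]
            linarith
  have h2 : (t : ℝ) ≤ 2 * n + 2 := by
    refine ht.2.2.trans (max_le (by linarith) ((min_le_left _ _).trans ?_))
    linarith [(Nat.cast_nonneg n : (0 : ℝ) ≤ n)]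
  exact_mod_cast h2

lemma IsLeafBudget.le_of_natCast {t : ℕ} (ht : IsLeafBudget K r d k n r C ε δ t) :
    t ≤ 2 * n + 2 ^ (r + 1) := by
  have h2 : (t : ℝ) ≤ 2 * n + 2 ^ (r + 1) := by
    have h3 : (0 : ℝ) ≤ 2 ^ r := by positivity
    have h4 : (2 : ℝ) ^ (r + 1) = 2 * 2 ^ r := by ring
    have h5 : (0 : ℝ) ≤ n := Nat.cast_nonneg n
    refine ht.2.2.trans (max_le ?_ ((min_le_left _ _).trans ?_))
    · rw [Real.rpow_natCast]; linarith
    · linarith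
  exact_mod_cast h2

/-- If the sample size is `Õ(X)` with `X` polynomial in the size of the problem, and the depth or the
number of leaves is linear in it, then the running time is polynomial. -/
lemma exists_steps_le {K : ℝ} (hK : 0 ≤ K) (p r : ℕ) {X : ℕ → ℕ → ℝ → ℝ → ℝ}
    (hX : ∃ A : ℕ, ∀ (d k : ℕ) (ε δ : ℝ), 0 < ε → 0 < δ → 2 * δ ≤ d → 0 ≤ X d k ε δ ∧
      X d k ε δ ≤ A * ((d : ℝ) + k + 1 / ε + Real.logb 2 (2 + 1 / δ)) ^ A) :
    ∃ a : ℕ, ∀ (d k n : ℕ) (ε δ : ℝ) (ω : ScoreData d k n), 0 < ε → 0 < δ → 2 * δ ≤ d →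
      n = ⌈softO K p (X d k ε δ)⌉₊ → ∀ s : ℕ, s ≤ 2 * n + 2 ^ (r + 1) →
        ((learnLevelSplits s ω).steps : ℝ) ≤
            a * (d + k + 1 / ε + Real.logb 2 (2 + 1 / δ)) ^ a ∧
          ((learnBreiman s ω).steps : ℝ) ≤
            a * (d + k + 1 / ε + Real.logb 2 (2 + 1 / δ)) ^ a := by
  obtain ⟨A, hA⟩ := hX
  obtain ⟨a, ha⟩ := exists_pow_sampleSize_le hK p (64 + 2 ^ (r + 1)) 6 A
  refine ⟨a, fun d k n ε δ ω hε hδ hd hn s hs => ?_⟩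
  obtain ⟨h1, h2⟩ := hA d k ε δ hε hδ hd
  obtain ⟨hdZ, hkZ, -⟩ := le_size (d := d) (k := k) hδ hε
  have h3 := ha d k _ _ (one_le_size hδ hε) hdZ hkZ h1 h2
  rw [← hn] at h3
  set N := d + k + 2 * n + (64 + 2 ^ (r + 1)) with hN
  have h4 : ((64 * N ^ 6 : ℕ) : ℝ) ≤ a * (d + k + 1 / ε + Real.logb 2 (2 + 1 / δ)) ^ a := by
    refine le_trans ?_ h3
    rw [hN]
    push_cast
    gcongr
    linarith [(by positivity : (0 : ℝ) ≤ 2 ^ (r + 1))]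
  have h5 : 0 < 2 ^ (r + 1) := by positivity
  constructor <;> refine le_trans (Nat.cast_le.2 ?_) h4
  · exact learnLevelSplits_steps_le (by omega) (by omega) (by omega) (by omega) (by omega) ω
  · exact learnBreiman_steps_le (by omega) (by omega) (by omega) (by omega) (by omega) ω

end

end

end ScoreTrees

theorem mainTheorem3 :
    ∃ (K : ℝ) (p : ℕ), 1 ≤ K ∧
      -- accuracy
      (∀ (d k n r : ℕ) (C ε δ : ℝ) (m : Point d → Fin k → ℝ)
          (Dx : Measure (Point d)) (E : Measure (Fin k → ℝ))
          [IsProbabilityMeasure Dx] [IsProbabilityMeasure E],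
        1 ≤ r → 1 ≤ C → 0 < ε → 0 < δ → 2 * δ ≤ d →
        (∀ x i, m x i ∈ Set.Icc (0 : ℝ) 1) →
        IsBoundedCenteredNoise E →
        (∀ i, IsSparse r fun x => m x i) →
        -- Level-Splits
        ((∀ i, ApproxSubmodular C (fun x => m x i) Dx) →
          (softO K p (rateGeneral 2 d k r C ε δ) ≤ n →
            ∀ H : ℕ, IsDepth (logLeaves 2 d n r C δ) H →
              sampleLaw m Dx E n {ω | ε < risk m Dx (levelSplitsEstimate H ω)}
                ≤ ENNReal.ofReal δ) ∧
          (IsProductLaw Dx → softO K p (rateLevelProduct d k r C ε δ) ≤ n →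
            ∀ H : ℕ, IsDepth r H →
              sampleLaw m Dx E n {ω | ε < risk m Dx (levelSplitsEstimate H ω)}
                ≤ ENNReal.ofReal δ)) ∧
        -- Breiman
        ((∀ i, ApproxDiminishingReturns C (fun x => m x i) Dx) →
          (softO K p (rateGeneral 3 d k r C ε δ) ≤ n →
            ∀ t : ℕ, IsLeafBudget K (logLeaves 3 d n r C δ) d k n r C ε δ t →
              sampleLaw m Dx E n {ω | ε < risk m Dx (breimanEstimate t ω)}
                ≤ ENNReal.ofReal δ) ∧
          (IsProductLaw Dx → softO K p (rateBreimanProduct d k r C ε δ) ≤ n →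
            ∀ t : ℕ, IsLeafBudget K r d k n r C ε δ t →
              sampleLaw m Dx E n {ω | ε < risk m Dx (breimanEstimate t ω)}
                ≤ ENNReal.ofReal δ))) ∧
      -- running time
      (∀ (r : ℕ) (C : ℝ), 1 ≤ r → 1 ≤ C → ∃ a : ℕ,
        ∀ (d k n : ℕ) (ε δ : ℝ) (ω : ScoreData d k n), 0 < ε → 0 < δ → 2 * δ ≤ d →
          (n = ⌈softO K p (rateGeneral 2 d k r C ε δ)⌉₊ →
            ∀ H : ℕ, IsDepth (logLeaves 2 d n r C δ) H →
              ((learnLevelSplits H ω).steps : ℝ)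
                ≤ a * (d + k + 1 / ε + Real.logb 2 (2 + 1 / δ)) ^ a) ∧
          (n = ⌈softO K p (rateLevelProduct d k r C ε δ)⌉₊ →
            ∀ H : ℕ, IsDepth r H →
              ((learnLevelSplits H ω).steps : ℝ)
                ≤ a * (d + k + 1 / ε + Real.logb 2 (2 + 1 / δ)) ^ a) ∧
          (n = ⌈softO K p (rateGeneral 3 d k r C ε δ)⌉₊ →
            ∀ t : ℕ, IsLeafBudget K (logLeaves 3 d n r C δ) d k n r C ε δ t →
              ((learnBreiman t ω).steps : ℝ)
                ≤ a * (d + k + 1 / ε + Real.logb 2 (2 + 1 / δ)) ^ a) ∧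
          (n = ⌈softO K p (rateBreimanProduct d k r C ε δ)⌉₊ →
            ∀ t : ℕ, IsLeafBudget K r d k n r C ε δ t →
              ((learnBreiman t ω).steps : ℝ)
                ≤ a * (d + k + 1 / ε + Real.logb 2 (2 + 1 / δ)) ^ a)) := by
  -- Opaque, so that nothing ever evaluates `M ^ (M + 3)`.
  obtain ⟨M, hM⟩ : ∃ M : ℕ, 10000 ≤ M := ⟨10000, le_rfl⟩
  have hM' : (1 : ℝ) ≤ M := by exact_mod_cast (by omega : 1 ≤ M)
  have hK1 : (1 : ℝ) ≤ (M : ℝ) ^ (M + 3) := one_le_pow₀ hM'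
  refine ⟨(M : ℝ) ^ (M + 3), 4, hK1, ?_, ?_⟩
  · intro d k n r C ε δ m Dx E _ _ hr hC hε hδ hd hm hE hs
    refine ⟨fun hV => ⟨fun hn H hH => ?_, fun hDx hn H hH => ?_⟩,
      fun hV => ⟨fun hn t ht => ?_, fun hDx hn t ht => ?_⟩⟩
    · exact levelSplits_general hM le_rfl hr hC hε hδ hd hm hE hs hV hn hH
    · exact levelSplits_product hM le_rfl hr hC hε hδ hd hm hE hs hV hDx hn hH
    · exact breiman_general hM le_rfl hr hC hε hδ hd hm hE hs hV hn ht
    · exact breiman_product hM le_rfl hr hC hε hδ hd hm hE hs hV hDx hn ht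
  · intro r C hr hC
    have hK0 : (0 : ℝ) ≤ (M : ℝ) ^ (M + 3) := by linarith
    obtain ⟨a₁, h₁⟩ := exists_steps_le hK0 4 r (exists_rateGeneral_le r C hr hC zero_le_two)
    obtain ⟨a₂, h₂⟩ := exists_steps_le hK0 4 r (exists_rateLevelProduct_le r hC)
    obtain ⟨a₃, h₃⟩ := exists_steps_le hK0 4 r (exists_rateGeneral_le r C hr hC zero_le_three)
    obtain ⟨a₄, h₄⟩ := exists_steps_le hK0 4 r (exists_rateBreimanProduct_le r hC)
    have h2r : r + 1 ≤ 2 ^ (r + 1) := Nat.lt_two_pow_self.le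
    have h2r' : 2 ≤ 2 ^ (r + 1) := le_self_pow₀ one_le_two (by omega)
    refine ⟨a₁ + a₂ + a₃ + a₄, fun d k n ε δ ω hε hδ hd => ?_⟩
    have hZ := one_le_size (d := d) (k := k) hδ hε
    refine ⟨fun hn H hH => ?_, fun hn H hH => ?_, fun hn t ht => ?_, fun hn t ht => ?_⟩
    · have hH' := hH.le_of_logLeaves hr hC zero_le_two hδ hd
      exact (h₁ d k n ε δ ω hε hδ hd hn H (by omega)).1.trans
        (mul_pow_le_mul_pow_of_le (by omega) hZ)
    · have hH' := hH.2
      rw [Nat.ceil_natCast] at hH'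
      exact (h₂ d k n ε δ ω hε hδ hd hn H (by omega)).1.trans
        (mul_pow_le_mul_pow_of_le (by omega) hZ)
    · have ht' := ht.le_of_logLeaves hr hC zero_le_three hδ hd
      exact (h₃ d k n ε δ ω hε hδ hd hn t (by omega)).2.trans
        (mul_pow_le_mul_pow_of_le (by omega) hZ)
    · exact (h₄ d k n ε δ ω hε hδ hd hn t ht.le_of_natCast).2.trans
        (mul_pow_le_mul_pow_of_le (by omega) hZ)
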